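/- Let $\bar{\mathcal M}$ be a compact smooth $n$-dimensional manifold with boundary, the boundary being the disjoint union of two closed sets $\partial_\infty\mathcal M$ (the boundary at infinity) and $\partial\mathcal M$ (a possibly empty inner boundary). Let $\mathring h$ be a smooth Riemannian metric on $\bar{\mathcal M}$ and let $\rho\in C^\infty(\bar{\mathcal M})$ satisfy $\rho\ge 0$, $\{\rho=0\}=\partial_\infty\mathcal M$, $d\rho\neq 0$ on $\partial_\infty\mathcal M$ and $|d\rho|_{\mathring h}=1$ on $\partial_\infty\mathcal M$; so $\mathring g=\rho^{-2}\mathring h$ is an asymptotically hyperbolic metric on $\mathcal M=\{\rho>0\}$. Denote by $\mathring\nabla$ its Levi-Civita connection and by $d\mu(\mathring g)$ its Riemannian measure. For a function $N$ put $$\mathring T(N)=\mathring\nabla^2N-N\mathring g .$$ For $R\in\mathbb R$ let $E_R=\{x\in\mathcal M:\rho(x)\le e^{-2R}\}$, and let $C_c^\infty(E_R)$ be the set of functions $N$ that are smooth on $E_R$ up to its inner boundary $\{\rho=e^{-2R}\}$ (i.e. smooth on a neighbourhood of $E_R$ in $\mathcal M$) and vanish on $E_R$ outside a compact subset of $E_R$;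 they need not vanish on $\{\rho=e^{-2R}\}$. For a tensor field $u$ and $s\in\mathbb R$ put $$\|u\|_{2,s;E_R}=\Big(\int_{E_R}|u|_{\mathring g}^2\,\rho^{2s}\,d\mu(\mathring g)\Big)^{1/2},\qquad \|N\|_{2,2,s;E_R}=\sum_{j=0}^{2}\|\mathring\nabla^jN\|_{2,s;E_R}.$$ Then for every $\delta\in\left(-\tfrac{n+1}{2},-1\right)$ there exist $R_\delta>0$ and $c>0$, depending only on $(\bar{\mathcal M},\mathring h,\rho)$ and $\delta$, such that for all $R>R_\delta$ and all $N\in C_c^\infty(E_R)$ $$\|N\|_{2,2,-\delta;E_R}\le c\,\|\mathring T(N)\|_{2,-\delta;E_R}.$$ -/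

import Mathlib

open Set Filter Topology MeasureTheory Matrix
open scoped Manifold ContDiff ENNReal NNReal

noncomputable section

namespace AsympHyp

/-! ### Riemannian geometry in the charts of a manifold with boundary

Throughout, `M` is a manifold with boundary of dimension `n`, and a (possibly singular) metric on
`M` is a field `g` of bilinear forms on the tangent spaces. All objects are first written in
the coordinates given by the chart `extChartAt (𝓡∂ n) p` based at a point `p`, as functions of the
coordinate point `y`. The value at `x : M` of a tensorial quantity is then computed at
`p = x`, `y = extChartAt (𝓡∂ n) x x`, that is, in the preferred chart at `x`. -/

section Coordinates

variable {n : ℕ} [NeZero n] {M : Type*} [TopologicalSpace M]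
  [ChartedSpace (EuclideanHalfSpace n) M]

variable (n M) in
/-- A field of bilinear forms on the tangent spaces of `M`. -/
abbrev BilinField : Type _ :=
  ∀ x : M, TangentSpace (𝓡∂ n) x →L[ℝ] TangentSpace (𝓡∂ n) x →L[ℝ] ℝ

/-- The partial derivative `∂_i F` of a function of the coordinates. It is taken within the range
of the model (a half-space), so that it also makes sense at boundary points; at the
other points it is the usual partial derivative. -/
def pderiv (i : Fin n) (F : EuclideanSpace ℝ (Fin n) → ℝ) (y : EuclideanSpace ℝ (Fin n)) : ℝ :=
  fderivWithin ℝ F (range (𝓡∂ n)) y (EuclideanSpace.single i 1)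

/-- The function `f` read in the chart based at `p`. -/
def inChart (p : M) (f : M → ℝ) (y : EuclideanSpace ℝ (Fin n)) : ℝ :=
  f ((extChartAt (𝓡∂ n) p).symm y)

/-- The coordinate vector field `∂_i` of the chart based at `p`, at the point of
coordinates `y`. -/
def coordVec (p : M) (i : Fin n) (y : EuclideanSpace ℝ (Fin n)) :
    TangentSpace (𝓡∂ n) ((extChartAt (𝓡∂ n) p).symm y) :=
  mfderivWithin 𝓘(ℝ, EuclideanSpace ℝ (Fin n)) (𝓡∂ n) (extChartAt (𝓡∂ n) p).symm
    (range (𝓡∂ n)) y (EuclideanSpace.single i (1 : ℝ) : EuclideanSpace ℝ (Fin n))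

/-- The matrix `g_ij = g(∂_i, ∂_j)` of the metric in the chart based at `p`. -/
def gram (g : BilinField n M) (p : M) (y : EuclideanSpace ℝ (Fin n)) :
    Matrix (Fin n) (Fin n) ℝ :=
  Matrix.of fun i j =>
    g ((extChartAt (𝓡∂ n) p).symm y) (coordVec p i y) (coordVec p j y)

/-- The Christoffel symbols
`Γ^k_ij = 1/2 ∑_l g^{kl} (∂_i g_jl + ∂_j g_il - ∂_l g_ij)` of the Levi-Civita connection. -/
def christoffel (g : BilinField n M) (p : M) (k i j : Fin n)
    (y : EuclideanSpace ℝ (Fin n)) : ℝ :=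
  (1 / 2) * ∑ l, (gram g p y)⁻¹ k l *
    (pderiv i (fun z => gram g p z j l) y + pderiv j (fun z => gram g p z i l) y
      - pderiv l (fun z => gram g p z i j) y)

/-- The components `∂_i f` of the differential of `f`. -/
def differential (f : M → ℝ) (p : M) (y : EuclideanSpace ℝ (Fin n)) : Fin n → ℝ :=
  fun i => pderiv i (inChart p f) y

/-- The components `∇²_ij f = ∂_i ∂_j f - ∑_k Γ^k_ij ∂_k f` of the Hessian of `f`. -/
def hessian (g : BilinField n M) (f : M → ℝ) (p : M) (y : EuclideanSpace ℝ (Fin n)) :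
    Matrix (Fin n) (Fin n) ℝ :=
  Matrix.of fun i j => pderiv i (pderiv j (inChart p f)) y
    - ∑ k, christoffel g p k i j y * pderiv k (inChart p f) y

/-- The components of the Hessian-type operator `T(f) = ∇² f - f g`. -/
def hessT (g : BilinField n M) (f : M → ℝ) (p : M) (y : EuclideanSpace ℝ (Fin n)) :
    Matrix (Fin n) (Fin n) ℝ :=
  hessian g f p y - inChart p f y • gram g p y

/-- The squared norm `∑ g^{ij} w_i w_j` of a covector. -/
def covectorNormSq (G : Matrix (Fin n) (Fin n) ℝ) (w : Fin n → ℝ) : ℝ :=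
  ∑ i, ∑ j, G⁻¹ i j * w i * w j

/-- The squared norm `∑ g^{ik} g^{jl} S_ij S_kl` of a covariant 2-tensor. -/
def tensorNormSq (G S : Matrix (Fin n) (Fin n) ℝ) : ℝ :=
  ∑ i, ∑ j, ∑ k, ∑ l, G⁻¹ i k * G⁻¹ j l * S i j * S k l

/-- The pointwise norm `|df|_g` at `x`. -/
def differentialNorm (g : BilinField n M) (f : M → ℝ) (x : M) : ℝ :=
  √(covectorNormSq (gram g x (extChartAt (𝓡∂ n) x x)) (differential f x (extChartAt (𝓡∂ n) x x)))

/-- The pointwise norm `|∇² f|_g` at `x`. -/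
def hessianNorm (g : BilinField n M) (f : M → ℝ) (x : M) : ℝ :=
  √(tensorNormSq (gram g x (extChartAt (𝓡∂ n) x x)) (hessian g f x (extChartAt (𝓡∂ n) x x)))

/-- The pointwise norm `|T(f)|_g` at `x`. -/
def hessTNorm (g : BilinField n M) (f : M → ℝ) (x : M) : ℝ :=
  √(tensorNormSq (gram g x (extChartAt (𝓡∂ n) x x)) (hessT g f x (extChartAt (𝓡∂ n) x x)))

/-- The measure `√(det g_ij) dy` on the domain of the chart based at `p`, as a measure on `M`
(it vanishes outside of that domain). -/
def chartMeasure [MeasurableSpace M] (g : BilinField n M) (p : M) : Measure M :=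
  Measure.map (extChartAt (𝓡∂ n) p).symm
    ((volume.restrict (extChartAt (𝓡∂ n) p).target).withDensity
      fun y => ENNReal.ofReal √(gram g p y).det)

/-- The Riemannian measure `dμ(g)`. By the change of variables formula the measures
`chartMeasure g p` agree on the overlaps of the charts; the measure on `M` which they
glue to is the least measure which is bounded below by all of them. -/
def riemannianMeasure [MeasurableSpace M] (g : BilinField n M) : Measure M :=
  ⨆ p : M, chartMeasure g p

end Coordinates

/-! ### Asymptotically hyperbolic manifolds -/

/-- The data of an asymptotically hyperbolic metric `ρ⁻² h` on the set `{ρ > 0}` of a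
manifold with boundary `M` (which is assumed to be compact wherever this structure is used;
`M` is the compactification, including the boundary at infinity `{ρ = 0}`). The boundary of `M` is
the disjoint union of the boundary at infinity and of an inner boundary, which
may be empty. -/
structure AHManifold (n : ℕ) [NeZero n] (M : Type*) [TopologicalSpace M]
    [ChartedSpace (EuclideanHalfSpace n) M] [IsManifold (𝓡∂ n) ∞ M] where
  /-- The conformal compactification of the metric, smooth up to the boundary. -/
  h : Bundle.ContMDiffRiemannianMetric (𝓡∂ n) ∞ (EuclideanSpace ℝ (Fin n))
    (fun x : M => TangentSpace (𝓡∂ n) x)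
  /-- The defining function of the boundary at infinity. -/
  ρ : M → ℝ
  ρ_smooth : ContMDiff (𝓡∂ n) 𝓘(ℝ) ∞ ρ
  ρ_nonneg : ∀ x, 0 ≤ ρ x
  boundary_of_ρ_eq_zero : ∀ x, ρ x = 0 → x ∈ (𝓡∂ n).boundary M
  isClosed_innerBoundary : IsClosed ((𝓡∂ n).boundary M ∩ {x | 0 < ρ x})
  dρ_ne_zero : ∀ x, ρ x = 0 → mfderiv (𝓡∂ n) 𝓘(ℝ) ρ x ≠ 0
  /-- `|dρ|_h = 1` on the boundary at infinity. -/
  dρ_norm : ∀ x, ρ x = 0 → differentialNorm h.inner ρ x = 1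

namespace AHManifold

variable {n : ℕ} [NeZero n] {M : Type*} [TopologicalSpace M]
  [ChartedSpace (EuclideanHalfSpace n) M] [IsManifold (𝓡∂ n) ∞ M]

/-- The asymptotically hyperbolic metric `g = ρ⁻² h`, meaningful on `{ρ > 0}`. -/
def g (A : AHManifold n M) : BilinField n M :=
  fun x => ((A.ρ x) ^ 2)⁻¹ • A.h.inner x

/-- The neighbourhood of infinity `E_R = {ρ ≤ e^{-2R}}` (the points at infinity are not part of
the manifold, so they are left out). -/
def E (A : AHManifold n M) (R : ℝ) : Set M :=
  {x | 0 < A.ρ x ∧ A.ρ x ≤ Real.exp (-2 * R)}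

/-- `N ∈ C_c^∞(E_R)`: `N` is smooth on `E_R` up to its inner boundary (that is, it is smooth in a
neighbourhood of `E_R`), and vanishes on `E_R` outside of a compact subset of `E_R`. It does not
have to vanish on the inner boundary `{ρ = e^{-2R}}`. -/
def IsTest (A : AHManifold n M) (R : ℝ) (N : M → ℝ) : Prop :=
  (∃ U : Set M, IsOpen U ∧ A.E R ⊆ U ∧ ContMDiffOn (𝓡∂ n) 𝓘(ℝ) ∞ N U) ∧
    ∃ K : Set M, IsCompact K ∧ K ⊆ A.E R ∧ ∀ x ∈ A.E R, x ∉ K → N x = 0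

variable [MeasurableSpace M]

/-- The weighted norm `(∫_U |u|_g² ρ^{2s} dμ(g))^{1/2}` of a tensor field `u` whose pointwise norm
is `x ↦ u x`. -/
def normL2 (A : AHManifold n M) (s : ℝ) (U : Set M) (u : M → ℝ) : ℝ≥0∞ :=
  eLpNorm (fun x => A.ρ x ^ s * u x) 2 ((riemannianMeasure A.g).restrict U)

/-- The weighted Sobolev norm `‖f‖_{2,2,s;U}`: the sum of the weighted `L²` norms of `f`, `∇f`
and `∇²f`. -/
def normW22 (A : AHManifold n M) (s : ℝ) (U : Set M) (f : M → ℝ) : ℝ≥0∞ :=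
  A.normL2 s U (fun x => |f x|) + A.normL2 s U (differentialNorm A.g f)
    + A.normL2 s U (hessianNorm A.g f)

end AHManifold

end AsympHyp

end

/-!
Why the weighted estimate holds. Let `τ = 1 / ρ`. The formula for the Hessian under a conformal
change of the metric (`IsMetricAt.coordHess_inv_conformal`), the smoothness of `h` and `ρ` up to
the boundary and `|dρ|_h = 1` at infinity show that, near infinity, `∇²τ = τ (g + o(1))` and
`|dτ|² = τ² (1 + o(1))` (`AHManifold.exists_collar`). So `τ` nearly solves `T(τ) = 0`, and in the
model case, where it does, any other solution `N` has the property that `u = τ⁻¹ ⟨dτ, dN⟩ - N` is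
constant along the level sets of `τ`.

Let `A = |dτ|²` and `b = τ⁻¹ ⟨dτ, dN⟩ = u + N`. For a smooth nondecreasing `χ` of `τ`, which
vanishes for small `τ`, the divergence theorem (`IsRiemannianOn.green`) is applied to the fields
`χ(τ) τ^{2δ-2} u (A ∇N - ⟨dτ, dN⟩ ∇τ)`, `χ(τ) τ^{2δ-2} N (A ∇N - ⟨dτ, dN⟩ ∇τ)` and
`χ(τ) τ^{2δ-1} N² ∇τ`. The first two are orthogonal to `∇τ`, so their divergence contains no
derivative of `χ` (`IsRiemannianOn.integrand_orthogonal`); in that of the third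
(`IsRiemannianOn.integrand_radial`) the term with `χ'` is nonnegative. This sign is the reason why
`N` need not vanish on the inner boundary of `E_R`. Up to terms with a factor `o(1)` or `T(N)`, and
up to the weight `χ(τ) τ^{2δ}`, the three divergences are

* `-(n - 1) u²`,
* `|dN|² - (n - 1) N u - (u + N)²`,
* `(n + 1 + 2δ) N² + 2 N u`, where the term with `χ'` is left out.

Minus a large multiple of the first, plus a small multiple of the second, plus the third is
coercive in `(N, dN)` when `n ≥ 2` and `n + 1 + 2δ > 0`
(`quadratic_form_lower_bound`, `exists_pointwise_bound`). The range of `δ` is the interval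
`(-(n + 1) / 2, -1)`: the second condition is its lower end, the first holds since it is nonempty.
The error terms are absorbed for `R` large. When `χ` decreases to the indicator function of `E_R`
(`IsRiemannianOn.tendsto_integral_cutoff`), the result is the weighted `L²` bound of `N` and `dN`
by `T(N)` (`AHManifold.exists_integral_le`). The Hessian is then controlled pointwise, as
`|∇²N| ≤ |T(N)| + √n |N|` (`IsRiemannianOn.hessianNorm_le`).

The geometric objects are given in coordinates, each at a point in the chart based at that point, so
that the transformation laws under a change of coordinates are proved along the way. The divergence
theorem is reduced by a partition of unity to integration by parts in one chart, where the
Riemannian measure is `√(det g_ij) dy` (`IsRiemannianOn.restrict_riemannianMeasure`). As `E_R` is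
disjoint from the boundary of the manifold when `R` is large, all of this is needed only in the
interior.
-/

noncomputable section

set_option linter.unusedSectionVars false

namespace AsympHyp

/-! ### Calculus in coordinates -/

/-- The coordinate space of an `n`-dimensional manifold. -/
abbrev Coord (n : ℕ) : Type := EuclideanSpace ℝ (Fin n)

section CoordinateCalculus

variable {n : ℕ} [NeZero n]

variable (n) in
/-- The coordinate points which are interior to the half-space of the model. -/
def interiorCoords : Set (Coord n) := interior (range (𝓡∂ n))

lemma isOpen_interiorCoords : IsOpen (interiorCoords n) := isOpen_interior

variable {y : Coord n} {i j : Fin n} {F H : Coord n → ℝ}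

lemma pderiv_eq_fderiv (hy : y ∈ interiorCoords n) (i : Fin n) (F : Coord n → ℝ) :
    pderiv i F y = fderiv ℝ F y (EuclideanSpace.single i 1) := by
  unfold pderiv
  rw [fderivWithin_of_mem_nhds (mem_interior_iff_mem_nhds.1 hy)]

lemma pderiv_congr (h : F =ᶠ[𝓝 y] H) (i : Fin n) :
    pderiv i F y = pderiv i H y := by
  unfold pderiv
  rw [(h.filter_mono nhdsWithin_le_nhds).fderivWithin_eq h.self_of_nhds]

lemma pderiv_eventuallyEq (h : F =ᶠ[𝓝 y] H) (i : Fin n) :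
    pderiv i F =ᶠ[𝓝 y] pderiv i H :=
  h.eventuallyEq_nhds.mono fun _ hz => pderiv_congr hz i

lemma contDiffAt_pderiv (hy : y ∈ interiorCoords n) (hF : ContDiffAt ℝ ∞ F y) (i : Fin n) :
    ContDiffAt ℝ ∞ (pderiv i F) y := by
  have h1 : ContDiffAt ℝ ∞ (fun z => fderiv ℝ F z (EuclideanSpace.single i 1)) y :=
    (hF.fderiv_right (m := ∞) (by simp)).clm_apply contDiffAt_const
  refine h1.congr_of_eventuallyEq ?_
  filter_upwards [isOpen_interiorCoords.mem_nhds hy] with z hz using pderiv_eq_fderiv hz i F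

lemma pderiv_const (hy : y ∈ interiorCoords n) (i : Fin n) (c : ℝ) : pderiv i (fun _ => c) y = 0 := by
  simp [pderiv_eq_fderiv hy]

lemma pderiv_sub (hy : y ∈ interiorCoords n) (hF : DifferentiableAt ℝ F y) (hH : DifferentiableAt ℝ H y) :
    pderiv i (fun z => F z - H z) y = pderiv i F y - pderiv i H y := by
  simp only [pderiv_eq_fderiv hy]
  rw [fderiv_fun_sub hF hH]; rfl

lemma pderiv_mul (hy : y ∈ interiorCoords n) (hF : DifferentiableAt ℝ F y) (hH : DifferentiableAt ℝ H y) :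
    pderiv i (fun z => F z * H z) y = F y * pderiv i H y + H y * pderiv i F y := by
  simp only [pderiv_eq_fderiv hy]
  rw [fderiv_fun_mul hF hH]; simp

lemma pderiv_sum (hy : y ∈ interiorCoords n) {ι : Type*} (s : Finset ι) {F : ι → Coord n → ℝ}
    (hF : ∀ k ∈ s, DifferentiableAt ℝ (F k) y) :
    pderiv i (fun z => ∑ k ∈ s, F k z) y = ∑ k ∈ s, pderiv i (F k) y := by
  simp only [pderiv_eq_fderiv hy]
  rw [fderiv_fun_sum hF]; simp

/-- The chain rule for `f ∘ F` with `f` a function of one variable. -/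
lemma pderiv_comp (hy : y ∈ interiorCoords n) {f : ℝ → ℝ} (hf : DifferentiableAt ℝ f (F y))
    (hF : DifferentiableAt ℝ F y) :
    pderiv i (fun z => f (F z)) y = deriv f (F y) * pderiv i F y := by
  simp only [pderiv_eq_fderiv hy]
  have := (hf.hasDerivAt.comp_hasFDerivAt y hF.hasFDerivAt).fderiv
  simp only [Function.comp_def] at this
  rw [this]; simp

lemma pderiv_comm (hy : y ∈ interiorCoords n) (hF : ContDiffAt ℝ ∞ F y) (i j : Fin n) :
    pderiv i (pderiv j F) y = pderiv j (pderiv i F) y := by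
  have key : ∀ i j : Fin n, pderiv i (pderiv j F) y
      = fderiv ℝ (fderiv ℝ F) y (EuclideanSpace.single i 1) (EuclideanSpace.single j 1) := by
    intro i j
    have h1 : pderiv j F =ᶠ[𝓝 y] fun z => fderiv ℝ F z (EuclideanSpace.single j 1) := by
      filter_upwards [isOpen_interiorCoords.mem_nhds hy] with z hz using pderiv_eq_fderiv hz j F
    rw [pderiv_congr h1, pderiv_eq_fderiv hy]
    have h2 : DifferentiableAt ℝ (fderiv ℝ F) y :=
      (hF.fderiv_right (m := ∞) (by simp)).differentiableAt (by simp)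
    rw [fderiv_clm_apply h2 (by fun_prop)]
    simp
  rw [key, key]
  exact (hF.isSymmSndFDerivAt (by simp; exact WithTop.coe_le_coe.2 le_top)) _ _

lemma fderiv_apply_eq_sum (hy : y ∈ interiorCoords n) (F : Coord n → ℝ) (v : Coord n) :
    fderiv ℝ F y v = ∑ i, v i * pderiv i F y := by
  conv_lhs => rw [show v = ∑ i, v i • EuclideanSpace.single i (1 : ℝ) by
    ext k; simp [Pi.single_apply]]
  rw [map_sum]
  simp [pderiv_eq_fderiv hy]

/-- The Jacobian matrix `∂_i φ^a` of a map of the coordinates. -/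
def jac (φ : Coord n → Coord n) (y : Coord n) : Matrix (Fin n) (Fin n) ℝ :=
  Matrix.of fun a i => pderiv i (fun z => φ z a) y

lemma fderiv_single_apply (hy : y ∈ interiorCoords n) {φ : Coord n → Coord n}
    (hφ : DifferentiableAt ℝ φ y) (a i : Fin n) :
    (fderiv ℝ φ y (EuclideanSpace.single i 1)) a = jac φ y a i := by
  have : fderiv ℝ (fun z => φ z a) y = (EuclideanSpace.proj a : Coord n →L[ℝ] ℝ) ∘L fderiv ℝ φ y :=
    ((EuclideanSpace.proj a : Coord n →L[ℝ] ℝ).hasFDerivAt.comp y hφ.hasFDerivAt).fderiv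
  simp only [jac, of_apply]
  rw [pderiv_eq_fderiv hy]
  rw [this]; rfl

/-- The chain rule for a change of coordinates. -/
lemma pderiv_comp_map {φ : Coord n → Coord n} (hy : y ∈ interiorCoords n) (hφy : φ y ∈ interiorCoords n)
    (hφ : DifferentiableAt ℝ φ y) (hF : DifferentiableAt ℝ F (φ y)) (i : Fin n) :
    pderiv i (fun z => F (φ z)) y = ∑ a, jac φ y a i * pderiv a F (φ y) := by
  have := (hF.hasFDerivAt.comp y hφ.hasFDerivAt).fderiv
  simp only [Function.comp_def] at this
  rw [pderiv_eq_fderiv hy, this, ContinuousLinearMap.comp_apply, fderiv_apply_eq_sum hφy]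
  simp only [fderiv_single_apply hy hφ]

/-! ### Metrics, Hessians and gradients in coordinates -/

/-- The Christoffel symbols of a matrix field. -/
def coordChristoffel (G : Coord n → Matrix (Fin n) (Fin n) ℝ) (k i j : Fin n) (y : Coord n) : ℝ :=
  (1 / 2) * ∑ l, (G y)⁻¹ k l *
    (pderiv i (fun z => G z j l) y + pderiv j (fun z => G z i l) y - pderiv l (fun z => G z i j) y)

/-- The Hessian of a function of the coordinates. -/
def coordHess (G : Coord n → Matrix (Fin n) (Fin n) ℝ) (f : Coord n → ℝ) (y : Coord n) :
    Matrix (Fin n) (Fin n) ℝ :=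
  Matrix.of fun i j => pderiv i (pderiv j f) y - ∑ k, coordChristoffel G k i j y * pderiv k f y

/-- The differential of a function of the coordinates. -/
def coordDiff (f : Coord n → ℝ) (y : Coord n) : Fin n → ℝ := fun i => pderiv i f y

/-- The inner product of the differentials of two functions of the coordinates. -/
def coordInner (G : Coord n → Matrix (Fin n) (Fin n) ℝ) (a b : Coord n → ℝ) (y : Coord n) : ℝ :=
  ∑ i, ∑ j, (G y)⁻¹ i j * coordDiff a y i * coordDiff b y j

/-- The gradient of a function of the coordinates. -/
def coordGrad (G : Coord n → Matrix (Fin n) (Fin n) ℝ) (f : Coord n → ℝ) (y : Coord n) :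
    Fin n → ℝ := (G y)⁻¹ *ᵥ coordDiff f y

/-- `G` is a smooth field of positive definite matrices near the point `y`, which is interior to
the half-space of the model. -/
structure IsMetricAt (G : Coord n → Matrix (Fin n) (Fin n) ℝ) (y : Coord n) : Prop where
  mem : y ∈ interiorCoords n
  contDiffAt' : ∀ᶠ z in 𝓝 y, ∀ i j, ContDiffAt ℝ ∞ (fun z => G z i j) z
  posDef : ∀ᶠ z in 𝓝 y, (G z).PosDef

variable {G : Coord n → Matrix (Fin n) (Fin n) ℝ}

lemma IsMetricAt.contDiffAt (h : IsMetricAt G y) (i j : Fin n) :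
    ContDiffAt ℝ ∞ (fun z => G z i j) y := h.contDiffAt'.self_of_nhds i j

lemma IsMetricAt.eventually (h : IsMetricAt G y) : ∀ᶠ z in 𝓝 y, IsMetricAt G z := by
  filter_upwards [h.contDiffAt'.eventually_nhds, h.posDef.eventually_nhds, isOpen_interiorCoords.mem_nhds h.mem] with z a b c
  exact ⟨c, a, b⟩

lemma contDiffAt_det {G : Coord n → Matrix (Fin n) (Fin n) ℝ}
    (h : ∀ i j, ContDiffAt ℝ ∞ (fun z => G z i j) y) : ContDiffAt ℝ ∞ (fun z => (G z).det) y := by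
  simp only [Matrix.det_apply']
  refine ContDiffAt.sum fun σ _ => contDiffAt_const.mul ?_
  exact contDiffAt_prod fun i _ => h _ _

lemma IsMetricAt.contDiffAt_inv (h : IsMetricAt G y) (i j : Fin n) :
    ContDiffAt ℝ ∞ (fun z => (G z)⁻¹ i j) y := by
  have hdet : (G y).det ≠ 0 := h.posDef.self_of_nhds.det_pos.ne'
  simp only [Matrix.inv_def, Matrix.smul_apply, Ring.inverse_eq_inv', smul_eq_mul]
  refine ((contDiffAt_det h.contDiffAt).inv hdet).mul ?_
  simp only [Matrix.adjugate_apply]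
  refine contDiffAt_det fun k l => ?_
  by_cases hk : k = j
  · subst hk; simp only [updateRow_self]; exact contDiffAt_const
  · simp only [updateRow_ne hk]; exact h.contDiffAt _ _

lemma _root_.ContDiffAt.diff {F : Coord n → ℝ} (h : ContDiffAt ℝ ∞ F y) : DifferentiableAt ℝ F y :=
  h.differentiableAt (by simp)

lemma IsMetricAt.symm (h : IsMetricAt G y) (i j : Fin n) : G y i j = G y j i :=
  by simpa using (h.posDef.self_of_nhds.isHermitian.apply j i)

lemma IsMetricAt.inv_symm (h : IsMetricAt G y) (i j : Fin n) : (G y)⁻¹ i j = (G y)⁻¹ j i :=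
  by simpa using (h.posDef.self_of_nhds.isHermitian.inv.apply j i)

lemma IsMetricAt.pderiv_symm (h : IsMetricAt G y) (k i j : Fin n) :
    pderiv k (fun z => G z i j) y = pderiv k (fun z => G z j i) y :=
  pderiv_congr (h.eventually.mono fun _ hz => hz.symm i j) k

lemma IsMetricAt.isUnit_det (h : IsMetricAt G y) : IsUnit (G y).det :=
  h.posDef.self_of_nhds.det_pos.ne'.isUnit

/-- The derivative of the inverse of a metric: `∂_k g^{ij} = - g^{ia} (∂_k g_ab) g^{bj}`. -/
lemma IsMetricAt.pderiv_inv (h : IsMetricAt G y) (k i j : Fin n) :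
    pderiv k (fun z => (G z)⁻¹ i j) y
      = - ((G y)⁻¹ * (Matrix.of fun a b => pderiv k (fun z => G z a b) y) * (G y)⁻¹) i j := by
  let X : Matrix (Fin n) (Fin n) ℝ := Matrix.of fun a b => pderiv k (fun z => (G z)⁻¹ a b) y
  let D : Matrix (Fin n) (Fin n) ℝ := Matrix.of fun a b => pderiv k (fun z => G z a b) y
  have h0 : X * G y + (G y)⁻¹ * D = 0 := by
    ext a b
    have e1 : (fun z => ∑ m, (G z)⁻¹ a m * G z m b)
        =ᶠ[𝓝 y] fun _ => (1 : Matrix (Fin n) (Fin n) ℝ) a b := by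
      filter_upwards [h.eventually] with z hz
      rw [← Matrix.nonsing_inv_mul _ hz.isUnit_det, Matrix.mul_apply]
    have e2 := pderiv_congr e1 k
    rw [pderiv_const h.mem, pderiv_sum h.mem] at e2
    · rw [Matrix.add_apply, Matrix.mul_apply, Matrix.mul_apply, Matrix.zero_apply,
        ← Finset.sum_add_distrib, ← e2]
      refine Finset.sum_congr rfl fun m _ => ?_
      rw [pderiv_mul h.mem (h.contDiffAt_inv _ _).diff (h.contDiffAt _ _).diff]
      change pderiv k (fun z => (G z)⁻¹ a m) y * _ + _ * pderiv k (fun z => G z m b) y = _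
      ring
    · exact fun m _ => ((h.contDiffAt_inv _ _).mul (h.contDiffAt _ _)).diff
  have h1 : X = - ((G y)⁻¹ * D * (G y)⁻¹) := by
    have := congrArg (· * (G y)⁻¹) h0
    simp only [add_mul, zero_mul, Matrix.mul_nonsing_inv_cancel_right _ _ h.isUnit_det] at this
    exact eq_neg_of_add_eq_zero_left this
  exact congrFun (congrFun h1 i) j

/-- The contraction of the Christoffel symbols with a differential, in terms of the gradient. -/
lemma IsMetricAt.sum_christoffel (h : IsMetricAt G y) (a : Coord n → ℝ) (i j : Fin n) :
    ∑ k, coordChristoffel G k i j y * pderiv k a y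
      = (1 / 2) * ∑ l, coordGrad G a y l * (pderiv i (fun z => G z j l) y
          + pderiv j (fun z => G z i l) y - pderiv l (fun z => G z i j) y) := by
  simp only [coordChristoffel, coordGrad, mulVec, dotProduct, Finset.mul_sum, Finset.sum_mul]
  rw [Finset.sum_comm]
  refine Finset.sum_congr rfl fun l _ => Finset.sum_congr rfl fun k _ => ?_
  rw [h.inv_symm l k, coordDiff]
  ring

lemma IsMetricAt.coordHess_symm (h : IsMetricAt G y) {f : Coord n → ℝ} (hf : ContDiffAt ℝ ∞ f y)
    (i j : Fin n) : coordHess G f y i j = coordHess G f y j i := by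
  simp only [coordHess, of_apply, h.sum_christoffel]
  rw [pderiv_comm h.mem hf]
  congr 2
  refine Finset.sum_congr rfl fun l _ => ?_
  rw [h.pderiv_symm l i j]; ring

lemma coordDiff_contDiffAt (hy : y ∈ interiorCoords n) {f : Coord n → ℝ} (hf : ContDiffAt ℝ ∞ f y)
    (i : Fin n) : ContDiffAt ℝ ∞ (fun z => coordDiff f z i) y := contDiffAt_pderiv hy hf i

lemma IsMetricAt.contDiffAt_coordInner (h : IsMetricAt G y) {a b : Coord n → ℝ}
    (ha : ContDiffAt ℝ ∞ a y) (hb : ContDiffAt ℝ ∞ b y) :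
    ContDiffAt ℝ ∞ (coordInner G a b) y := by
  unfold coordInner
  exact ContDiffAt.sum fun i _ => ContDiffAt.sum fun j _ =>
    ((h.contDiffAt_inv i j).mul (coordDiff_contDiffAt h.mem ha i)).mul
      (coordDiff_contDiffAt h.mem hb j)

lemma coordInner_eq (G : Coord n → Matrix (Fin n) (Fin n) ℝ) (a b : Coord n → ℝ) (y : Coord n) :
    coordInner G a b y = coordDiff a y ⬝ᵥ coordGrad G b y := by
  simp only [coordInner, coordGrad, dotProduct, mulVec, Finset.mul_sum]
  refine Finset.sum_congr rfl fun i _ => Finset.sum_congr rfl fun j _ => ?_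
  ring

lemma IsMetricAt.coordInner_comm (h : IsMetricAt G y) (a b : Coord n → ℝ) :
    coordInner G a b y = coordInner G b a y := by
  unfold coordInner
  rw [Finset.sum_comm]
  refine Finset.sum_congr rfl fun i _ => Finset.sum_congr rfl fun j _ => ?_
  rw [h.inv_symm]; ring

/-- Compatibility of the Levi-Civita connection with the metric:
`d⟨da, db⟩ = ∇²a(∇b, ·) + ∇²b(∇a, ·)`. -/
lemma IsMetricAt.coordDiff_coordInner (h : IsMetricAt G y) {a b : Coord n → ℝ}
    (ha : ContDiffAt ℝ ∞ a y) (hb : ContDiffAt ℝ ∞ b y) :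
    coordDiff (coordInner G a b) y
      = coordHess G a y *ᵥ coordGrad G b y + coordHess G b y *ᵥ coordGrad G a y := by
  ext k
  set D : Fin n → Matrix (Fin n) (Fin n) ℝ := fun k =>
    Matrix.of fun i j => pderiv k (fun z => G z i j) y with hD
  have hDs : ∀ k i j, D k i j = D k j i := fun k i j => h.pderiv_symm k i j
  set α := coordGrad G a y with hα
  set β := coordGrad G b y with hβ
  have hda := fun i => (coordDiff_contDiffAt h.mem ha i).diff
  have hdb := fun i => (coordDiff_contDiffAt h.mem hb i).diff
  have hi := fun i j => (h.contDiffAt_inv i j).diff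
  have e1 : coordDiff (coordInner G a b) y k = ∑ i, ∑ j,
      (- ((G y)⁻¹ * D k * (G y)⁻¹) i j * coordDiff a y i * coordDiff b y j
        + (G y)⁻¹ i j * pderiv k (pderiv i a) y * coordDiff b y j
        + (G y)⁻¹ i j * coordDiff a y i * pderiv k (pderiv j b) y) := by
    have : coordDiff (coordInner G a b) y k = pderiv k (fun z => ∑ i, ∑ j,
        (G z)⁻¹ i j * coordDiff a z i * coordDiff b z j) y := rfl
    rw [this, pderiv_sum h.mem]
    · refine Finset.sum_congr rfl fun i _ => ?_
      rw [pderiv_sum h.mem]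
      · refine Finset.sum_congr rfl fun j _ => ?_
        have hij : DifferentiableAt ℝ (fun z => (G z)⁻¹ i j * coordDiff a z i) y :=
          (hi i j).mul (hda i)
        rw [pderiv_mul h.mem hij (hdb j), pderiv_mul h.mem (hi i j) (hda i), h.pderiv_inv]
        change _ * pderiv k (pderiv j b) y + _ * (_ * pderiv k (pderiv i a) y + _) = _
        ring
      · exact fun j _ => ((hi i j).mul (hda i)).mul (hdb j)
    · exact fun i _ => DifferentiableAt.fun_sum fun j _ => ((hi i j).mul (hda i)).mul (hdb j)
  have e2 : ∑ i, ∑ j, ((G y)⁻¹ * D k * (G y)⁻¹) i j * coordDiff a y i * coordDiff b y j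
      = ∑ i, ∑ j, α i * β j * D k i j := by
    have s1 : ∑ i, ∑ j, ((G y)⁻¹ * D k * (G y)⁻¹) i j * coordDiff a y i * coordDiff b y j
        = coordDiff a y ⬝ᵥ ((G y)⁻¹ * D k * (G y)⁻¹) *ᵥ coordDiff b y := by
      simp only [dotProduct, mulVec, Finset.mul_sum]
      refine Finset.sum_congr rfl fun i _ => Finset.sum_congr rfl fun j _ => by ring
    have s2 : α = coordDiff a y ᵥ* (G y)⁻¹ := by
      rw [hα, coordGrad]
      ext i; simp only [mulVec, vecMul, dotProduct]
      exact Finset.sum_congr rfl fun j _ => by rw [h.inv_symm]; ring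
    rw [s1, ← mulVec_mulVec, ← mulVec_mulVec, dotProduct_mulVec, ← s2]
    change α ⬝ᵥ D k *ᵥ β = _
    simp only [dotProduct, mulVec, Finset.mul_sum]
    exact Finset.sum_congr rfl fun i _ => Finset.sum_congr rfl fun j _ => by ring
  have e3 : ∑ i, ∑ j, (G y)⁻¹ i j * pderiv k (pderiv i a) y * coordDiff b y j
      = ∑ i, pderiv k (pderiv i a) y * β i := by
    simp only [hβ, coordGrad, mulVec, dotProduct, Finset.mul_sum]
    exact Finset.sum_congr rfl fun i _ => Finset.sum_congr rfl fun j _ => by ring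
  have e4 : ∑ i, ∑ j, (G y)⁻¹ i j * coordDiff a y i * pderiv k (pderiv j b) y
      = ∑ i, pderiv k (pderiv i b) y * α i := by
    simp only [hα, coordGrad, mulVec, dotProduct, Finset.mul_sum]
    rw [Finset.sum_comm]
    exact Finset.sum_congr rfl fun i _ => Finset.sum_congr rfl fun j _ => by
      rw [h.inv_symm i j]; ring
  have e5 : ∑ i, (∑ m, coordChristoffel G m k i y * pderiv m a y) * β i
      + ∑ i, (∑ m, coordChristoffel G m k i y * pderiv m b y) * α i
      = ∑ i, ∑ j, α i * β j * D k i j := by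
    simp only [h.sum_christoffel, ← hα, ← hβ]
    change ∑ i, (1 / 2 * ∑ l, α l * (D k i l + D i k l - D l k i)) * β i
      + ∑ i, (1 / 2 * ∑ l, β l * (D k i l + D i k l - D l k i)) * α i = _
    simp only [Finset.mul_sum, Finset.sum_mul]
    rw [Finset.sum_comm, ← Finset.sum_add_distrib]
    refine Finset.sum_congr rfl fun i _ => ?_
    rw [← Finset.sum_add_distrib]
    refine Finset.sum_congr rfl fun j _ => ?_
    rw [hDs k j i]; ring
  rw [e1]
  simp only [Finset.sum_add_distrib, neg_mul, Finset.sum_neg_distrib]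
  rw [e2, e3, e4, ← e5]
  simp only [Pi.add_apply, mulVec, dotProduct, coordHess, of_apply, sub_mul,
    Finset.sum_sub_distrib]
  ring

end CoordinateCalculus

section CoordinateFormulas

variable {n : ℕ} [NeZero n] {y : Coord n} {G : Coord n → Matrix (Fin n) (Fin n) ℝ}

/-! ### The divergence formula for the Laplacian -/

/-- Jacobi's formula for the derivative of the determinant of a metric. -/
lemma IsMetricAt.pderiv_det (h : IsMetricAt G y) (k : Fin n) :
    pderiv k (fun z => (G z).det) y
      = (G y).det * ((G y)⁻¹ * Matrix.of fun a b => pderiv k (fun z => G z a b) y).trace := by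
  have hG : ∀ i j, HasFDerivAt (fun z => G z i j) (fderiv ℝ (fun z => G z i j) y) y :=
    fun i j => (h.contDiffAt i j).diff.hasFDerivAt
  have h1 : HasFDerivAt (fun z => (G z).det) (∑ σ : Equiv.Perm (Fin n),
      ((Equiv.Perm.sign σ : ℤ) : ℝ) • ∑ m, (∏ i ∈ Finset.univ.erase m, G y (σ i) i) •
        fderiv ℝ (fun z => G z (σ m) m) y) y := by
    simp only [Matrix.det_apply']
    refine HasFDerivAt.fun_sum fun σ _ => HasFDerivAt.const_mul ?_ _
    exact HasFDerivAt.finsetProd fun i _ => hG _ _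
  have h2 : ((G y).det • (G y)⁻¹) = (G y).adjugate := by
    rw [Matrix.inv_def, smul_smul, Ring.mul_inverse_cancel _ h.isUnit_det, one_smul]
  rw [pderiv_eq_fderiv h.mem, h1.fderiv, ← smul_eq_mul, ← Matrix.trace_smul, ← smul_mul_assoc, h2]
  have h3 : ∀ m, ((G y).adjugate * Matrix.of fun a b => pderiv k (fun z => G z a b) y) m m
      = ((G y).updateCol m fun a => pderiv k (fun z => G z a m) y).det := by
    intro m
    rw [← cramer_apply, cramer_eq_adjugate_mulVec]
    rfl
  simp only [Matrix.trace, diag_apply, h3, Matrix.det_apply']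
  rw [Finset.sum_comm]
  simp only [_root_.sum_apply, _root_.smul_apply, smul_eq_mul, Finset.mul_sum]
  refine Finset.sum_congr rfl fun σ _ => Finset.sum_congr rfl fun m _ => ?_
  rw [← Finset.mul_prod_erase _ _ (Finset.mem_univ m), updateCol_self,
    ← pderiv_eq_fderiv h.mem]
  rw [Finset.prod_congr rfl (g := fun i => G y (σ i) i)
    (fun i hi => updateCol_ne (Finset.ne_of_mem_erase hi))]
  ring

/-- The Laplacian of a function of the coordinates. -/
def coordLap (G : Coord n → Matrix (Fin n) (Fin n) ℝ) (f : Coord n → ℝ) (y : Coord n) : ℝ :=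
  ((G y)⁻¹ * coordHess G f y).trace

lemma IsMetricAt.contDiffAt_coordGrad (h : IsMetricAt G y) {f : Coord n → ℝ}
    (hf : ContDiffAt ℝ ∞ f y) (i : Fin n) : ContDiffAt ℝ ∞ (fun z => coordGrad G f z i) y := by
  simp only [coordGrad, mulVec, dotProduct]
  exact ContDiffAt.sum fun j _ => (h.contDiffAt_inv i j).mul (coordDiff_contDiffAt h.mem hf j)

lemma IsMetricAt.contDiffAt_sqrt_det (h : IsMetricAt G y) :
    ContDiffAt ℝ ∞ (fun z => √(G z).det) y :=
  (contDiffAt_det h.contDiffAt).sqrt h.posDef.self_of_nhds.det_pos.ne'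

/-- The Laplacian is the divergence of the gradient:
`∑_i ∂_i (√(det g) ∇^i f) = √(det g) Δ f`. -/
lemma IsMetricAt.divergence_coordGrad (h : IsMetricAt G y) {f : Coord n → ℝ}
    (hf : ContDiffAt ℝ ∞ f y) :
    ∑ i, pderiv i (fun z => √(G z).det * coordGrad G f z i) y
      = √(G y).det * coordLap G f y := by
  set D : Fin n → Matrix (Fin n) (Fin n) ℝ := fun k =>
    Matrix.of fun i j => pderiv k (fun z => G z i j) y with hD
  have hDs : ∀ k i j, D k i j = D k j i := fun k i j => h.pderiv_symm k i j
  have hdet := h.posDef.self_of_nhds.det_pos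
  set β := coordGrad G f y with hβ
  have e1 : ∀ i, pderiv i (fun z => √(G z).det) y
      = √(G y).det * ((1 / 2) * ((G y)⁻¹ * D i).trace) := by
    intro i
    rw [pderiv_comp h.mem (f := Real.sqrt) (F := fun z => (G z).det)
      (Real.hasDerivAt_sqrt hdet.ne').differentiableAt (contDiffAt_det h.contDiffAt).diff,
      (Real.hasDerivAt_sqrt hdet.ne').deriv, h.pderiv_det]
    have : √(G y).det ≠ 0 := (Real.sqrt_pos.2 hdet).ne'
    change 1 / (2 * √(G y).det) * ((G y).det * ((G y)⁻¹ * D i).trace) = _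
    have h2 := Real.mul_self_sqrt hdet.le
    field_simp
    rw [sq, h2]
  have e2 : ∀ i, pderiv i (fun z => coordGrad G f z i) y
      = ∑ j, ((G y)⁻¹ i j * pderiv i (pderiv j f) y) - ∑ j, ∑ l, (G y)⁻¹ i j * D i j l * β l := by
    intro i
    have : (fun z => coordGrad G f z i) = fun z => ∑ j, (G z)⁻¹ i j * coordDiff f z j := rfl
    rw [this, pderiv_sum h.mem]
    · have : ∀ j, pderiv i (fun z => (G z)⁻¹ i j * coordDiff f z j) y
          = (G y)⁻¹ i j * pderiv i (pderiv j f) y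
            - ((G y)⁻¹ * D i * (G y)⁻¹) i j * coordDiff f y j := by
        intro j
        rw [pderiv_mul h.mem (h.contDiffAt_inv i j).diff (coordDiff_contDiffAt h.mem hf j).diff,
          h.pderiv_inv]
        change _ * pderiv i (pderiv j f) y + _ = _
        ring
      simp only [this, Finset.sum_sub_distrib]
      congr 1
      have s1 : ∑ j, ((G y)⁻¹ * D i * (G y)⁻¹) i j * coordDiff f y j
          = (((G y)⁻¹ * D i * (G y)⁻¹) *ᵥ coordDiff f y) i := rfl
      rw [s1, ← mulVec_mulVec, ← mulVec_mulVec]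
      change ((G y)⁻¹ *ᵥ D i *ᵥ β) i = _
      simp only [mulVec, dotProduct, Finset.mul_sum]
      exact Finset.sum_congr rfl fun j _ => Finset.sum_congr rfl fun l _ => by ring
    · exact fun j _ => ((h.contDiffAt_inv i j).mul (coordDiff_contDiffAt h.mem hf j)).diff
  have e3 : coordLap G f y = ∑ i, ∑ j, (G y)⁻¹ i j * pderiv i (pderiv j f) y
      - ∑ i, ∑ j, ∑ l, (G y)⁻¹ i j * D i j l * β l
      + (1 / 2) * ∑ l, ((G y)⁻¹ * D l).trace * β l := by
    have s0 : coordLap G f y = ∑ i, ∑ j, (G y)⁻¹ i j * coordHess G f y i j := by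
      simp only [coordLap, Matrix.trace, diag_apply, Matrix.mul_apply]
      exact Finset.sum_congr rfl fun i _ => Finset.sum_congr rfl fun j _ => by
        rw [h.coordHess_symm hf]
    have s1 : ∑ l, ((G y)⁻¹ * D l).trace * β l = ∑ i, ∑ j, ∑ l, (G y)⁻¹ i j * D l i j * β l := by
      simp only [Matrix.trace, diag_apply, Matrix.mul_apply, Finset.sum_mul]
      rw [Finset.sum_comm]
      refine Finset.sum_congr rfl fun i _ => ?_
      rw [Finset.sum_comm]
      exact Finset.sum_congr rfl fun j _ => Finset.sum_congr rfl fun l _ => by rw [hDs l i j]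
    have s2 : ∑ i, ∑ j, ∑ l, (G y)⁻¹ i j * D i j l * β l
        = ∑ i, ∑ j, ∑ l, (G y)⁻¹ i j * D j i l * β l := by
      rw [Finset.sum_comm]
      exact Finset.sum_congr rfl fun i _ => Finset.sum_congr rfl fun j _ =>
        Finset.sum_congr rfl fun l _ => by rw [h.inv_symm]
    have s3 : ∑ i, ∑ j, (G y)⁻¹ i j * ∑ k, coordChristoffel G k i j y * pderiv k f y
        = (1 / 2) * (∑ i, ∑ j, ∑ l, (G y)⁻¹ i j * D i j l * β l
          + ∑ i, ∑ j, ∑ l, (G y)⁻¹ i j * D j i l * β l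
          - ∑ i, ∑ j, ∑ l, (G y)⁻¹ i j * D l i j * β l) := by
      simp only [h.sum_christoffel, ← hβ, Finset.mul_sum, ← Finset.sum_add_distrib,
        ← Finset.sum_sub_distrib]
      refine Finset.sum_congr rfl fun i _ => Finset.sum_congr rfl fun j _ =>
        Finset.sum_congr rfl fun l _ => ?_
      change _ * (_ * (_ * (D i j l + D j i l - D l i j))) = _
      ring
    rw [s0]
    simp only [coordHess, of_apply, mul_sub, Finset.sum_sub_distrib]
    rw [s3, s1, ← s2]; ring
  have e4 : ∀ i, pderiv i (fun z => √(G z).det * coordGrad G f z i) y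
      = √(G y).det * pderiv i (fun z => coordGrad G f z i) y
        + β i * pderiv i (fun z => √(G z).det) y := fun i =>
    pderiv_mul h.mem h.contDiffAt_sqrt_det.diff (h.contDiffAt_coordGrad hf i).diff
  simp only [e4, e1, e2, e3, Finset.sum_add_distrib, mul_sub, Finset.sum_sub_distrib, mul_add,
    Finset.mul_sum]
  congr 1
  exact Finset.sum_congr rfl fun i _ => by ring

/-! ### Conformal change of the metric -/

section Conformal

variable {G' : Coord n → Matrix (Fin n) (Fin n) ℝ} {r : Coord n → ℝ}

/-- The conformal metric `r⁻² G` is a smooth metric. -/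
lemma IsMetricAt.conformal (h : IsMetricAt G y) (hr : ∀ᶠ z in 𝓝 y, ContDiffAt ℝ ∞ r z)
    (hr0 : 0 < r y) (hG' : ∀ᶠ z in 𝓝 y, G' z = (r z ^ 2)⁻¹ • G z) : IsMetricAt G' y := by
  have hpos : ∀ᶠ z in 𝓝 y, 0 < r z :=
    hr.self_of_nhds.continuousAt.eventually (lt_mem_nhds hr0)
  refine ⟨h.mem, ?_, ?_⟩
  · filter_upwards [hr, hpos, hG'.eventually_nhds, h.contDiffAt'] with z h1 h2 h3 h4 i j
    have : ContDiffAt ℝ ∞ (fun z => (r z ^ 2)⁻¹ * G z i j) z :=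
      ((h1.pow 2).inv (by positivity)).mul (h4 i j)
    refine this.congr_of_eventuallyEq ?_
    filter_upwards [h3] with w hw
    rw [hw]; rfl
  · filter_upwards [hpos, hG', h.posDef] with z h1 h2 h3
    rw [h2]
    exact h3.smul (by positivity)

/-- The Hessian under the conformal change `g' = r⁻² g`. -/
lemma IsMetricAt.coordHess_conformal (h : IsMetricAt G y) (h' : IsMetricAt G' y)
    (hr : ContDiffAt ℝ ∞ r y) (hr0 : 0 < r y)
    (hG' : ∀ᶠ z in 𝓝 y, G' z = (r z ^ 2)⁻¹ • G z) (f : Coord n → ℝ) (i j : Fin n) :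
    coordHess G' f y i j = coordHess G f y i j
      + (r y)⁻¹ * (pderiv i r y * pderiv j f y + pderiv j r y * pderiv i f y
        - coordInner G r f y * G y i j) := by
  have hr0' := hr0.ne'
  have e1 : ∀ k i j, pderiv k (fun z => G' z i j) y
      = (r y ^ 2)⁻¹ * pderiv k (fun z => G z i j) y
        - 2 * (r y ^ 3)⁻¹ * pderiv k r y * G y i j := by
    intro k i j
    have : (fun z => G' z i j) =ᶠ[𝓝 y] fun z => (r z ^ 2)⁻¹ * G z i j := by
      filter_upwards [hG'] with z hz
      rw [hz]; rfl
    have hd : HasDerivAt (fun s : ℝ => (s ^ 2)⁻¹) (-(2 * r y) / (r y ^ 2) ^ 2) (r y) := by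
      simpa using (hasDerivAt_pow 2 (r y)).fun_inv (by positivity)
    have hi : ContDiffAt ℝ ∞ (fun z => (r z ^ 2)⁻¹) y := (hr.pow 2).inv (by positivity)
    rw [pderiv_congr this, pderiv_mul h.mem hi.diff
      (h.contDiffAt i j).diff, pderiv_comp h.mem (f := fun s => (s ^ 2)⁻¹) hd.differentiableAt
      hr.diff, hd.deriv]
    field_simp
    ring
  have e2 : coordGrad G' f y = (r y ^ 2) • coordGrad G f y := by
    unfold coordGrad
    have : (G' y)⁻¹ = (r y ^ 2) • (G y)⁻¹ := by
      rw [hG'.self_of_nhds]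
      refine Matrix.inv_eq_left_inv ?_
      rw [smul_mul_smul_comm, nonsing_inv_mul _ h.isUnit_det, mul_inv_cancel₀ (by positivity),
        one_smul]
    rw [this, smul_mulVec]
  have e3 : ∀ j, ∑ l, coordGrad G f y l * G y j l = pderiv j f y := by
    intro j
    have : (G y *ᵥ coordGrad G f y) j = coordDiff f y j := by
      rw [coordGrad, mulVec_mulVec, mul_nonsing_inv _ h.isUnit_det, one_mulVec]
    rw [← show coordDiff f y j = pderiv j f y from rfl, ← this]
    simp only [mulVec, dotProduct]
    exact Finset.sum_congr rfl fun l _ => mul_comm _ _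
  have e4 : ∑ l, coordGrad G f y l * pderiv l r y = coordInner G r f y := by
    rw [coordInner_eq, dotProduct]
    exact Finset.sum_congr rfl fun l _ => mul_comm _ _
  have e5 : ∑ l, (r y ^ 2 * coordGrad G f y l) *
      (((r y ^ 2)⁻¹ * pderiv i (fun z => G z j l) y - 2 * (r y ^ 3)⁻¹ * pderiv i r y * G y j l)
      + ((r y ^ 2)⁻¹ * pderiv j (fun z => G z i l) y - 2 * (r y ^ 3)⁻¹ * pderiv j r y * G y i l)
      - ((r y ^ 2)⁻¹ * pderiv l (fun z => G z i j) y - 2 * (r y ^ 3)⁻¹ * pderiv l r y * G y i j))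
      = ∑ l, coordGrad G f y l * (pderiv i (fun z => G z j l) y
          + pderiv j (fun z => G z i l) y - pderiv l (fun z => G z i j) y)
        - 2 * (r y)⁻¹ * (pderiv i r y * ∑ l, coordGrad G f y l * G y j l
          + pderiv j r y * ∑ l, coordGrad G f y l * G y i l
          - (∑ l, coordGrad G f y l * pderiv l r y) * G y i j) := by
    simp only [Finset.mul_sum, Finset.sum_mul, ← Finset.sum_add_distrib, ← Finset.sum_sub_distrib]
    refine Finset.sum_congr rfl fun l _ => ?_
    field_simp
    ring
  simp only [coordHess, of_apply, h.sum_christoffel, h'.sum_christoffel, e1, e2, Pi.smul_apply,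
    smul_eq_mul]
  rw [e5, e3, e3, e4]
  ring

/-- The Hessian of `1 / r` for the metric `g' = r⁻² g`, which is `1 / r` times `g'` up to a
lower-order term when `|dr|_g = 1`. -/
lemma IsMetricAt.coordHess_inv_conformal (h : IsMetricAt G y)
    (h' : IsMetricAt G' y) (hr : ContDiffAt ℝ ∞ r y) (hr0 : 0 < r y)
    (hG' : ∀ᶠ z in 𝓝 y, G' z = (r z ^ 2)⁻¹ • G z) (i j : Fin n) :
    coordHess G' (fun z => (r z)⁻¹) y i j
      = (r y)⁻¹ * coordInner G r r y * G' y i j - (r y ^ 2)⁻¹ * coordHess G r y i j := by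
  have hpos : ∀ᶠ z in 𝓝 y, 0 < r z :=
    hr.continuousAt.eventually (lt_mem_nhds hr0)
  have hdif : ∀ᶠ z in 𝓝 y, ContDiffAt ℝ 1 r z :=
    (hr.of_le (by exact_mod_cast le_top)).eventually (by simp)
  have hr0' := hr0.ne'
  have e1 : ∀ j, pderiv j (fun z => (r z)⁻¹) =ᶠ[𝓝 y] fun z => -(r z ^ 2)⁻¹ * pderiv j r z := by
    intro j
    filter_upwards [hpos, hdif, isOpen_interiorCoords.mem_nhds h.mem] with z h1 h2 h3
    rw [pderiv_comp h3 (f := fun s => s⁻¹) (hasDerivAt_inv h1.ne').differentiableAt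
      (h2.differentiableAt (by simp)), (hasDerivAt_inv h1.ne').deriv]
  have e2 : pderiv i (pderiv j (fun z => (r z)⁻¹)) y = -(r y ^ 2)⁻¹ * pderiv i (pderiv j r) y
      + 2 * (r y ^ 3)⁻¹ * pderiv i r y * pderiv j r y := by
    have hd : HasDerivAt (fun s : ℝ => -(s ^ 2)⁻¹) (-(-(2 * r y) / (r y ^ 2) ^ 2)) (r y) := by
      simpa using ((hasDerivAt_pow 2 (r y)).fun_inv (by positivity)).fun_neg
    have hi : ContDiffAt ℝ ∞ (fun z => -(r z ^ 2)⁻¹) y := ((hr.pow 2).inv (by positivity)).neg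
    rw [pderiv_congr (e1 j), pderiv_mul h.mem hi.diff
      (contDiffAt_pderiv h.mem hr j).diff, pderiv_comp h.mem (f := fun s => -(s ^ 2)⁻¹)
      hd.differentiableAt hr.diff, hd.deriv]
    field_simp
  have e3 : coordHess G (fun z => (r z)⁻¹) y i j = -(r y ^ 2)⁻¹ * coordHess G r y i j
      + 2 * (r y ^ 3)⁻¹ * pderiv i r y * pderiv j r y := by
    simp only [coordHess, of_apply, e2, (e1 _).self_of_nhds, mul_sub, Finset.mul_sum]
    rw [sub_eq_add_neg, sub_eq_add_neg, ← Finset.sum_neg_distrib, ← Finset.sum_neg_distrib]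
    have : ∀ k, -(coordChristoffel G k i j y * (-(r y ^ 2)⁻¹ * pderiv k r y))
        = -(-(r y ^ 2)⁻¹ * (coordChristoffel G k i j y * pderiv k r y)) := fun k => by ring
    simp only [this]
    ring
  have e4 : coordInner G r (fun z => (r z)⁻¹) y = -(r y ^ 2)⁻¹ * coordInner G r r y := by
    have : ∀ j, coordDiff (fun z => (r z)⁻¹) y j = -(r y ^ 2)⁻¹ * coordDiff r y j :=
      fun j => (e1 j).self_of_nhds
    simp only [coordInner, this, Finset.mul_sum]
    exact Finset.sum_congr rfl fun i _ => Finset.sum_congr rfl fun j _ => by ring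
  rw [h.coordHess_conformal h' hr hr0 hG', e3, e4, (e1 i).self_of_nhds, (e1 j).self_of_nhds,
    hG'.self_of_nhds, Matrix.smul_apply, smul_eq_mul]
  field_simp
  ring

end Conformal

/-! ### Change of coordinates -/

/-- The derivative of an inner product of gradients, in terms of Hessians. -/
lemma IsMetricAt.coordInner_coordInner (h : IsMetricAt G y) {a b c : Coord n → ℝ}
    (ha : ContDiffAt ℝ ∞ a y) (hb : ContDiffAt ℝ ∞ b y) :
    coordInner G c (coordInner G a b) y
      = coordGrad G c y ⬝ᵥ coordHess G a y *ᵥ coordGrad G b y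
        + coordGrad G c y ⬝ᵥ coordHess G b y *ᵥ coordGrad G a y := by
  rw [h.coordInner_comm, coordInner_eq, h.coordDiff_coordInner ha hb, dotProduct_comm,
    dotProduct_add]

lemma IsMetricAt.coordHess_dot_comm (h : IsMetricAt G y) {f : Coord n → ℝ}
    (hf : ContDiffAt ℝ ∞ f y) (v w : Fin n → ℝ) :
    v ⬝ᵥ coordHess G f y *ᵥ w = w ⬝ᵥ coordHess G f y *ᵥ v := by
  have : (coordHess G f y)ᵀ = coordHess G f y := by
    ext i j; exact h.coordHess_symm hf j i
  rw [dotProduct_mulVec, ← mulVec_transpose, this, dotProduct_comm]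

/-- The Hessian is determined by the inner products of gradients. -/
lemma IsMetricAt.two_mul_coordHess (h : IsMetricAt G y) {f a b : Coord n → ℝ}
    (hf : ContDiffAt ℝ ∞ f y) (ha : ContDiffAt ℝ ∞ a y) (hb : ContDiffAt ℝ ∞ b y) :
    2 * (coordGrad G a y ⬝ᵥ coordHess G f y *ᵥ coordGrad G b y)
      = coordInner G a (coordInner G f b) y + coordInner G b (coordInner G f a) y
        - coordInner G f (coordInner G a b) y := by
  rw [h.coordInner_coordInner hf hb, h.coordInner_coordInner hf ha, h.coordInner_coordInner ha hb,
    h.coordHess_dot_comm hf (coordGrad G b y) (coordGrad G a y),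
    h.coordHess_dot_comm ha (coordGrad G f y) (coordGrad G b y),
    h.coordHess_dot_comm hb (coordGrad G f y) (coordGrad G a y)]
  ring

section Change

variable {G' : Coord n → Matrix (Fin n) (Fin n) ℝ} {φ : Coord n → Coord n}

/-- The coordinate change `φ` is an isometry, near `y`, from the metric `G'` to `G`. -/
structure IsIsometryAt (φ : Coord n → Coord n) (G' G : Coord n → Matrix (Fin n) (Fin n) ℝ)
    (y : Coord n) : Prop where
  source : IsMetricAt G' y
  target : IsMetricAt G (φ y)
  contDiffAt : ∀ᶠ z in 𝓝 y, ContDiffAt ℝ ∞ φ z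
  pullback : ∀ᶠ z in 𝓝 y, G' z = (jac φ z)ᵀ * G (φ z) * jac φ z

lemma IsIsometryAt.smooth (h : IsIsometryAt φ G' G y) : ContDiffAt ℝ ∞ φ y :=
  h.contDiffAt.self_of_nhds

lemma IsIsometryAt.eventually (h : IsIsometryAt φ G' G y) :
    ∀ᶠ z in 𝓝 y, IsIsometryAt φ G' G z := by
  filter_upwards [h.source.eventually, h.smooth.continuousAt.eventually h.target.eventually,
    h.contDiffAt.eventually_nhds, h.pullback.eventually_nhds] with z h1 h2 h3 h4
  exact ⟨h1, h2, h3, h4⟩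

lemma IsIsometryAt.coordDiff_comp (h : IsIsometryAt φ G' G y) {f : Coord n → ℝ}
    (hf : DifferentiableAt ℝ f (φ y)) :
    coordDiff (fun z => f (φ z)) y = (jac φ y)ᵀ *ᵥ coordDiff f (φ y) := by
  ext i
  exact pderiv_comp_map h.source.mem h.target.mem (h.smooth.differentiableAt (by simp)) hf i

lemma IsIsometryAt.inv_eq (h : IsIsometryAt φ G' G y) :
    (G (φ y))⁻¹ = jac φ y * (G' y)⁻¹ * (jac φ y)ᵀ := by
  have hJ : IsUnit (jac φ y).det := by
    have := h.source.isUnit_det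
    rw [h.pullback.self_of_nhds, det_mul, det_mul] at this
    exact isUnit_of_mul_isUnit_right this
  have hJ' : IsUnit (jac φ y)ᵀ.det := by rwa [det_transpose]
  rw [h.pullback.self_of_nhds, Matrix.mul_inv_rev, Matrix.mul_inv_rev, ← mul_assoc,
    mul_nonsing_inv _ hJ, one_mul, mul_assoc, nonsing_inv_mul _ hJ', mul_one]

lemma IsIsometryAt.coordInner_comp (h : IsIsometryAt φ G' G y) {a b : Coord n → ℝ}
    (ha : DifferentiableAt ℝ a (φ y)) (hb : DifferentiableAt ℝ b (φ y)) :
    coordInner G' (fun z => a (φ z)) (fun z => b (φ z)) y = coordInner G a b (φ y) := by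
  rw [coordInner_eq, coordInner_eq, coordGrad, coordGrad, h.coordDiff_comp ha, h.coordDiff_comp hb,
    h.inv_eq, ← mulVec_mulVec, ← mulVec_mulVec, mulVec_transpose, ← dotProduct_mulVec]

lemma IsIsometryAt.coordInner_comp_eventuallyEq (h : IsIsometryAt φ G' G y) {a b : Coord n → ℝ}
    (ha : ContDiffAt ℝ ∞ a (φ y)) (hb : ContDiffAt ℝ ∞ b (φ y)) :
    coordInner G' (fun z => a (φ z)) (fun z => b (φ z)) =ᶠ[𝓝 y]
      fun z => coordInner G a b (φ z) := by
  have key : ∀ {a : Coord n → ℝ}, ContDiffAt ℝ ∞ a (φ y) →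
      ∀ᶠ z in 𝓝 y, DifferentiableAt ℝ a (φ z) := fun ha =>
    (h.smooth.continuousAt.eventually ((ha.of_le (m := 1) (by exact_mod_cast le_top)).eventually
      (by simp))).mono fun z hz => hz.differentiableAt (by simp)
  filter_upwards [h.eventually, key ha, key hb] with z h1 h2 h3 using h1.coordInner_comp h2 h3

lemma coordInner_congr {a b c : Coord n → ℝ} (h : b =ᶠ[𝓝 y] c) :
    coordInner G a b y = coordInner G a c y := by
  have : coordDiff b y = coordDiff c y := funext fun i => pderiv_congr h i
  simp only [coordInner, this]

/-- A linear function of the coordinates with a given differential. -/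
lemma exists_coordDiff_eq (hy : y ∈ interiorCoords n) (w : Fin n → ℝ) :
    ∃ a : Coord n → ℝ, ContDiff ℝ ∞ a ∧ coordDiff a y = w := by
  refine ⟨fun z => ∑ i, w i * z i, by fun_prop, ?_⟩
  ext j
  change pderiv j (fun z : Coord n => ∑ i, w i * z i) y = w j
  rw [pderiv_eq_fderiv hy]
  have : HasFDerivAt (fun z : Coord n => ∑ i, w i * z i)
      (∑ i, w i • (EuclideanSpace.proj i : Coord n →L[ℝ] ℝ)) y := by
    refine HasFDerivAt.fun_sum fun i _ => HasFDerivAt.const_mul ?_ _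
    exact (EuclideanSpace.proj i : Coord n →L[ℝ] ℝ).hasFDerivAt
  rw [this.fderiv]
  simp

/-- The Hessian is a tensor. -/
lemma IsIsometryAt.coordHess_comp (h : IsIsometryAt φ G' G y) {f : Coord n → ℝ}
    (hf : ContDiffAt ℝ ∞ f (φ y)) :
    coordHess G' (fun z => f (φ z)) y = (jac φ y)ᵀ * coordHess G f (φ y) * jac φ y := by
  set J := jac φ y
  ext i j
  have lin : ∀ i : Fin n, ∃ a : Coord n → ℝ, ContDiff ℝ ∞ a ∧
      coordGrad G a (φ y) = J *ᵥ Pi.single i 1 ∧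
      coordGrad G' (fun z => a (φ z)) y = Pi.single i 1 := by
    intro i
    obtain ⟨a, ha, hda⟩ := exists_coordDiff_eq h.target.mem (G (φ y) *ᵥ J *ᵥ Pi.single i 1)
    refine ⟨a, ha, ?_, ?_⟩
    · rw [coordGrad, hda, mulVec_mulVec, nonsing_inv_mul _ h.target.isUnit_det, one_mulVec]
    · rw [coordGrad, h.coordDiff_comp (ha.differentiable (by simp)).differentiableAt, hda,
        mulVec_mulVec, mulVec_mulVec, mulVec_mulVec, mul_assoc, mul_assoc,
        ← mul_assoc (jac φ y)ᵀ, ← h.pullback.self_of_nhds,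
        nonsing_inv_mul _ h.source.isUnit_det, one_mulVec]
  obtain ⟨a, ha, ga, ga'⟩ := lin i
  obtain ⟨b, hb, gb, gb'⟩ := lin j
  have sm : ∀ {f : Coord n → ℝ}, ContDiffAt ℝ ∞ f (φ y) → ContDiffAt ℝ ∞ (fun z => f (φ z)) y :=
    fun hf => hf.comp y h.smooth
  have key : ∀ {a b c : Coord n → ℝ}, ContDiffAt ℝ ∞ a (φ y) → ContDiffAt ℝ ∞ b (φ y) →
      ContDiffAt ℝ ∞ c (φ y) → coordInner G' (fun z => a (φ z))
        (coordInner G' (fun z => b (φ z)) (fun z => c (φ z))) y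
      = coordInner G a (coordInner G b c) (φ y) := by
    intro a b c ha hb hc
    rw [coordInner_congr (h.coordInner_comp_eventuallyEq hb hc),
      h.coordInner_comp ha.diff (h.target.contDiffAt_coordInner hb hc).diff]
  have e1 := h.source.two_mul_coordHess (sm hf) (sm ha.contDiffAt) (sm hb.contDiffAt)
  rw [key ha.contDiffAt hf hb.contDiffAt, key hb.contDiffAt hf ha.contDiffAt,
    key hf ha.contDiffAt hb.contDiffAt,
    ← h.target.two_mul_coordHess hf ha.contDiffAt hb.contDiffAt, ga, gb, ga', gb'] at e1
  have e2 : ∀ (H : Matrix (Fin n) (Fin n) ℝ) i j,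
      H i j = Pi.single i (1 : ℝ) ⬝ᵥ H *ᵥ Pi.single j 1 := by simp
  rw [e2 (coordHess G' _ y), mul_left_cancel₀ two_ne_zero e1, e2 (_ * _ * _), ← mulVec_mulVec,
    ← mulVec_mulVec, dotProduct_mulVec (Pi.single i 1), vecMul_transpose]

end Change

end CoordinateFormulas
section Charts

variable {n : ℕ} [NeZero n] {M : Type*} [TopologicalSpace M]
  [ChartedSpace (EuclideanHalfSpace n) M] [IsManifold (𝓡∂ n) ∞ M]
  {p q x : M} {y : Coord n} {B : BilinField n M}

/-! ### Functions and metrics read in different charts -/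

/-- The change of coordinates from the chart based at `p` to the chart based at `q`. -/
def transition (p q : M) : Coord n → Coord n :=
  fun y => extChartAt (𝓡∂ n) q ((extChartAt (𝓡∂ n) p).symm y)

lemma extChartAt_mem_interiorCoords (hx : x ∈ (𝓡∂ n).interior M)
    (hp : x ∈ (extChartAt (𝓡∂ n) p).source) : extChartAt (𝓡∂ n) p x ∈ interiorCoords n := by
  have hp' : x ∈ (chartAt (EuclideanHalfSpace n) p).source := by rwa [extChartAt_source] at hp
  have := ((𝓡∂ n).isInteriorPoint_iff_of_mem_atlas (n := ∞) (by simp) (chart_mem_atlas _ p) hp').1 hx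
  exact interior_mono (OpenPartialHomeomorph.extend_target_subset_range _) this

lemma eventually_extChartAt_symm (hx : x ∈ (𝓡∂ n).interior M)
    (hp : x ∈ (extChartAt (𝓡∂ n) p).source) {s : Set M} (hs : s ∈ 𝓝 x) :
    ∀ᶠ y in 𝓝 (extChartAt (𝓡∂ n) p x), y ∈ (extChartAt (𝓡∂ n) p).target ∧
      (extChartAt (𝓡∂ n) p).symm y ∈ s := by
  have h1 : range (𝓡∂ n) ∈ 𝓝 (extChartAt (𝓡∂ n) p x) :=
    mem_interior_iff_mem_nhds.1 (extChartAt_mem_interiorCoords hx hp)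
  have h2 : (extChartAt (𝓡∂ n) p).target ∈ 𝓝 (extChartAt (𝓡∂ n) p x) := by
    have := extChartAt_target_mem_nhdsWithin' hp
    rwa [nhdsWithin_eq_nhds.2 h1] at this
  have h3 : ContinuousAt (extChartAt (𝓡∂ n) p).symm (extChartAt (𝓡∂ n) p x) :=
    continuousAt_extChartAt_symm' hp
  have h4 : s ∈ 𝓝 ((extChartAt (𝓡∂ n) p).symm (extChartAt (𝓡∂ n) p x)) := by
    rwa [(extChartAt (𝓡∂ n) p).left_inv hp]
  filter_upwards [h2, h3.eventually h4] with y a b using ⟨a, b⟩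

lemma contDiffAt_inChart {f : M → ℝ} (hx : x ∈ (𝓡∂ n).interior M)
    (hp : x ∈ (extChartAt (𝓡∂ n) p).source) (hf : ContMDiffAt (𝓡∂ n) 𝓘(ℝ) ∞ f x) :
    ContDiffAt ℝ ∞ (inChart p f) (extChartAt (𝓡∂ n) p x) := by
  have h1 : range (𝓡∂ n) ∈ 𝓝 (extChartAt (𝓡∂ n) p x) :=
    mem_interior_iff_mem_nhds.1 (extChartAt_mem_interiorCoords hx hp)
  rw [extChartAt_source] at hp
  have := (contMDiffAt_iff_of_mem_source (y := f x) hp (mem_chart_source _ _)).1 hf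
  exact this.2.contDiffAt h1

lemma contMDiffAt_of_inChart {f : M → ℝ} (hp : x ∈ (extChartAt (𝓡∂ n) p).source)
    (hf : ContDiffAt ℝ ∞ (inChart p f) (extChartAt (𝓡∂ n) p x)) :
    ContMDiffAt (𝓡∂ n) 𝓘(ℝ) ∞ f x := by
  have hp' := hp
  rw [extChartAt_source] at hp'
  have h1 : ContMDiffAt (𝓡∂ n) 𝓘(ℝ, Coord n) ∞ (extChartAt (𝓡∂ n) p) x :=
    contMDiffAt_extChartAt' hp'
  have h2 : ContMDiffAt (𝓡∂ n) 𝓘(ℝ) ∞ (fun z => inChart p f (extChartAt (𝓡∂ n) p z)) x :=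
    (contMDiffAt_iff_contDiffAt.2 hf).comp x h1
  refine h2.congr_of_eventuallyEq ?_
  filter_upwards [extChartAt_source_mem_nhds' hp] with z hz
  simp only [inChart, (extChartAt (𝓡∂ n) p).left_inv hz]

lemma inChart_eventuallyEq {f g : M → ℝ} (hx : x ∈ (𝓡∂ n).interior M)
    (hp : x ∈ (extChartAt (𝓡∂ n) p).source) (hfg : f =ᶠ[𝓝 x] g) :
    inChart p f =ᶠ[𝓝 (extChartAt (𝓡∂ n) p x)] inChart p g := by
  filter_upwards [eventually_extChartAt_symm hx hp hfg] with y hy using hy.2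

lemma contDiffAt_transition (hx : x ∈ (𝓡∂ n).interior M) (hp : x ∈ (extChartAt (𝓡∂ n) p).source)
    (hq : x ∈ (extChartAt (𝓡∂ n) q).source) :
    ContDiffAt ℝ ∞ (transition p q) (extChartAt (𝓡∂ n) p x) := by
  have h1 : range (𝓡∂ n) ∈ 𝓝 (extChartAt (𝓡∂ n) p x) :=
    mem_interior_iff_mem_nhds.1 (extChartAt_mem_interiorCoords hx hp)
  refine (contDiffWithinAt_ext_coord_change (n := ∞) (I := 𝓡∂ n) q p ?_).contDiffAt h1
  simp only [PartialEquiv.trans_source, PartialEquiv.symm_source, mem_inter_iff, mem_preimage]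
  exact ⟨(extChartAt (𝓡∂ n) p).map_source hp, by rwa [(extChartAt (𝓡∂ n) p).left_inv hp]⟩

lemma inChart_transition {f : M → ℝ} (hx : x ∈ (𝓡∂ n).interior M)
    (hp : x ∈ (extChartAt (𝓡∂ n) p).source) (hq : x ∈ (extChartAt (𝓡∂ n) q).source) :
    inChart p f =ᶠ[𝓝 (extChartAt (𝓡∂ n) p x)] fun y => inChart q f (transition p q y) := by
  filter_upwards [eventually_extChartAt_symm hx hp (extChartAt_source_mem_nhds' hq)] with y hy
  simp only [inChart, transition, (extChartAt (𝓡∂ n) q).left_inv hy.2]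

lemma transition_apply (hp : x ∈ (extChartAt (𝓡∂ n) p).source) :
    transition p q (extChartAt (𝓡∂ n) p x) = extChartAt (𝓡∂ n) q x := by
  simp only [transition, (extChartAt (𝓡∂ n) p).left_inv hp]

/-- The transformation rule of the coordinate vector fields. -/
lemma coordVec_transition (hx : x ∈ (𝓡∂ n).interior M) (hp : x ∈ (extChartAt (𝓡∂ n) p).source)
    (hq : x ∈ (extChartAt (𝓡∂ n) q).source) (i : Fin n) :
    (coordVec p i (extChartAt (𝓡∂ n) p x) : Coord n)
      = ∑ a, jac (transition p q) (extChartAt (𝓡∂ n) p x) a i •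
          (coordVec q a (extChartAt (𝓡∂ n) q x) : Coord n) := by
  set y := extChartAt (𝓡∂ n) p x with hy
  have hyi : y ∈ interiorCoords n := extChartAt_mem_interiorCoords hx hp
  have hyr : y ∈ range (𝓡∂ n) := interior_subset hyi
  have hφ := contDiffAt_transition (n := n) hx hp hq
  have hφd : DifferentiableAt ℝ (transition p q) y := hφ.differentiableAt (by simp)
  have e1 : (extChartAt (𝓡∂ n) p).symm =ᶠ[𝓝 y]
      (extChartAt (𝓡∂ n) q).symm ∘ transition p q := by
    filter_upwards [eventually_extChartAt_symm hx hp (extChartAt_source_mem_nhds' hq)] with z hz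
    simp only [transition, Function.comp_apply, (extChartAt (𝓡∂ n) q).left_inv hz.2]
  have e2 : transition p q y = extChartAt (𝓡∂ n) q x := transition_apply hp
  have hg : MDifferentiableWithinAt 𝓘(ℝ, Coord n) (𝓡∂ n) (extChartAt (𝓡∂ n) q).symm
      (range (𝓡∂ n)) (transition p q y) := by
    rw [e2]
    exact mdifferentiableWithinAt_extChartAt_symm ((extChartAt (𝓡∂ n) q).map_source hq)
  have hf : MDifferentiableWithinAt 𝓘(ℝ, Coord n) 𝓘(ℝ, Coord n) (transition p q)
      (range (𝓡∂ n)) y := hφd.mdifferentiableAt.mdifferentiableWithinAt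
  have hsub : range (𝓡∂ n) ⊆ transition p q ⁻¹' range (𝓡∂ n) := fun z _ => mem_range_self _
  have hun : UniqueMDiffWithinAt 𝓘(ℝ, Coord n) (range (𝓡∂ n)) y :=
    ((𝓡∂ n).uniqueDiffOn y hyr).uniqueMDiffWithinAt
  have key := mfderivWithin_comp y hg hf hsub hun
  have e3 := (e1.filter_mono (nhdsWithin_le_nhds (s := range (𝓡∂ n)))).mfderivWithin_eq
    (I := 𝓘(ℝ, Coord n)) (I' := 𝓡∂ n) (e1.self_of_nhds)
  have e4 : fderiv ℝ (transition p q) y (EuclideanSpace.single i 1)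
      = ∑ a, jac (transition p q) y a i • EuclideanSpace.single a (1 : ℝ) := by
    ext b
    rw [fderiv_single_apply hyi hφd]
    simp [Pi.single_apply]
  have e5 : mfderivWithin 𝓘(ℝ, Coord n) 𝓘(ℝ, Coord n) (transition p q) (range (𝓡∂ n)) y
      = fderiv ℝ (transition p q) y := by
    rw [mfderivWithin_eq_fderivWithin, fderivWithin_of_mem_nhds (mem_interior_iff_mem_nhds.1 hyi)]
  let L : Coord n →L[ℝ] Coord n := mfderivWithin 𝓘(ℝ, Coord n) (𝓡∂ n)
    (extChartAt (𝓡∂ n) q).symm (range (𝓡∂ n)) (extChartAt (𝓡∂ n) q x)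
  have e6 : (coordVec p i y : Coord n)
      = L (fderiv ℝ (transition p q) y (EuclideanSpace.single i 1)) := by
    have h1 : (coordVec p i y : Coord n) = (mfderivWithin 𝓘(ℝ, Coord n) (𝓡∂ n)
        ((extChartAt (𝓡∂ n) q).symm ∘ transition p q) (range (𝓡∂ n)) y)
        (EuclideanSpace.single i (1 : ℝ) : Coord n) := by
      rw [← e3]; rfl
    rw [h1, key, e5, e2]
    rfl
  rw [e6, e4, map_sum]
  refine Finset.sum_congr rfl fun a _ => ?_
  rw [map_smul]
  rfl

lemma bilin_sum_sum (b : Coord n →L[ℝ] Coord n →L[ℝ] ℝ) (s t : Fin n → ℝ) (v w : Fin n → Coord n) :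
    b (∑ i, s i • v i) (∑ j, t j • w j) = ∑ i, ∑ j, s i * t j * b (v i) (w j) := by
  simp only [map_sum, map_smul, _root_.sum_apply, _root_.smul_apply, smul_eq_mul, Finset.mul_sum]
  rw [Finset.sum_comm]
  exact Finset.sum_congr rfl fun i _ => Finset.sum_congr rfl fun j _ => by ring

/-- The transformation rule of the matrix of a bilinear form. -/
lemma gram_transition (B : BilinField n M) (hx : x ∈ (𝓡∂ n).interior M)
    (hp : x ∈ (extChartAt (𝓡∂ n) p).source) (hq : x ∈ (extChartAt (𝓡∂ n) q).source) :
    gram B p (extChartAt (𝓡∂ n) p x) = (jac (transition p q) (extChartAt (𝓡∂ n) p x))ᵀ *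
      gram B q (extChartAt (𝓡∂ n) q x) * jac (transition p q) (extChartAt (𝓡∂ n) p x) := by
  have hb : ∀ x', x' = x → ∀ v w : Coord n, (B x' : Coord n →L[ℝ] Coord n →L[ℝ] ℝ) v w
      = (B x : Coord n →L[ℝ] Coord n →L[ℝ] ℝ) v w := by
    rintro _ rfl _ _; rfl
  have hg : ∀ r : M, x ∈ (extChartAt (𝓡∂ n) r).source → ∀ i j,
      gram B r (extChartAt (𝓡∂ n) r x) i j = (B x : Coord n →L[ℝ] Coord n →L[ℝ] ℝ)
        (coordVec r i (extChartAt (𝓡∂ n) r x) : Coord n)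
        (coordVec r j (extChartAt (𝓡∂ n) r x) : Coord n) := fun r hr i j =>
    hb _ ((extChartAt (𝓡∂ n) r).left_inv hr) _ _
  ext i j
  rw [hg p hp, coordVec_transition hx hp hq i, coordVec_transition hx hp hq j]
  refine (bilin_sum_sum (B x : Coord n →L[ℝ] Coord n →L[ℝ] ℝ) _ _ _ _).trans ?_
  rw [Matrix.mul_apply]
  simp only [Matrix.mul_apply, transpose_apply, Finset.sum_mul, hg q hq]
  rw [Finset.sum_comm]
  refine Finset.sum_congr rfl fun a _ => Finset.sum_congr rfl fun b _ => ?_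
  exact mul_right_comm _ _ _

/-! ### Riemannian metrics on open sets of interior points -/

/-- On the open set `W`, which consists of interior points of `M`, the field `B` is a smooth
Riemannian metric. -/
structure IsRiemannianOn (B : BilinField n M) (W : Set M) : Prop where
  isOpen : IsOpen W
  interior : W ⊆ (𝓡∂ n).interior M
  metric : ∀ p : M, ∀ x ∈ W, x ∈ (extChartAt (𝓡∂ n) p).source →
    IsMetricAt (gram B p) (extChartAt (𝓡∂ n) p x)

variable {W : Set M} {a b c f : M → ℝ}

lemma IsRiemannianOn.isIsometryAt (h : IsRiemannianOn B W) (hx : x ∈ W)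
    (hp : x ∈ (extChartAt (𝓡∂ n) p).source) (hq : x ∈ (extChartAt (𝓡∂ n) q).source) :
    IsIsometryAt (transition p q) (gram B p) (gram B q) (extChartAt (𝓡∂ n) p x) := by
  have hev := eventually_extChartAt_symm (h.interior hx) hp
    (inter_mem (h.isOpen.mem_nhds hx) (extChartAt_source_mem_nhds' (I := 𝓡∂ n) hq))
  have hback : ∀ y ∈ (extChartAt (𝓡∂ n) p).target,
      extChartAt (𝓡∂ n) p ((extChartAt (𝓡∂ n) p).symm y) = y ∧
      (extChartAt (𝓡∂ n) p).symm y ∈ (extChartAt (𝓡∂ n) p).source := fun y hy =>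
    ⟨(extChartAt (𝓡∂ n) p).right_inv hy, (extChartAt (𝓡∂ n) p).map_target hy⟩
  refine ⟨h.metric p x hx hp, ?_, ?_, ?_⟩
  · rw [transition_apply hp]; exact h.metric q x hx hq
  · filter_upwards [hev] with y hy
    obtain ⟨h1, h2⟩ := hback y hy.1
    have := contDiffAt_transition (h.interior hy.2.1) h2 hy.2.2
    rwa [h1] at this
  · filter_upwards [hev] with y hy
    obtain ⟨h1, h2⟩ := hback y hy.1
    have := gram_transition B (h.interior hy.2.1) h2 hy.2.2
    rwa [h1] at this

/-- The inner product `⟨da, db⟩` of the differentials of two functions, in the preferred chart. -/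
def innerD (B : BilinField n M) (a b : M → ℝ) (x : M) : ℝ :=
  coordInner (gram B x) (inChart x a) (inChart x b) (extChartAt (𝓡∂ n) x x)

/-- The Laplacian `Δf`, in the preferred chart. -/
def lap (B : BilinField n M) (f : M → ℝ) (x : M) : ℝ :=
  coordLap (gram B x) (inChart x f) (extChartAt (𝓡∂ n) x x)

/-- The value `∇²f(∇a, ∇b)` of the Hessian at two gradients, in the preferred chart. -/
def hessD (B : BilinField n M) (f a b : M → ℝ) (x : M) : ℝ :=
  coordGrad (gram B x) (inChart x a) (extChartAt (𝓡∂ n) x x) ⬝ᵥ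
    coordHess (gram B x) (inChart x f) (extChartAt (𝓡∂ n) x x) *ᵥ
      coordGrad (gram B x) (inChart x b) (extChartAt (𝓡∂ n) x x)

lemma coordInner_congr' {G : Coord n → Matrix (Fin n) (Fin n) ℝ} {a a' b b' : Coord n → ℝ}
    (ha : a =ᶠ[𝓝 y] a') (hb : b =ᶠ[𝓝 y] b') : coordInner G a b y = coordInner G a' b' y := by
  have h1 : coordDiff a y = coordDiff a' y := funext fun i => pderiv_congr ha i
  have h2 : coordDiff b y = coordDiff b' y := funext fun i => pderiv_congr hb i
  simp only [coordInner, h1, h2]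

lemma coordHess_congr {G : Coord n → Matrix (Fin n) (Fin n) ℝ} {f f' : Coord n → ℝ}
    (hf : f =ᶠ[𝓝 y] f') : coordHess G f y = coordHess G f' y := by
  ext i j
  simp only [coordHess, of_apply, pderiv_congr hf, pderiv_congr (pderiv_eventuallyEq hf j)]

lemma IsRiemannianOn.innerD_eq (h : IsRiemannianOn B W) (hx : x ∈ W)
    (hp : x ∈ (extChartAt (𝓡∂ n) p).source) (ha : ContMDiffAt (𝓡∂ n) 𝓘(ℝ) ∞ a x)
    (hb : ContMDiffAt (𝓡∂ n) 𝓘(ℝ) ∞ b x) :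
    innerD B a b x
      = coordInner (gram B p) (inChart p a) (inChart p b) (extChartAt (𝓡∂ n) p x) := by
  have hx' := mem_extChartAt_source (I := 𝓡∂ n) x
  have hi := h.isIsometryAt hx hx' hp
  have ea := inChart_transition (f := a) (h.interior hx) hx' hp
  have eb := inChart_transition (f := b) (h.interior hx) hx' hp
  have hT := transition_apply (n := n) (q := p) hx'
  rw [innerD, coordInner_congr' ea eb, hi.coordInner_comp, hT]
  · rw [hT]; exact (contDiffAt_inChart (h.interior hx) hp ha).diff
  · rw [hT]; exact (contDiffAt_inChart (h.interior hx) hp hb).diff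

/-- The Hessian in two charts. -/
lemma IsRiemannianOn.coordHess_eq (h : IsRiemannianOn B W) (hx : x ∈ W)
    (hp : x ∈ (extChartAt (𝓡∂ n) p).source) (hf : ContMDiffAt (𝓡∂ n) 𝓘(ℝ) ∞ f x) :
    coordHess (gram B x) (inChart x f) (extChartAt (𝓡∂ n) x x)
      = (jac (transition x p) (extChartAt (𝓡∂ n) x x))ᵀ
        * coordHess (gram B p) (inChart p f) (extChartAt (𝓡∂ n) p x)
        * jac (transition x p) (extChartAt (𝓡∂ n) x x) := by
  have hx' := mem_extChartAt_source (I := 𝓡∂ n) x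
  have hi := h.isIsometryAt hx hx' hp
  have hT := transition_apply (n := n) (q := p) hx'
  rw [coordHess_congr (inChart_transition (h.interior hx) hx' hp), hi.coordHess_comp, hT]
  rw [hT]; exact contDiffAt_inChart (h.interior hx) hp hf

lemma IsRiemannianOn.inv_gram_eq (h : IsRiemannianOn B W) (hx : x ∈ W)
    (hp : x ∈ (extChartAt (𝓡∂ n) p).source) :
    (gram B p (extChartAt (𝓡∂ n) p x))⁻¹ = jac (transition x p) (extChartAt (𝓡∂ n) x x)
        * (gram B x (extChartAt (𝓡∂ n) x x))⁻¹
        * (jac (transition x p) (extChartAt (𝓡∂ n) x x))ᵀ := by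
  have hx' := mem_extChartAt_source (I := 𝓡∂ n) x
  have hT := transition_apply (n := n) (q := p) hx'
  have := (h.isIsometryAt hx hx' hp).inv_eq
  rwa [hT] at this

lemma IsRiemannianOn.lap_eq (h : IsRiemannianOn B W) (hx : x ∈ W)
    (hp : x ∈ (extChartAt (𝓡∂ n) p).source) (hf : ContMDiffAt (𝓡∂ n) 𝓘(ℝ) ∞ f x) :
    lap B f x = coordLap (gram B p) (inChart p f) (extChartAt (𝓡∂ n) p x) := by
  rw [lap, coordLap, coordLap, h.coordHess_eq hx hp hf, h.inv_gram_eq hx hp, ← mul_assoc,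
    ← mul_assoc, Matrix.trace_mul_comm]
  simp only [mul_assoc]

/-- The inner product of differentials is smooth. -/
lemma IsRiemannianOn.contMDiffOn_innerD (h : IsRiemannianOn B W)
    (ha : ContMDiffOn (𝓡∂ n) 𝓘(ℝ) ∞ a W) (hb : ContMDiffOn (𝓡∂ n) 𝓘(ℝ) ∞ b W) :
    ContMDiffOn (𝓡∂ n) 𝓘(ℝ) ∞ (innerD B a b) W := by
  intro x hx
  have hx' := mem_extChartAt_source (I := 𝓡∂ n) x
  refine (contMDiffAt_of_inChart hx' ?_).contMDiffWithinAt
  have hn := h.isOpen.mem_nhds hx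
  refine ((h.metric x x hx hx').contDiffAt_coordInner
    (contDiffAt_inChart (h.interior hx) hx' (ha.contMDiffAt hn))
    (contDiffAt_inChart (h.interior hx) hx' (hb.contMDiffAt hn))).congr_of_eventuallyEq ?_
  filter_upwards [eventually_extChartAt_symm (h.interior hx) hx' hn] with y hy
  have hs := (extChartAt (𝓡∂ n) x).map_target hy.1
  rw [inChart, h.innerD_eq hy.2 hs (ha.contMDiffAt (h.isOpen.mem_nhds hy.2))
    (hb.contMDiffAt (h.isOpen.mem_nhds hy.2)), (extChartAt (𝓡∂ n) x).right_inv hy.1]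

lemma IsRiemannianOn.inChart_innerD (h : IsRiemannianOn B W) (hx : x ∈ W)
    (hp : x ∈ (extChartAt (𝓡∂ n) p).source)
    (ha : ContMDiffOn (𝓡∂ n) 𝓘(ℝ) ∞ a W) (hb : ContMDiffOn (𝓡∂ n) 𝓘(ℝ) ∞ b W) :
    inChart p (innerD B a b) =ᶠ[𝓝 (extChartAt (𝓡∂ n) p x)]
      coordInner (gram B p) (inChart p a) (inChart p b) := by
  filter_upwards [eventually_extChartAt_symm (h.interior hx) hp (h.isOpen.mem_nhds hx)] with y hy
  have hs := (extChartAt (𝓡∂ n) p).map_target hy.1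
  rw [inChart, h.innerD_eq hy.2 hs (ha.contMDiffAt (h.isOpen.mem_nhds hy.2))
    (hb.contMDiffAt (h.isOpen.mem_nhds hy.2)), (extChartAt (𝓡∂ n) p).right_inv hy.1]

lemma IsRiemannianOn.innerD_innerD (h : IsRiemannianOn B W) (hx : x ∈ W)
    (ha : ContMDiffOn (𝓡∂ n) 𝓘(ℝ) ∞ a W) (hb : ContMDiffOn (𝓡∂ n) 𝓘(ℝ) ∞ b W) (c : M → ℝ) :
    innerD B c (innerD B a b) x = hessD B a c b x + hessD B b c a x := by
  have hx' := mem_extChartAt_source (I := 𝓡∂ n) x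
  have hn := h.isOpen.mem_nhds hx
  rw [innerD, coordInner_congr (h.inChart_innerD hx hx' ha hb),
    (h.metric x x hx hx').coordInner_coordInner
      (contDiffAt_inChart (h.interior hx) hx' (ha.contMDiffAt hn))
      (contDiffAt_inChart (h.interior hx) hx' (hb.contMDiffAt hn))]
  rfl

lemma IsRiemannianOn.innerD_comm (h : IsRiemannianOn B W) (hx : x ∈ W) (a b : M → ℝ) :
    innerD B a b x = innerD B b a x :=
  (h.metric x x hx (mem_extChartAt_source x)).coordInner_comm _ _

lemma IsRiemannianOn.hessD_comm (h : IsRiemannianOn B W) (hx : x ∈ W)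
    (hf : ContMDiffOn (𝓡∂ n) 𝓘(ℝ) ∞ f W) (a b : M → ℝ) : hessD B f a b x = hessD B f b a x :=
  (h.metric x x hx (mem_extChartAt_source x)).coordHess_dot_comm
    (contDiffAt_inChart (h.interior hx) (mem_extChartAt_source x)
      (hf.contMDiffAt (h.isOpen.mem_nhds hx))) _ _

lemma IsRiemannianOn.differentiableAt_inChart (h : IsRiemannianOn B W) (hx : x ∈ W)
    (ha : ContMDiffOn (𝓡∂ n) 𝓘(ℝ) ∞ a W) :
    DifferentiableAt ℝ (inChart x a) (extChartAt (𝓡∂ n) x x) :=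
  (contDiffAt_inChart (h.interior hx) (mem_extChartAt_source x)
    (ha.contMDiffAt (h.isOpen.mem_nhds hx))).diff

lemma inChart_self (a : M → ℝ) (x : M) : inChart x a (extChartAt (𝓡∂ n) x x) = a x := by
  simp only [inChart, extChartAt_to_inv]

lemma IsRiemannianOn.innerD_mul (h : IsRiemannianOn B W) (hx : x ∈ W)
    (ha : ContMDiffOn (𝓡∂ n) 𝓘(ℝ) ∞ a W) (hb : ContMDiffOn (𝓡∂ n) 𝓘(ℝ) ∞ b W) (c : M → ℝ) :
    innerD B (fun z => a z * b z) c x = a x * innerD B b c x + b x * innerD B a c x := by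
  have hy := (h.metric x x hx (mem_extChartAt_source x)).mem
  have : ∀ i, coordDiff (inChart x fun z => a z * b z) (extChartAt (𝓡∂ n) x x) i
      = a x * coordDiff (inChart x b) (extChartAt (𝓡∂ n) x x) i
        + b x * coordDiff (inChart x a) (extChartAt (𝓡∂ n) x x) i := by
    intro i
    rw [← inChart_self (n := n) a x, ← inChart_self (n := n) b x]
    exact pderiv_mul hy (h.differentiableAt_inChart hx ha) (h.differentiableAt_inChart hx hb)
  simp only [innerD, coordInner, this, Finset.mul_sum, ← Finset.sum_add_distrib]
  exact Finset.sum_congr rfl fun i _ => Finset.sum_congr rfl fun j _ => by ring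

lemma IsRiemannianOn.innerD_sub (h : IsRiemannianOn B W) (hx : x ∈ W)
    (ha : ContMDiffOn (𝓡∂ n) 𝓘(ℝ) ∞ a W) (hb : ContMDiffOn (𝓡∂ n) 𝓘(ℝ) ∞ b W) (c : M → ℝ) :
    innerD B (fun z => a z - b z) c x = innerD B a c x - innerD B b c x := by
  have hy := (h.metric x x hx (mem_extChartAt_source x)).mem
  have : ∀ i, coordDiff (inChart x fun z => a z - b z) (extChartAt (𝓡∂ n) x x) i
      = coordDiff (inChart x a) (extChartAt (𝓡∂ n) x x) i
        - coordDiff (inChart x b) (extChartAt (𝓡∂ n) x x) i := fun i =>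
    pderiv_sub hy (h.differentiableAt_inChart hx ha) (h.differentiableAt_inChart hx hb)
  simp only [innerD, coordInner, this, ← Finset.sum_sub_distrib]
  exact Finset.sum_congr rfl fun i _ => Finset.sum_congr rfl fun j _ => by ring

lemma IsRiemannianOn.innerD_sum (h : IsRiemannianOn B W) (hx : x ∈ W) {ι : Type*} (s : Finset ι)
    {a : ι → M → ℝ} (ha : ∀ k ∈ s, ContMDiffOn (𝓡∂ n) 𝓘(ℝ) ∞ (a k) W) (c : M → ℝ) :
    innerD B (fun z => ∑ k ∈ s, a k z) c x = ∑ k ∈ s, innerD B (a k) c x := by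
  have hy := (h.metric x x hx (mem_extChartAt_source x)).mem
  have : ∀ i, coordDiff (inChart x fun z => ∑ k ∈ s, a k z) (extChartAt (𝓡∂ n) x x) i
      = ∑ k ∈ s, coordDiff (inChart x (a k)) (extChartAt (𝓡∂ n) x x) i := fun i =>
    pderiv_sum hy s fun k hk => h.differentiableAt_inChart hx (ha k hk)
  simp only [innerD, coordInner, this]
  simp only [Finset.mul_sum, Finset.sum_mul]
  conv_rhs => rw [Finset.sum_comm]
  refine Finset.sum_congr rfl fun i _ => ?_
  rw [Finset.sum_comm]

lemma IsRiemannianOn.innerD_comp (h : IsRiemannianOn B W) (hx : x ∈ W) {F : ℝ → ℝ}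
    (hF : DifferentiableAt ℝ F (a x)) (ha : ContMDiffOn (𝓡∂ n) 𝓘(ℝ) ∞ a W) (c : M → ℝ) :
    innerD B (fun z => F (a z)) c x = deriv F (a x) * innerD B a c x := by
  have hy := (h.metric x x hx (mem_extChartAt_source x)).mem
  have : ∀ i, coordDiff (inChart x fun z => F (a z)) (extChartAt (𝓡∂ n) x x) i
      = deriv F (a x) * coordDiff (inChart x a) (extChartAt (𝓡∂ n) x x) i := by
    intro i
    rw [← inChart_self (n := n) a x] at hF ⊢
    exact pderiv_comp hy hF (h.differentiableAt_inChart hx ha)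
  simp only [innerD, coordInner, this, Finset.mul_sum]
  exact Finset.sum_congr rfl fun i _ => Finset.sum_congr rfl fun j _ => by ring

/-- The inner product of differentials is local. -/
lemma IsRiemannianOn.innerD_congr (h : IsRiemannianOn B W) (hx : x ∈ W) {a' : M → ℝ}
    (ha : a =ᶠ[𝓝 x] a') (c : M → ℝ) : innerD B a c x = innerD B a' c x :=
  coordInner_congr' (inChart_eventuallyEq (h.interior hx) (mem_extChartAt_source x) ha)
    Filter.EventuallyEq.rfl

end Charts
section Measure

variable {n : ℕ} [NeZero n] {M : Type*} [TopologicalSpace M]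
  [ChartedSpace (EuclideanHalfSpace n) M] [IsManifold (𝓡∂ n) ∞ M]
  [MeasurableSpace M] [BorelSpace M]
  {p q x : M} {y : Coord n} {B : BilinField n M} {W : Set M}

/-! ### The Riemannian measure in a chart -/

lemma measurableSet_target (p : M) : MeasurableSet (extChartAt (𝓡∂ n) p).target := by
  rw [extChartAt_target]
  exact (((chartAt _ p).open_target.preimage (𝓡∂ n).continuous_symm).measurableSet).inter
    (𝓡∂ n).isClosed_range.measurableSet

lemma measurableSet_target_inter (p : M) {s : Set M} (hs : MeasurableSet s) :
    MeasurableSet ((extChartAt (𝓡∂ n) p).target ∩ (extChartAt (𝓡∂ n) p).symm ⁻¹' s) := by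
  have h := (continuousOn_extChartAt_symm (I := 𝓡∂ n) p).domRestrict.measurable hs
  have := (measurableSet_target (n := n) p).subtype_image h
  convert this using 1
  ext z; simp [and_comm]

lemma aemeasurable_symm (p : M) :
    AEMeasurable (extChartAt (𝓡∂ n) p).symm
      (volume.restrict (extChartAt (𝓡∂ n) p).target) :=
  (continuousOn_extChartAt_symm p).aemeasurable (measurableSet_target p)

/-- The restriction of the chart measure to a measurable set. -/
lemma restrict_chartMeasure (B : BilinField n M) (p : M) {s : Set M} (hs : MeasurableSet s) :
    (chartMeasure B p).restrict s = Measure.map (extChartAt (𝓡∂ n) p).symm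
      ((volume.restrict ((extChartAt (𝓡∂ n) p).target ∩ (extChartAt (𝓡∂ n) p).symm ⁻¹' s)).withDensity
        fun y => ENNReal.ofReal √(gram B p y).det) := by
  rw [chartMeasure, Measure.restrict_map_of_aemeasurable
    ((aemeasurable_symm p).mono_ac (withDensity_absolutelyContinuous _ _)) hs,
    restrict_withDensity', Measure.restrict_restrict' (measurableSet_target p), inter_comm]

lemma chartMeasure_apply (B : BilinField n M) (p : M) {s : Set M} (hs : MeasurableSet s) :
    chartMeasure B p s
      = ∫⁻ y in (extChartAt (𝓡∂ n) p).target ∩ (extChartAt (𝓡∂ n) p).symm ⁻¹' s,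
          ENNReal.ofReal √(gram B p y).det := by
  rw [chartMeasure, Measure.map_apply_of_aemeasurable
    ((aemeasurable_symm p).mono_ac (withDensity_absolutelyContinuous _ _)) hs, withDensity_apply',
    Measure.restrict_restrict' (measurableSet_target p), inter_comm]

lemma det_fderiv_eq {φ : Coord n → Coord n} (hy : y ∈ interiorCoords n)
    (hφ : DifferentiableAt ℝ φ y) : (fderiv ℝ φ y).det = (jac φ y).det := by
  have : LinearMap.toMatrix (EuclideanSpace.basisFun (Fin n) ℝ).toBasis
      (EuclideanSpace.basisFun (Fin n) ℝ).toBasis (fderiv ℝ φ y : Coord n →ₗ[ℝ] Coord n)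
      = jac φ y := by
    ext a i
    rw [LinearMap.toMatrix_apply]
    simp only [OrthonormalBasis.coe_toBasis, EuclideanSpace.basisFun_apply,
      OrthonormalBasis.coe_toBasis_repr_apply, EuclideanSpace.basisFun_repr]
    exact fderiv_single_apply hy hφ a i
  rw [← this, LinearMap.det_toMatrix]

/-- The chart measures agree on the overlap of the charts. -/
lemma IsRiemannianOn.chartMeasure_eq (h : IsRiemannianOn B W) {s : Set M} (hs : MeasurableSet s)
    (hW : s ⊆ W) (hp : s ⊆ (extChartAt (𝓡∂ n) p).source)
    (hq : s ⊆ (extChartAt (𝓡∂ n) q).source) : chartMeasure B p s = chartMeasure B q s := by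
  rw [chartMeasure_apply B p hs, chartMeasure_apply B q hs]
  set ep := extChartAt (𝓡∂ n) p
  set eq := extChartAt (𝓡∂ n) q
  have himg : transition p q '' (ep.target ∩ ep.symm ⁻¹' s) = eq.target ∩ eq.symm ⁻¹' s := by
    ext z
    constructor
    · rintro ⟨y, ⟨hy, hys⟩, rfl⟩
      refine ⟨eq.map_source (hq hys), ?_⟩
      change eq.symm (eq (ep.symm y)) ∈ s
      rw [eq.left_inv (hq hys)]
      exact hys
    · rintro ⟨hz, hzs⟩
      refine ⟨ep (eq.symm z), ⟨ep.map_source (hp hzs), ?_⟩, ?_⟩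
      · simpa only [mem_preimage, ep.left_inv (hp hzs)] using hzs
      · simp only [transition]
        rw [ep.left_inv (hp hzs), eq.right_inv hz]
  have hpt : ∀ y ∈ ep.target ∩ ep.symm ⁻¹' s, ep (ep.symm y) = y := fun y hy => ep.right_inv hy.1
  have hdiff : ∀ y ∈ ep.target ∩ ep.symm ⁻¹' s, ContDiffAt ℝ ∞ (transition p q) y := by
    intro y hy
    have := contDiffAt_transition (n := n) (h.interior (hW hy.2)) (hp hy.2) (hq hy.2)
    rwa [show extChartAt (𝓡∂ n) p (ep.symm y) = y from hpt y hy] at this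
  have hinj : InjOn (transition p q) (ep.target ∩ ep.symm ⁻¹' s) := by
    intro y hy z hz hyz
    have h1 : eq (ep.symm y) = eq (ep.symm z) := hyz
    have h2 := eq.injOn (hq hy.2) (hq hz.2) h1
    rw [← hpt y hy, ← hpt z hz, h2]
  rw [← himg, lintegral_image_eq_lintegral_abs_det_fderiv_mul volume
    (measurableSet_target_inter p hs)
    (fun y hy => ((hdiff y hy).differentiableAt (by simp)).hasFDerivAt.hasFDerivWithinAt) hinj]
  refine setLIntegral_congr_fun (measurableSet_target_inter p hs) fun y hy => ?_
  have hi := h.isIsometryAt (hW hy.2) (hp hy.2) (hq hy.2)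
  rw [show extChartAt (𝓡∂ n) p (ep.symm y) = y from hpt y hy] at hi
  change ENNReal.ofReal √(gram B p y).det = _
  rw [hi.pullback.self_of_nhds, det_fderiv_eq hi.source.mem ((hdiff y hy).differentiableAt (by simp)),
    ← ENNReal.ofReal_mul (abs_nonneg _), det_mul, det_mul, det_transpose]
  congr 1
  rw [← Real.sqrt_sq_eq_abs, ← Real.sqrt_mul (sq_nonneg _)]
  congr 1; ring

/-- Within a chart domain in `W`, the Riemannian measure, which is a supremum of the chart
measures, is the chart measure: there, each other chart measure agrees with it on the overlap and
vanishes outside. -/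
lemma IsRiemannianOn.restrict_riemannianMeasure (h : IsRiemannianOn B W) (p : M) :
    (riemannianMeasure B).restrict (W ∩ (extChartAt (𝓡∂ n) p).source)
      = (chartMeasure B p).restrict (W ∩ (extChartAt (𝓡∂ n) p).source) := by
  set S := W ∩ (extChartAt (𝓡∂ n) p).source
  have hS : MeasurableSet S := (h.isOpen.inter (isOpen_extChartAt_source p)).measurableSet
  have hzero : ∀ q (s : Set M), MeasurableSet s →
      chartMeasure B q s = chartMeasure B q (s ∩ (extChartAt (𝓡∂ n) q).source) := by
    intro q s hs
    rw [chartMeasure_apply B q hs,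
      chartMeasure_apply B q (hs.inter (isOpen_extChartAt_source q).measurableSet)]
    congr 2
    ext z
    simp only [mem_inter_iff, mem_preimage]
    exact ⟨fun hz => ⟨hz.1, hz.2, (extChartAt (𝓡∂ n) q).map_target hz.1⟩,
      fun hz => ⟨hz.1, hz.2.1⟩⟩
  have hle : riemannianMeasure B
      ≤ (chartMeasure B p).restrict S + (riemannianMeasure B).restrict Sᶜ := by
    refine iSup_le fun q => ?_
    rw [Measure.le_iff]
    intro s hs
    rw [Measure.add_apply, Measure.restrict_apply hs, Measure.restrict_apply hs,
      ← measure_inter_add_sdiff s hS]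
    refine add_le_add ?_ ?_
    · rw [hzero q _ (hs.inter hS), h.chartMeasure_eq (p := q) (q := p)
        ((hs.inter hS).inter (isOpen_extChartAt_source q).measurableSet)
        (fun z hz => hz.1.2.1) (fun z hz => hz.2) (fun z hz => hz.1.2.2)]
      exact measure_mono inter_subset_left
    · exact Measure.le_iff'.1 (le_iSup (chartMeasure B) q) _
  refine le_antisymm ?_ (Measure.restrict_mono le_rfl (le_iSup (chartMeasure B) p))
  refine (Measure.restrict_mono (le_refl S) hle).trans ?_
  rw [Measure.restrict_add, Measure.restrict_restrict hS, Measure.restrict_restrict hS]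
  simp

/-- The integral over a chart domain in `W` is computed in the coordinates. -/
lemma IsRiemannianOn.integral_chart (h : IsRiemannianOn B W) (p : M) {F : M → ℝ}
    (hF : ContinuousOn F W) :
    ∫ x in W ∩ (extChartAt (𝓡∂ n) p).source, F x ∂(riemannianMeasure B)
      = ∫ y in (extChartAt (𝓡∂ n) p).target ∩ (extChartAt (𝓡∂ n) p).symm ⁻¹' W,
          √(gram B p y).det * F ((extChartAt (𝓡∂ n) p).symm y) := by
  set S := W ∩ (extChartAt (𝓡∂ n) p).source with hSdef
  have hS : MeasurableSet S := (h.isOpen.inter (isOpen_extChartAt_source p)).measurableSet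
  set Ω := (extChartAt (𝓡∂ n) p).target ∩ (extChartAt (𝓡∂ n) p).symm ⁻¹' W with hΩ
  have hΩm : MeasurableSet Ω := measurableSet_target_inter p h.isOpen.measurableSet
  have hΩS : (extChartAt (𝓡∂ n) p).target ∩ (extChartAt (𝓡∂ n) p).symm ⁻¹' S = Ω := by
    ext z
    simp only [hΩ, hSdef, mem_inter_iff, mem_preimage]
    exact ⟨fun hz => ⟨hz.1, hz.2.1⟩, fun hz => ⟨hz.1, hz.2,
      (extChartAt (𝓡∂ n) p).map_target hz.1⟩⟩
  have hd : AEMeasurable (fun y => Real.toNNReal √(gram B p y).det) (volume.restrict Ω) := by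
    refine ContinuousOn.aemeasurable (fun y hy => ?_) hΩm
    have := (h.metric p _ hy.2 ((extChartAt (𝓡∂ n) p).map_target hy.1)).contDiffAt_sqrt_det
    rw [(extChartAt (𝓡∂ n) p).right_inv hy.1] at this
    exact (continuous_real_toNNReal.continuousAt.comp this.continuousAt).continuousWithinAt
  have hrestr := restrict_chartMeasure B p hS
  rw [hΩS] at hrestr
  have hsymm : AEMeasurable (extChartAt (𝓡∂ n) p).symm ((volume.restrict Ω).withDensity
        fun y => ENNReal.ofReal √(gram B p y).det) :=
    ((aemeasurable_symm p).mono_measure (Measure.restrict_mono inter_subset_left le_rfl)).mono_ac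
      (withDensity_absolutelyContinuous _ _)
  have hFS : AEStronglyMeasurable F ((chartMeasure B p).restrict S) :=
    (hF.mono inter_subset_left).aestronglyMeasurable hS
  rw [h.restrict_riemannianMeasure p, hrestr]
  rw [hrestr] at hFS
  rw [integral_map hsymm hFS]
  have := integral_withDensity_eq_integral_smul₀ (μ := volume.restrict Ω) hd
    (fun y => F ((extChartAt (𝓡∂ n) p).symm y))
  rw [show (fun y => ENNReal.ofReal √(gram B p y).det)
    = fun y => ((Real.toNNReal √(gram B p y).det : ℝ≥0) : ℝ≥0∞) from rfl, this]
  refine integral_congr_ae (Eventually.of_forall fun y => ?_)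
  simp [NNReal.smul_def, Real.coe_toNNReal _ (Real.sqrt_nonneg _)]

lemma IsRiemannianOn.exists_measure_lt_top (h : IsRiemannianOn B W) (hx : x ∈ W) :
    ∃ s ∈ 𝓝 x, riemannianMeasure B s < ⊤ := by
  set e := extChartAt (𝓡∂ n) x with he
  have hx' := mem_extChartAt_source (I := 𝓡∂ n) x
  have hc := (h.metric x x hx hx').contDiffAt_sqrt_det.continuousAt
  set C := √(gram B x (e x)).det + 1
  obtain ⟨r, hr, hball⟩ := Metric.eventually_nhds_iff_ball.1
    (hc.eventually (gt_mem_nhds (show _ < C by simp [C, he])))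
  set s := (W ∩ e.source) ∩ (e.source ∩ e ⁻¹' Metric.ball (e x) r)
  have hso : IsOpen s := (h.isOpen.inter (isOpen_extChartAt_source x)).inter
    (isOpen_extChartAt_preimage' (I := 𝓡∂ n) x Metric.isOpen_ball)
  refine ⟨s, hso.mem_nhds ⟨⟨hx, hx'⟩, hx', Metric.mem_ball_self hr⟩, ?_⟩
  have h1 : riemannianMeasure B s = chartMeasure B x s := by
    rw [← Measure.restrict_eq_self (μ := riemannianMeasure B)
      (show s ⊆ W ∩ e.source from inter_subset_left), h.restrict_riemannianMeasure x,
      Measure.restrict_eq_self _ inter_subset_left]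
  rw [h1, chartMeasure_apply B x hso.measurableSet]
  have hsub : e.target ∩ e.symm ⁻¹' s ⊆ Metric.ball (e x) r := by
    intro z hz
    have := hz.2.2.2
    rwa [mem_preimage, e.right_inv hz.1] at this
  calc ∫⁻ y in e.target ∩ e.symm ⁻¹' s, ENNReal.ofReal √(gram B x y).det
      ≤ ∫⁻ y in Metric.ball (e x) r, ENNReal.ofReal √(gram B x y).det :=
        lintegral_mono_set hsub
    _ ≤ ∫⁻ _ in Metric.ball (e x) r, ENNReal.ofReal C :=
        setLIntegral_mono measurable_const fun y hy => ENNReal.ofReal_le_ofReal (hball y hy).le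
    _ < ⊤ := by
        rw [setLIntegral_const]
        exact ENNReal.mul_lt_top ENNReal.ofReal_lt_top measure_ball_lt_top

lemma IsRiemannianOn.measure_lt_top (h : IsRiemannianOn B W) {K : Set M} (hK : IsCompact K)
    (hKW : K ⊆ W) : riemannianMeasure B K < ⊤ :=
  hK.measure_lt_top_of_nhdsWithin fun _ hx =>
    let ⟨s, hs, hμ⟩ := h.exists_measure_lt_top (hKW hx)
    ⟨s, mem_nhdsWithin_of_mem_nhds hs, hμ⟩

lemma IsRiemannianOn.integrableOn_of_isCompact [T2Space M] (h : IsRiemannianOn B W) {K : Set M}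
    (hK : IsCompact K) (hKW : K ⊆ W) {F : M → ℝ} (hF : ContinuousOn F K) :
    IntegrableOn F K (riemannianMeasure B) := by
  have hKm := hK.measurableSet
  obtain ⟨C, hC⟩ := hK.exists_bound_of_continuousOn hF
  have : IsFiniteMeasure ((riemannianMeasure B).restrict K) :=
    ⟨by simpa using h.measure_lt_top hK hKW⟩
  exact Integrable.of_bound (hF.aestronglyMeasurable hKm) C
    ((ae_restrict_iff' hKm).2 (Eventually.of_forall hC))

/-- A continuous function on `W` which vanishes outside of a compact set is integrable. -/
lemma IsRiemannianOn.integrableOn [T2Space M] (h : IsRiemannianOn B W) {K : Set M}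
    (hK : IsCompact K) (hKW : K ⊆ W) {F : M → ℝ} (hF : ContinuousOn F W)
    (hF0 : ∀ x ∈ W, x ∉ K → F x = 0) : IntegrableOn F W (riemannianMeasure B) :=
  (h.integrableOn_of_isCompact hK hKW (hF.mono hKW)).of_forall_sdiff_eq_zero
    h.isOpen.measurableSet fun x hx => hF0 x hx.1 hx.2

end Measure
section Green

/-! ### Green's formula -/

section Coordinates

variable {n : ℕ} [NeZero n] {y : Coord n} {G : Coord n → Matrix (Fin n) (Fin n) ℝ}

/-- The integral of a partial derivative of a compactly supported function vanishes. -/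
lemma integral_pderiv_eq_zero {X : Coord n → ℝ} {O K : Set (Coord n)} (hO : IsOpen O)
    (hOi : O ⊆ interiorCoords n) (hK : IsCompact K) (hKO : K ⊆ O)
    (hX : ∀ y ∈ O, ContDiffAt ℝ ∞ X y) (hX0 : ∀ y ∈ O, y ∉ K → X y = 0) (i : Fin n) :
    ∫ y in O, pderiv i X y = 0 := by
  classical
  set Y : Coord n → ℝ := O.indicator X with hY
  have hYX : ∀ y ∈ O, Y =ᶠ[𝓝 y] X := fun y hy => by
    filter_upwards [hO.mem_nhds hy] with z hz using indicator_of_mem hz X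
  have hY0 : ∀ y ∉ K, Y =ᶠ[𝓝 y] fun _ => 0 := fun y hy => by
    filter_upwards [hK.isClosed.isOpen_compl.mem_nhds hy] with z hz
    by_cases hzO : z ∈ O
    · rw [hY, indicator_of_mem hzO, hX0 z hzO hz]
    · exact indicator_of_notMem hzO X
  have hsm : ContDiff ℝ 1 Y := by
    rw [contDiff_iff_contDiffAt]
    intro y
    by_cases hy : y ∈ K
    · exact ((hX y (hKO hy)).of_le (by exact_mod_cast le_top)).congr_of_eventuallyEq
        (hYX y (hKO hy))
    · exact contDiffAt_const.congr_of_eventuallyEq (hY0 y hy)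
  have hcs : HasCompactSupport Y :=
    HasCompactSupport.intro hK fun y hy => (hY0 y hy).self_of_nhds
  have hcs' : HasCompactSupport fun y => fderiv ℝ Y y (EuclideanSpace.single i 1) :=
    hcs.fderiv_apply (𝕜 := ℝ) _
  have hc' : Continuous fun y => fderiv ℝ Y y (EuclideanSpace.single i 1) :=
    (hsm.continuous_fderiv (by simp)).clm_apply continuous_const
  have h0 := integral_mul_fderiv_eq_neg_fderiv_mul_of_integrable (μ := (volume : Measure (Coord n)))
    (f := fun _ => (1 : ℝ)) (g := Y) (v := EuclideanSpace.single i (1 : ℝ)) (by simp)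
    (by simpa using hc'.integrable_of_hasCompactSupport hcs')
    (by simpa using hsm.continuous.integrable_of_hasCompactSupport hcs)
    (fun _ _ => differentiableAt_const (1 : ℝ)) (fun _ _ => (hsm.differentiable (by simp)).differentiableAt)
  simp only [one_mul, fderiv_fun_const, Pi.zero_apply, _root_.zero_apply, zero_mul,
    integral_zero, neg_zero] at h0
  rw [← h0, ← setIntegral_eq_integral_of_forall_compl_eq_zero (s := O)
    (f := fun y => fderiv ℝ Y y (EuclideanSpace.single i 1))]
  · refine setIntegral_congr_fun hO.measurableSet fun y hy => ?_
    rw [← pderiv_eq_fderiv (hOi hy), pderiv_congr (hYX y hy)]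
  · intro y hy
    rw [(hY0 y fun h => hy (hKO h)).fderiv_eq]
    simp

/-- Green's formula in coordinates. -/
lemma coord_green {a b : Coord n → ℝ} {O K : Set (Coord n)} (hO : IsOpen O)
    (hG : ∀ y ∈ O, IsMetricAt G y) (hK : IsCompact K) (hKO : K ⊆ O)
    (ha : ∀ y ∈ O, ContDiffAt ℝ ∞ a y) (hb : ∀ y ∈ O, ContDiffAt ℝ ∞ b y)
    (ha0 : ∀ y ∈ O, y ∉ K → a y = 0) :
    ∫ y in O, √(G y).det * (a y * coordLap G b y + coordInner G a b y) = 0 := by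
  set V : Fin n → Coord n → ℝ := fun i y => √(G y).det * coordGrad G b y i with hV
  have hVs : ∀ y ∈ O, ∀ i, ContDiffAt ℝ ∞ (V i) y := fun y hy i =>
    (hG y hy).contDiffAt_sqrt_det.mul ((hG y hy).contDiffAt_coordGrad (hb y hy) i)
  have e1 : ∀ y ∈ O, √(G y).det * (a y * coordLap G b y + coordInner G a b y)
      = ∑ i, pderiv i (fun z => a z * V i z) y := by
    intro y hy
    have : ∀ i, pderiv i (fun z => a z * V i z) y
        = a y * pderiv i (V i) y + √(G y).det * (coordDiff a y i * coordGrad G b y i) := by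
      intro i
      rw [pderiv_mul (hG y hy).mem (ha y hy).diff (hVs y hy i).diff]
      simp only [hV, coordDiff]; ring
    simp only [this, Finset.sum_add_distrib, ← Finset.mul_sum]
    rw [(hG y hy).divergence_coordGrad (hb y hy), coordInner_eq, dotProduct]
    ring
  have hX : ∀ i, ∀ y ∈ O, ContDiffAt ℝ ∞ (fun z => a z * V i z) y := fun i y hy =>
    (ha y hy).mul (hVs y hy i)
  rw [setIntegral_congr_fun hO.measurableSet e1, integral_finsetSum]
  · exact Finset.sum_eq_zero fun i _ => integral_pderiv_eq_zero hO (fun y hy => (hG y hy).mem) hK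
      hKO (hX i) (fun y hy hyK => by rw [ha0 y hy hyK, zero_mul]) i
  · intro i _
    have hc : ContinuousOn (pderiv i fun z => a z * V i z) O := fun y hy =>
      (contDiffAt_pderiv (hG y hy).mem (hX i y hy) i).continuousAt.continuousWithinAt
    refine ((hc.mono hKO).integrableOn_compact hK).of_forall_sdiff_eq_zero hO.measurableSet ?_
    intro y hy
    have : (fun z => a z * V i z) =ᶠ[𝓝 y] fun _ => 0 := by
      filter_upwards [hO.mem_nhds hy.1, hK.isClosed.isOpen_compl.mem_nhds hy.2] with z h1 h2
      rw [ha0 z h1 h2, zero_mul]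
    rw [pderiv_congr this, pderiv_const (hG y hy.1).mem]

lemma IsMetricAt.contDiffAt_coordHess (h : IsMetricAt G y) {f : Coord n → ℝ}
    (hf : ContDiffAt ℝ ∞ f y) (i j : Fin n) : ContDiffAt ℝ ∞ (fun z => coordHess G f z i j) y := by
  simp only [coordHess, of_apply, coordChristoffel]
  refine (contDiffAt_pderiv h.mem (contDiffAt_pderiv h.mem hf j) i).sub
    (ContDiffAt.sum fun k _ => ContDiffAt.mul (contDiffAt_const.mul (ContDiffAt.sum fun l _ =>
      (h.contDiffAt_inv k l).mul ?_)) (contDiffAt_pderiv h.mem hf k))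
  exact ((contDiffAt_pderiv h.mem (h.contDiffAt _ _) _).add
    (contDiffAt_pderiv h.mem (h.contDiffAt _ _) _)).sub
    (contDiffAt_pderiv h.mem (h.contDiffAt _ _) _)

lemma IsMetricAt.contDiffAt_coordLap (h : IsMetricAt G y) {f : Coord n → ℝ}
    (hf : ContDiffAt ℝ ∞ f y) : ContDiffAt ℝ ∞ (coordLap G f) y := by
  have : coordLap G f = fun z => ∑ i, ∑ j, (G z)⁻¹ i j * coordHess G f z j i := by
    ext z; simp [coordLap, Matrix.trace, Matrix.mul_apply]
  rw [this]
  exact ContDiffAt.sum fun i _ => ContDiffAt.sum fun j _ =>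
    (h.contDiffAt_inv i j).mul (h.contDiffAt_coordHess hf j i)

end Coordinates

variable {n : ℕ} [NeZero n] {M : Type*} [TopologicalSpace M]
  [ChartedSpace (EuclideanHalfSpace n) M] [IsManifold (𝓡∂ n) ∞ M]
  {p x : M} {B : BilinField n M} {W : Set M} {a b f : M → ℝ}

lemma IsRiemannianOn.contMDiffOn_lap (h : IsRiemannianOn B W)
    (hf : ContMDiffOn (𝓡∂ n) 𝓘(ℝ) ∞ f W) : ContMDiffOn (𝓡∂ n) 𝓘(ℝ) ∞ (lap B f) W := by
  intro x hx
  have hx' := mem_extChartAt_source (I := 𝓡∂ n) x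
  refine (contMDiffAt_of_inChart hx' ?_).contMDiffWithinAt
  have hn := h.isOpen.mem_nhds hx
  refine ((h.metric x x hx hx').contDiffAt_coordLap
    (contDiffAt_inChart (h.interior hx) hx' (hf.contMDiffAt hn))).congr_of_eventuallyEq ?_
  filter_upwards [eventually_extChartAt_symm (h.interior hx) hx' hn] with y hy
  have hs := (extChartAt (𝓡∂ n) x).map_target hy.1
  rw [inChart, h.lap_eq hy.2 hs (hf.contMDiffAt (h.isOpen.mem_nhds hy.2)),
    (extChartAt (𝓡∂ n) x).right_inv hy.1]

variable [MeasurableSpace M] [BorelSpace M]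

lemma IsRiemannianOn.isOpen_chart (h : IsRiemannianOn B W) (p : M) :
    IsOpen ((extChartAt (𝓡∂ n) p).target ∩ (extChartAt (𝓡∂ n) p).symm ⁻¹' W) := by
  rw [isOpen_iff_mem_nhds]
  intro y hy
  have hs := (extChartAt (𝓡∂ n) p).map_target hy.1
  have := eventually_extChartAt_symm (h.interior hy.2) hs (h.isOpen.mem_nhds hy.2)
  rwa [(extChartAt (𝓡∂ n) p).right_inv hy.1] at this

/-- Green's formula for a function `a` with compact support in a chart domain, by integration by
parts in that chart. -/
lemma IsRiemannianOn.green_chart [T2Space M] (h : IsRiemannianOn B W) (p : M) {K : Set M}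
    (hK : IsCompact K) (hKW : K ⊆ W) (hKp : K ⊆ (extChartAt (𝓡∂ n) p).source)
    (ha : ContMDiffOn (𝓡∂ n) 𝓘(ℝ) ∞ a W) (hb : ContMDiffOn (𝓡∂ n) 𝓘(ℝ) ∞ b W)
    (ha0 : ∀ x ∈ W, x ∉ K → a x = 0) :
    ∫ x in W, (a x * lap B b x + innerD B a b x) ∂(riemannianMeasure B) = 0 := by
  set e := extChartAt (𝓡∂ n) p
  have hF : ContinuousOn (fun x => a x * lap B b x + innerD B a b x) W :=
    (ha.continuousOn.mul (h.contMDiffOn_lap hb).continuousOn).add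
      (h.contMDiffOn_innerD ha hb).continuousOn
  have hsub : W ∩ e.source ⊆ W := inter_subset_left
  have hz : ∀ x ∈ W \ (W ∩ e.source), a x * lap B b x + innerD B a b x = 0 := by
    intro x hx
    have hxK : x ∉ K := fun hxK => hx.2 ⟨hx.1, hKp hxK⟩
    have : a =ᶠ[𝓝 x] fun _ => 0 := by
      filter_upwards [h.isOpen.mem_nhds hx.1, hK.isClosed.isOpen_compl.mem_nhds hxK] with z h1 h2
        using ha0 z h1 h2
    rw [h.innerD_congr hx.1 this, this.self_of_nhds]
    have h0 := h.innerD_comp (a := fun _ : M => (0 : ℝ)) hx.1 (F := fun _ => 0)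
      (differentiableAt_const _) contMDiffOn_const b
    simp at h0
    rw [h0]; ring
  rw [setIntegral_eq_of_subset_of_forall_sdiff_eq_zero h.isOpen.measurableSet hsub hz,
    h.integral_chart p hF]
  set O := e.target ∩ e.symm ⁻¹' W
  have hO : IsOpen O := h.isOpen_chart p
  have hmem : ∀ y ∈ O, e.symm y ∈ W ∧ e.symm y ∈ e.source ∧ e (e.symm y) = y := fun y hy =>
    ⟨hy.2, e.map_target hy.1, e.right_inv hy.1⟩
  have hsm : ∀ {f : M → ℝ}, ContMDiffOn (𝓡∂ n) 𝓘(ℝ) ∞ f W → ∀ y ∈ O,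
      ContDiffAt ℝ ∞ (inChart p f) y := by
    intro f hf y hy
    obtain ⟨h1, h2, h3⟩ := hmem y hy
    have := contDiffAt_inChart (h.interior h1) h2 (hf.contMDiffAt (h.isOpen.mem_nhds h1))
    rwa [show extChartAt (𝓡∂ n) p (e.symm y) = y from h3] at this
  have hG : ∀ y ∈ O, IsMetricAt (gram B p) y := by
    intro y hy
    obtain ⟨h1, h2, h3⟩ := hmem y hy
    have := h.metric p _ h1 h2
    rwa [show extChartAt (𝓡∂ n) p (e.symm y) = y from h3] at this
  have key := coord_green (G := gram B p) (a := inChart p a) (b := inChart p b) (K := e '' K) hO hG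
    (hK.image_of_continuousOn ((continuousOn_extChartAt p).mono hKp))
    (by
      rintro _ ⟨x, hx, rfl⟩
      exact ⟨e.map_source (hKp hx), by rw [mem_preimage, e.left_inv (hKp hx)]; exact hKW hx⟩)
    (hsm ha) (hsm hb) (by
      intro y hy hyK
      exact ha0 _ hy.2 fun hm => hyK ⟨_, hm, (hmem y hy).2.2⟩)
  rw [← key]
  refine setIntegral_congr_fun hO.measurableSet fun y hy => ?_
  obtain ⟨h1, h2, h3⟩ := hmem y hy
  have hn := h.isOpen.mem_nhds h1
  change _ * (_ * lap B b (e.symm y) + innerD B a b (e.symm y)) = _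
  rw [h.lap_eq h1 h2 (hb.contMDiffAt hn), h.innerD_eq h1 h2 (ha.contMDiffAt hn) (hb.contMDiffAt hn),
    show extChartAt (𝓡∂ n) p (e.symm y) = y from h3]
  rfl

/-- Green's formula: `∫ a Δb + ⟨da, db⟩ = 0` if `a` is compactly supported in `W`. -/
theorem IsRiemannianOn.green [T2Space M] [CompactSpace M] (h : IsRiemannianOn B W) {K : Set M}
    (hK : IsCompact K) (hKW : K ⊆ W)
    (ha : ContMDiffOn (𝓡∂ n) 𝓘(ℝ) ∞ a W) (hb : ContMDiffOn (𝓡∂ n) 𝓘(ℝ) ∞ b W)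
    (ha0 : ∀ x ∈ W, x ∉ K → a x = 0) :
    IntegrableOn (fun x => a x * lap B b x + innerD B a b x) W (riemannianMeasure B) ∧
    ∫ x in W, (a x * lap B b x + innerD B a b x) ∂(riemannianMeasure B) = 0 := by
  have hint : ∀ {a : M → ℝ} {K : Set M}, IsCompact K → K ⊆ W →
      ContMDiffOn (𝓡∂ n) 𝓘(ℝ) ∞ a W → (∀ x ∈ W, x ∉ K → a x = 0) →
      IntegrableOn (fun x => a x * lap B b x + innerD B a b x) W (riemannianMeasure B) := by
    intro a K hK hKW ha ha0
    refine h.integrableOn hK hKW ((ha.continuousOn.mul (h.contMDiffOn_lap hb).continuousOn).add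
      (h.contMDiffOn_innerD ha hb).continuousOn) fun x hx hxK => ?_
    have : a =ᶠ[𝓝 x] fun _ => 0 := by
      filter_upwards [h.isOpen.mem_nhds hx, hK.isClosed.isOpen_compl.mem_nhds hxK] with z h1 h2
        using ha0 z h1 h2
    rw [h.innerD_congr hx this, this.self_of_nhds]
    have h0 := h.innerD_comp (a := fun _ : M => (0 : ℝ)) hx (F := fun _ => 0)
      (differentiableAt_const _) contMDiffOn_const b
    simp at h0
    rw [h0]; ring
  refine ⟨hint hK hKW ha ha0, ?_⟩
  obtain ⟨φ, hφ⟩ := SmoothPartitionOfUnity.exists_isSubordinate_chartAt_source (𝓡∂ n) M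
  have hfin : {k | (Function.support (φ k)).Nonempty}.Finite :=
    φ.locallyFinite.finite_nonempty_of_compact
  set s := hfin.toFinset
  have hsum : ∀ x, ∑ k ∈ s, φ k x = 1 := by
    intro x
    rw [← φ.sum_eq_one (mem_univ x), finsum_eq_sum_of_support_subset]
    intro k hk
    simp only [s, Finite.coe_toFinset, mem_ofPred_eq]
    exact ⟨x, hk⟩
  set a' : M → M → ℝ := fun k x => φ k x * a x
  have ha' : ∀ k, ContMDiffOn (𝓡∂ n) 𝓘(ℝ) ∞ (a' k) W := fun k =>
    ((φ k).contMDiff.contMDiffOn).mul ha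
  have haa : a = fun x => ∑ k ∈ s, a' k x := by
    ext x; simp only [a', ← Finset.sum_mul, hsum, one_mul]
  have hcomp : ∀ k, IsCompact (K ∩ tsupport (φ k)) := fun k =>
    hK.inter_right (isClosed_tsupport _)
  have ha0' : ∀ k, ∀ x ∈ W, x ∉ K ∩ tsupport (φ k) → a' k x = 0 := by
    intro k x hx hxK
    by_cases hxk : x ∈ K
    · have : φ k x = 0 := image_eq_zero_of_notMem_tsupport fun ht => hxK ⟨hxk, ht⟩
      simp only [a', this, zero_mul]
    · simp only [a', ha0 x hx hxk, mul_zero]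
  have e1 : ∀ x ∈ W, a x * lap B b x + innerD B a b x
      = ∑ k ∈ s, (a' k x * lap B b x + innerD B (a' k) b x) := by
    intro x hx
    rw [Finset.sum_add_distrib, ← h.innerD_sum hx s (fun k _ => ha' k), ← Finset.sum_mul, ← haa]
    congr 2
    exact congrFun haa x
  rw [setIntegral_congr_fun h.isOpen.measurableSet e1, integral_finsetSum]
  · refine Finset.sum_eq_zero fun k _ => ?_
    refine h.green_chart k (hcomp k) (inter_subset_left.trans hKW) ?_ (ha' k) hb (ha0' k)
    rw [extChartAt_source]
    exact inter_subset_right.trans (hφ k)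
  · exact fun k _ => hint (hcomp k) (inter_subset_left.trans hKW) (ha' k) (ha0' k)

end Green
section MatrixNorms

/-! ### Norms of tensors with respect to a positive definite matrix -/

variable {n : ℕ} {G S S' C : Matrix (Fin n) (Fin n) ℝ} {v w : Fin n → ℝ}

lemma tensorNormSq_eq_trace (G S : Matrix (Fin n) (Fin n) ℝ) :
    tensorNormSq G S = (Sᵀ * G⁻¹ * S * G⁻¹ᵀ).trace := by
  simp only [tensorNormSq, Matrix.trace, diag_apply, Matrix.mul_apply, transpose_apply,
    Finset.sum_mul]
  rw [Finset.sum_comm]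
  refine Finset.sum_congr rfl fun j _ => ?_
  calc _ = ∑ i, ∑ l, ∑ k, G⁻¹ i k * G⁻¹ j l * S i j * S k l :=
      Finset.sum_congr rfl fun i _ => Finset.sum_comm
    _ = ∑ l, ∑ i, ∑ k, G⁻¹ i k * G⁻¹ j l * S i j * S k l := Finset.sum_comm
    _ = ∑ l, ∑ k, ∑ i, G⁻¹ i k * G⁻¹ j l * S i j * S k l :=
      Finset.sum_congr rfl fun l _ => Finset.sum_comm
    _ = _ := Finset.sum_congr rfl fun l _ => Finset.sum_congr rfl fun k _ =>
      Finset.sum_congr rfl fun i _ => by ring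

open scoped MatrixOrder in
lemma exists_inv_eq_transpose_mul_self (hG : G.PosDef) :
    ∃ C : Matrix (Fin n) (Fin n) ℝ, G⁻¹ = Cᵀ * C := by
  obtain ⟨C, hC⟩ := CStarAlgebra.nonneg_iff_eq_star_mul_self.1 hG.inv.posSemidef.nonneg
  exact ⟨C, by simpa [star_eq_conjTranspose] using hC⟩

lemma tensorNormSq_eq_sum (hC : G⁻¹ = Cᵀ * C) (S : Matrix (Fin n) (Fin n) ℝ) :
    tensorNormSq G S = ∑ i, ∑ j, (C * S * Cᵀ) i j ^ 2 := by
  have h1 : ∑ i, ∑ j, (C * S * Cᵀ) i j ^ 2 = ((C * S * Cᵀ)ᵀ * (C * S * Cᵀ)).trace := by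
    simp only [Matrix.trace, diag_apply, Matrix.mul_apply (M := (C * S * Cᵀ)ᵀ), transpose_apply, sq]
    exact Finset.sum_comm
  rw [tensorNormSq_eq_trace, h1, hC]
  simp only [transpose_mul, transpose_transpose, mul_assoc]
  rw [Matrix.trace_mul_comm C]
  simp only [mul_assoc]

lemma tensorNormSq_nonneg (hG : G.PosDef) (S : Matrix (Fin n) (Fin n) ℝ) :
    0 ≤ tensorNormSq G S := by
  obtain ⟨C, hC⟩ := exists_inv_eq_transpose_mul_self hG
  rw [tensorNormSq_eq_sum hC]
  positivity

lemma sqrt_sum_sq_add_le {ι : Type*} (s : Finset ι) (a b : ι → ℝ) :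
    √(∑ i ∈ s, (a i + b i) ^ 2) ≤ √(∑ i ∈ s, a i ^ 2) + √(∑ i ∈ s, b i ^ 2) := by
  have := Real.Lp_add_le s a b (p := 2) (by norm_num)
  simpa [Real.sqrt_eq_rpow] using this

/-- The triangle inequality for the norm of tensors. -/
lemma sqrt_tensorNormSq_add_le (hG : G.PosDef) (S S' : Matrix (Fin n) (Fin n) ℝ) :
    √(tensorNormSq G (S + S')) ≤ √(tensorNormSq G S) + √(tensorNormSq G S') := by
  obtain ⟨C, hC⟩ := exists_inv_eq_transpose_mul_self hG
  have := sqrt_sum_sq_add_le Finset.univ (fun ij : Fin n × Fin n => (C * S * Cᵀ) ij.1 ij.2)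
    (fun ij => (C * S' * Cᵀ) ij.1 ij.2)
  simp only [tensorNormSq_eq_sum hC, ← Fintype.sum_prod_type'] at this ⊢
  simpa [Matrix.mul_add, Matrix.add_mul] using this

lemma tensorNormSq_smul (G S : Matrix (Fin n) (Fin n) ℝ) (c : ℝ) :
    tensorNormSq G (c • S) = c ^ 2 * tensorNormSq G S := by
  simp only [tensorNormSq, Finset.mul_sum, Matrix.smul_apply, smul_eq_mul]
  refine Finset.sum_congr rfl fun i _ => Finset.sum_congr rfl fun j _ =>
    Finset.sum_congr rfl fun k _ => Finset.sum_congr rfl fun l _ => by ring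

lemma sqrt_tensorNormSq_smul (G S : Matrix (Fin n) (Fin n) ℝ) (c : ℝ) :
    √(tensorNormSq G (c • S)) = |c| * √(tensorNormSq G S) := by
  rw [tensorNormSq_smul, Real.sqrt_mul (sq_nonneg _), Real.sqrt_sq_eq_abs]

/-- The norm of the metric itself. -/
lemma tensorNormSq_self (hG : G.PosDef) : tensorNormSq G G = n := by
  have hu : IsUnit G.det := (hG.det_pos).ne'.isUnit
  have ht : Gᵀ = G := by simpa using hG.isHermitian.eq
  have ht' : G⁻¹ᵀ = G⁻¹ := by rw [transpose_nonsing_inv, ht]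
  rw [tensorNormSq_eq_trace, ht, ht', Matrix.mul_nonsing_inv _ hu]
  simp [Matrix.mul_nonsing_inv _ hu]

/-- Replacing `G` by `c⁻¹ • G` multiplies the squared norm of 2-tensors by `c ^ 2`. -/
lemma tensorNormSq_inv_smul {c : ℝ} (hc : c ≠ 0) (hG : G.PosDef) (S : Matrix (Fin n) (Fin n) ℝ) :
    tensorNormSq (c⁻¹ • G) S = c ^ 2 * tensorNormSq G S := by
  have hu : IsUnit G.det := (hG.det_pos).ne'.isUnit
  have : (c⁻¹ • G)⁻¹ = c • G⁻¹ := by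
    refine Matrix.inv_eq_right_inv ?_
    simp [Matrix.mul_nonsing_inv _ hu, smul_smul, hc]
  simp only [tensorNormSq, this, Finset.mul_sum, Matrix.smul_apply, smul_eq_mul]
  refine Finset.sum_congr rfl fun i _ => Finset.sum_congr rfl fun j _ =>
    Finset.sum_congr rfl fun k _ => Finset.sum_congr rfl fun l _ => by ring

lemma sq_trace_le (hG : G.PosDef) (S : Matrix (Fin n) (Fin n) ℝ) :
    (G⁻¹ * S).trace ^ 2 ≤ n * tensorNormSq G S := by
  obtain ⟨C, hC⟩ := exists_inv_eq_transpose_mul_self hG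
  have h1 : (G⁻¹ * S).trace = ∑ i, (C * S * Cᵀ) i i := by
    rw [hC, mul_assoc, Matrix.trace_mul_comm]; rfl
  rw [h1, tensorNormSq_eq_sum hC]
  have h2 := sq_sum_le_card_mul_sum_sq (s := Finset.univ) (f := fun i => (C * S * Cᵀ) i i)
  simp only [Finset.card_univ, Fintype.card_fin] at h2
  refine h2.trans (mul_le_mul_of_nonneg_left ?_ (Nat.cast_nonneg _))
  exact Finset.sum_le_sum fun i _ =>
    Finset.single_le_sum (f := fun j => (C * S * Cᵀ) i j ^ 2) (fun _ _ => sq_nonneg _)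
      (Finset.mem_univ i)

lemma covectorNormSq_eq_sum (hC : G⁻¹ = Cᵀ * C) (v : Fin n → ℝ) :
    covectorNormSq G v = ∑ i, (C *ᵥ v) i ^ 2 := by
  have h1 : covectorNormSq G v = v ⬝ᵥ G⁻¹ *ᵥ v := by
    simp only [covectorNormSq, dotProduct, mulVec, Finset.mul_sum]
    exact Finset.sum_congr rfl fun i _ => Finset.sum_congr rfl fun j _ => by ring
  have h2 : ∑ i, (C *ᵥ v) i ^ 2 = (C *ᵥ v) ⬝ᵥ (C *ᵥ v) := by
    simp only [dotProduct, sq]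
  rw [h1, h2, hC, ← mulVec_mulVec, dotProduct_mulVec, vecMul_transpose]

lemma sq_sum_sum_mul_le (S : Matrix (Fin n) (Fin n) ℝ) (v w : Fin n → ℝ) :
    (v ⬝ᵥ S *ᵥ w) ^ 2 ≤ (∑ i, ∑ j, S i j ^ 2) * (∑ i, v i ^ 2) * ∑ i, w i ^ 2 := by
  have h1 : (v ⬝ᵥ S *ᵥ w) ^ 2 ≤ (∑ i, v i ^ 2) * ∑ i, (S *ᵥ w) i ^ 2 :=
    Finset.sum_mul_sq_le_sq_mul_sq _ _ _
  have h2 : ∑ i, (S *ᵥ w) i ^ 2 ≤ (∑ i, ∑ j, S i j ^ 2) * ∑ i, w i ^ 2 := by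
    rw [Finset.sum_mul]
    exact Finset.sum_le_sum fun i _ => Finset.sum_mul_sq_le_sq_mul_sq Finset.univ (S i) w
  calc _ ≤ _ := h1
    _ ≤ (∑ i, v i ^ 2) * ((∑ i, ∑ j, S i j ^ 2) * ∑ i, w i ^ 2) :=
      mul_le_mul_of_nonneg_left h2 (by positivity)
    _ = _ := by ring

/-- The Cauchy–Schwarz inequality for the value of a 2-tensor at the vectors which are dual
to `v` and `w`. -/
lemma sq_dotProduct_mulVec_inv_le (hG : G.PosDef) (S : Matrix (Fin n) (Fin n) ℝ)
    (v w : Fin n → ℝ) :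
    ((G⁻¹ *ᵥ v) ⬝ᵥ S *ᵥ (G⁻¹ *ᵥ w)) ^ 2
      ≤ tensorNormSq G S * covectorNormSq G v * covectorNormSq G w := by
  obtain ⟨C, hC⟩ := exists_inv_eq_transpose_mul_self hG
  have := sq_sum_sum_mul_le (C * S * Cᵀ) (C *ᵥ v) (C *ᵥ w)
  rw [tensorNormSq_eq_sum hC, covectorNormSq_eq_sum hC, covectorNormSq_eq_sum hC]
  convert this using 2
  rw [hC, ← mulVec_mulVec v, mulVec_transpose, ← dotProduct_mulVec]
  simp only [mulVec_mulVec, mul_assoc]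

lemma sq_dotProduct_inv_mulVec_le (hG : G.PosDef) (v w : Fin n → ℝ) :
    (v ⬝ᵥ G⁻¹ *ᵥ w) ^ 2 ≤ covectorNormSq G v * covectorNormSq G w := by
  obtain ⟨C, hC⟩ := exists_inv_eq_transpose_mul_self hG
  rw [covectorNormSq_eq_sum hC, covectorNormSq_eq_sum hC, hC, ← mulVec_mulVec, dotProduct_mulVec,
    vecMul_transpose]
  exact Finset.sum_mul_sq_le_sq_mul_sq _ _ _

/-- The norm of a 2-tensor does not depend on the coordinates. -/
lemma tensorNormSq_transform {G' J : Matrix (Fin n) (Fin n) ℝ} (hJ : G'⁻¹ = J * G⁻¹ * Jᵀ)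
    (S : Matrix (Fin n) (Fin n) ℝ) : tensorNormSq G (Jᵀ * S * J) = tensorNormSq G' S := by
  rw [tensorNormSq_eq_trace, tensorNormSq_eq_trace, hJ]
  simp only [transpose_mul, transpose_transpose, mul_assoc]
  rw [Matrix.trace_mul_comm Jᵀ]
  simp only [mul_assoc]

end MatrixNorms
section Infinity

/-! ### Smoothness up to the boundary of the compactified metric -/

variable {n : ℕ} [NeZero n] {M : Type*} [TopologicalSpace M]
  [ChartedSpace (EuclideanHalfSpace n) M] [IsManifold (𝓡∂ n) ∞ M]
  {p q x : M} {y : Coord n}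

open Bundle in
/-- Smoothness of the metric, evaluated on two vectors which are constant in a trivialization of
the tangent bundle. -/
lemma contMDiffOn_metric (h : ContMDiffRiemannianMetric (𝓡∂ n) ∞ (EuclideanSpace ℝ (Fin n))
    (fun x : M => TangentSpace (𝓡∂ n) x)) (p : M) (v w : Coord n) :
    ContMDiffOn (𝓡∂ n) 𝓘(ℝ) ∞ (fun m => h.inner m
      ((trivializationAt (Coord n) (TangentSpace (𝓡∂ n)) p).symmL ℝ m v)
      ((trivializationAt (Coord n) (TangentSpace (𝓡∂ n)) p).symmL ℝ m w))
      (chartAt (EuclideanHalfSpace n) p).source := by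
  have hv : ∀ v : Coord n, ContMDiffOn (𝓡∂ n) ((𝓡∂ n).prod 𝓘(ℝ, Coord n)) ∞ (fun m => (TotalSpace.mk' (Coord n) m
      ((trivializationAt (Coord n) (TangentSpace (𝓡∂ n)) p).symmL ℝ m v) : TotalSpace (Coord n) (TangentSpace (𝓡∂ n) : M → Type _)))
      (chartAt (EuclideanHalfSpace n) p).source := by
    intro v x hx
    refine ContMDiffWithinAt.clm_bundle_apply (F₁ := Coord n) (E₁ := Bundle.Trivial M (Coord n)) ?_ ?_ (b := id) (v := fun _ => v)
    · exact (((trivializationAt (Coord n) (TangentSpace (𝓡∂ n)) p).contMDiffAt_symmL hx)).contMDiffWithinAt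
    · simp only [contMDiffWithinAt_totalSpace]
      exact ⟨contMDiffWithinAt_id, contMDiffWithinAt_const⟩
  intro x hx
  have : ContMDiffWithinAt (𝓡∂ n) ((𝓡∂ n).prod 𝓘(ℝ)) ∞
      (fun m ↦ TotalSpace.mk' ℝ (E := Bundle.Trivial M ℝ) (id m) (h.inner m
      ((trivializationAt (Coord n) (TangentSpace (𝓡∂ n)) p).symmL ℝ m v)
      ((trivializationAt (Coord n) (TangentSpace (𝓡∂ n)) p).symmL ℝ m w))) (chartAt (EuclideanHalfSpace n) p).source x := by
    apply ContMDiffWithinAt.clm_bundle_apply₂ (F₁ := Coord n) (F₂ := Coord n)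
    · exact (h.contMDiff x).contMDiffWithinAt
    · exact hv v x hx
    · exact hv w x hx
  simp only [contMDiffWithinAt_totalSpace] at this
  exact this.2

/-- The matrix of the metric is smooth up to the boundary: the coordinate fields are the frame of
the trivialization of the tangent bundle over the chart. -/
lemma contDiffOn_gram (h : Bundle.ContMDiffRiemannianMetric (𝓡∂ n) ∞ (EuclideanSpace ℝ (Fin n))
    (fun x : M => TangentSpace (𝓡∂ n) x)) (p : M) (i j : Fin n) :
    ContDiffOn ℝ ∞ (fun y => gram h.inner p y i j) (extChartAt (𝓡∂ n) p).target := by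
  rw [← contMDiffOn_iff_contDiffOn]
  refine ((contMDiffOn_metric h p (EuclideanSpace.single i 1) (EuclideanSpace.single j 1)).comp
    (contMDiffOn_extChartAt_symm p) ?_).congr ?_
  · intro y hy
    have := (extChartAt (𝓡∂ n) p).map_target hy
    rwa [extChartAt_source] at this
  · intro y hy
    have h1 := (extChartAt (𝓡∂ n) p).map_target hy
    rw [extChartAt_source] at h1
    simp only [gram, of_apply, Function.comp_apply, coordVec]
    rw [TangentBundle.symmL_trivializationAt h1, (extChartAt (𝓡∂ n) p).right_inv hy]
    rfl

lemma posDef_gram (h : Bundle.ContMDiffRiemannianMetric (𝓡∂ n) ∞ (EuclideanSpace ℝ (Fin n))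
    (fun x : M => TangentSpace (𝓡∂ n) x)) (p : M) (hy : y ∈ (extChartAt (𝓡∂ n) p).target) :
    (gram h.inner p y).PosDef := by
  set L : Coord n →L[ℝ] Coord n := mfderivWithin 𝓘(ℝ, EuclideanSpace ℝ (Fin n)) (𝓡∂ n) (extChartAt (𝓡∂ n) p).symm
    (range (𝓡∂ n)) y with hL
  have hinj : Function.Injective L :=
    (isInvertible_mfderivWithin_extChartAt_symm (I := 𝓡∂ n) hy).injective
  set b : Coord n →L[ℝ] Coord n →L[ℝ] ℝ := h.inner ((extChartAt (𝓡∂ n) p).symm y) with hb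
  have hG : ∀ i j, gram h.inner p y i j
    = b (L (EuclideanSpace.single i 1)) (L (EuclideanSpace.single j 1)) := fun i j => rfl
  refine PosDef.of_dotProduct_mulVec_pos ?_ ?_
  · ext i j
    simp only [conjTranspose_apply, star_trivial, hG]
    exact h.symm _ _ _
  · intro v hv
    have e : star v ⬝ᵥ (gram h.inner p y *ᵥ v) = b (L (WithLp.toLp 2 v)) (L (WithLp.toLp 2 v)) := by
      have e1 : (WithLp.toLp 2 v : Coord n) = ∑ i, v i • EuclideanSpace.single i (1 : ℝ) := by
        ext k; simp [Pi.single_apply]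
      rw [e1, map_sum]
      simp only [map_smul]
      rw [bilin_sum_sum]
      simp only [dotProduct, mulVec, hG, star_trivial, Finset.mul_sum]
      exact Finset.sum_congr rfl fun i _ => Finset.sum_congr rfl fun j _ => by ring
    rw [e]
    refine h.pos _ _ ?_
    intro h0
    have h2 : L (WithLp.toLp 2 v) = L 0 := by rw [map_zero]; exact h0
    have := hinj h2
    exact hv (by simpa using congrArg WithLp.ofLp this)

lemma contDiffOn_pderiv {F : Coord n → ℝ} (hF : ContDiffOn ℝ ∞ F (extChartAt (𝓡∂ n) p).target)
    (i : Fin n) : ContDiffOn ℝ ∞ (pderiv i F) (extChartAt (𝓡∂ n) p).target := by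
  have h1 : ContDiffOn ℝ ∞ (fun y => fderivWithin ℝ F (extChartAt (𝓡∂ n) p).target y
      (EuclideanSpace.single i 1)) (extChartAt (𝓡∂ n) p).target :=
    (hF.fderivWithin (uniqueDiffOn_extChartAt_target p) (by simp)).clm_apply contDiffOn_const
  refine h1.congr fun y hy => ?_
  rw [pderiv, fderivWithin_congr_set (extChartAt_target_eventuallyEq_of_mem hy)]

lemma contDiffOn_inChart {f : M → ℝ} (hf : ContMDiff (𝓡∂ n) 𝓘(ℝ) ∞ f) :
    ContDiffOn ℝ ∞ (inChart p f) (extChartAt (𝓡∂ n) p).target := by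
  rw [← contMDiffOn_iff_contDiffOn]
  exact hf.comp_contMDiffOn (contMDiffOn_extChartAt_symm p)

/-- `G` is a field of positive definite matrices on the domain of the chart based at `p`, smooth up to
the boundary of the half-space. -/
structure IsMetricOnChart (p : M) (G : Coord n → Matrix (Fin n) (Fin n) ℝ) : Prop where
  contDiffOn : ∀ i j, ContDiffOn ℝ ∞ (fun y => G y i j) (extChartAt (𝓡∂ n) p).target
  posDef : ∀ y ∈ (extChartAt (𝓡∂ n) p).target, (G y).PosDef

variable {G : Coord n → Matrix (Fin n) (Fin n) ℝ} {f : Coord n → ℝ}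

lemma continuousOn_inv_apply {s : Set (Coord n)} (h : ∀ i j, ContinuousOn (fun y => G y i j) s)
    (hu : ∀ y ∈ s, IsUnit (G y).det) (i j : Fin n) : ContinuousOn (fun y => (G y)⁻¹ i j) s := by
  have hG : ContinuousOn G s := continuousOn_pi.2 fun i => continuousOn_pi.2 fun j => h i j
  have hd : ContinuousOn (fun y => (G y).det) s :=
    (Continuous.matrix_det continuous_id).comp_continuousOn hG
  have ha : ContinuousOn (fun y => (G y).adjugate i j) s :=
    ((Continuous.matrix_adjugate continuous_id).matrix_elem i j).comp_continuousOn hG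
  refine ((hd.inv₀ fun y hy => (hu y hy).ne_zero).mul ha).congr fun y hy => ?_
  simp [Matrix.inv_def]

lemma continuousOn_tensorNormSq {s : Set (Coord n)} (h : ∀ i j, ContinuousOn (fun y => G y i j) s)
    (hu : ∀ y ∈ s, IsUnit (G y).det) {S : Coord n → Matrix (Fin n) (Fin n) ℝ}
    (hS : ∀ i j, ContinuousOn (fun y => S y i j) s) :
    ContinuousOn (fun y => tensorNormSq (G y) (S y)) s := by
  have := continuousOn_inv_apply h hu
  simp only [tensorNormSq]
  exact continuousOn_finsetSum _ fun i _ => continuousOn_finsetSum _ fun j _ =>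
    continuousOn_finsetSum _ fun k _ => continuousOn_finsetSum _ fun l _ =>
      (((this i k).mul (this j l)).mul (hS i j)).mul (hS k l)

lemma continuousOn_coordInner {s : Set (Coord n)} (h : ∀ i j, ContinuousOn (fun y => G y i j) s)
    (hu : ∀ y ∈ s, IsUnit (G y).det) {a b : Coord n → ℝ}
    (ha : ∀ i, ContinuousOn (pderiv i a) s) (hb : ∀ i, ContinuousOn (pderiv i b) s) :
    ContinuousOn (coordInner G a b) s := by
  have := continuousOn_inv_apply h hu
  exact continuousOn_finsetSum _ fun i _ => continuousOn_finsetSum _ fun j _ =>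
      ((this i j).mul (ha i)).mul (hb j)

lemma IsMetricOnChart.isUnit_det (h : IsMetricOnChart p G)
    (hy : y ∈ (extChartAt (𝓡∂ n) p).target) : IsUnit (G y).det := (h.posDef y hy).det_pos.ne'.isUnit

lemma IsMetricOnChart.continuousOn_coordHess (h : IsMetricOnChart p G)
    (hf : ContDiffOn ℝ ∞ f (extChartAt (𝓡∂ n) p).target) (i j : Fin n) :
    ContinuousOn (fun y => coordHess G f y i j) (extChartAt (𝓡∂ n) p).target := by
  have h1 := continuousOn_inv_apply (fun i j => (h.contDiffOn i j).continuousOn)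
    (fun y hy => h.isUnit_det hy)
  have h2 := fun k i j => (contDiffOn_pderiv (h.contDiffOn i j) k).continuousOn
  have h3 := fun k => (contDiffOn_pderiv hf k).continuousOn
  have h4 := fun k l => (contDiffOn_pderiv (contDiffOn_pderiv hf k) l).continuousOn
  simp only [coordHess, of_apply]
  exact (h4 j i).sub (continuousOn_finsetSum _ fun k _ => (continuousOn_const.mul
    (continuousOn_finsetSum _ fun l _ => (h1 k l).mul
      (((h2 i j l).add (h2 j i l)).sub (h2 l i j)))).mul (h3 k))

lemma IsMetricOnChart.isMetricAt (h : IsMetricOnChart p G) (hx : x ∈ (𝓡∂ n).interior M)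
    (hp : x ∈ (extChartAt (𝓡∂ n) p).source) : IsMetricAt G (extChartAt (𝓡∂ n) p x) := by
  have hi : ∀ᶠ z in 𝓝 (extChartAt (𝓡∂ n) p x), z ∈ interiorCoords n :=
    isOpen_interiorCoords.mem_nhds (extChartAt_mem_interiorCoords hx hp)
  have ht := (eventually_extChartAt_symm hx hp univ_mem).mono fun z hz => hz.1
  exact ⟨hi.self_of_nhds, ht.eventually_nhds.mono fun z hz i j =>
    (h.contDiffOn i j).contDiffAt hz, ht.mono h.posDef⟩

lemma isMetricOnChart_gram (h : Bundle.ContMDiffRiemannianMetric (𝓡∂ n) ∞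
    (EuclideanSpace ℝ (Fin n)) (fun x : M => TangentSpace (𝓡∂ n) x)) (p : M) :
    IsMetricOnChart p (gram h.inner p) := ⟨contDiffOn_gram h p, fun _ => posDef_gram h p⟩

/-! ### Pointwise norms in different charts -/

section Norms

variable {B : BilinField n M} {W : Set M} {f : M → ℝ}

lemma IsRiemannianOn.hessT_eq (h : IsRiemannianOn B W) (hx : x ∈ W)
    (hp : x ∈ (extChartAt (𝓡∂ n) p).source) (hf : ContMDiffAt (𝓡∂ n) 𝓘(ℝ) ∞ f x) :
    hessT B f x (extChartAt (𝓡∂ n) x x) = (jac (transition x p) (extChartAt (𝓡∂ n) x x))ᵀ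
        * hessT B f p (extChartAt (𝓡∂ n) p x) * jac (transition x p) (extChartAt (𝓡∂ n) x x) := by
  have h1 := h.coordHess_eq hx hp hf
  have h2 := gram_transition B (h.interior hx) (mem_extChartAt_source (I := 𝓡∂ n) x) hp
  have h3 : inChart p f (extChartAt (𝓡∂ n) p x) = inChart x f (extChartAt (𝓡∂ n) x x) := by
    simp only [inChart, (extChartAt (𝓡∂ n) p).left_inv hp, extChartAt_to_inv]
  change coordHess (gram B x) (inChart x f) (extChartAt (𝓡∂ n) x x) - _ • _ = _ * (coordHess
    (gram B p) (inChart p f) (extChartAt (𝓡∂ n) p x) - _ • _) * _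
  rw [h1, h2, h3]
  simp only [mul_sub, sub_mul, Matrix.mul_smul, Matrix.smul_mul]

/-- The norm of `∇²f - f g` can be computed in any chart. -/
lemma IsRiemannianOn.hessTNorm_eq (h : IsRiemannianOn B W) (hx : x ∈ W)
    (hp : x ∈ (extChartAt (𝓡∂ n) p).source) (hf : ContMDiffAt (𝓡∂ n) 𝓘(ℝ) ∞ f x) :
    hessTNorm B f x = √(tensorNormSq (gram B p (extChartAt (𝓡∂ n) p x))
      (hessT B f p (extChartAt (𝓡∂ n) p x))) := by
  rw [hessTNorm, h.hessT_eq hx hp hf, tensorNormSq_transform (h.inv_gram_eq hx hp)]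

lemma IsRiemannianOn.continuousOn_hessTNorm (h : IsRiemannianOn B W)
    (hf : ContMDiffOn (𝓡∂ n) 𝓘(ℝ) ∞ f W) : ContinuousOn (hessTNorm B f) W := by
  intro x hx
  have hs := mem_extChartAt_source (I := 𝓡∂ n) x
  have hm := h.metric x x hx hs
  set φ := extChartAt (𝓡∂ n) x
  set S : Set (Coord n) := {z | IsMetricAt (gram B x) z ∧ ContDiffAt ℝ ∞ (inChart x f) z}
  have hfS : ∀ᶠ z in 𝓝 (φ x), ContDiffAt ℝ ∞ (inChart x f) z := by
    filter_upwards [eventually_extChartAt_symm (h.interior hx) hs (h.isOpen.mem_nhds hx)] with z hz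
    have := contDiffAt_inChart (h.interior hz.2) (φ.map_target hz.1)
      (hf.contMDiffAt (h.isOpen.mem_nhds hz.2))
    rwa [φ.right_inv hz.1] at this
  have hS : S ∈ 𝓝 (φ x) := hm.eventually.and hfS
  have hG : ∀ i j, ContinuousOn (fun y => gram B x y i j) S := fun i j z hz =>
    (hz.1.contDiffAt i j).continuousAt.continuousWithinAt
  have hH : ∀ i j, ContinuousOn (fun y => hessT B f x y i j) S := fun i j z hz =>
    ((hz.1.contDiffAt_coordHess hz.2 i j).continuousAt.sub
      (hz.2.continuousAt.mul (hz.1.contDiffAt i j).continuousAt)).continuousWithinAt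
  have h1 := (Real.continuous_sqrt.comp_continuousOn
    (continuousOn_tensorNormSq hG (fun z hz => hz.1.isUnit_det) hH)).continuousAt hS
  have h2 : ContinuousAt (hessTNorm B f) x := by
    refine ContinuousAt.congr (ContinuousAt.comp (f := φ) h1 (continuousAt_extChartAt x)) ?_
    filter_upwards [h.isOpen.mem_nhds hx, extChartAt_source_mem_nhds (I := 𝓡∂ n) x] with z hz hz'
    exact (h.hessTNorm_eq hz hz' (hf.contMDiffAt (h.isOpen.mem_nhds hz))).symm
  exact h2.continuousWithinAt

end Norms

/-! ### The geometry near infinity -/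

namespace AHManifold

variable (A : AHManifold n M)

lemma gram_g (p : M) (y : Coord n) :
    gram A.g p y = (inChart p A.ρ y ^ 2)⁻¹ • gram A.h.inner p y := rfl

lemma contDiffAt_inChart_ρ (hx : x ∈ (𝓡∂ n).interior M) (hp : x ∈ (extChartAt (𝓡∂ n) p).source) :
    ∀ᶠ z in 𝓝 (extChartAt (𝓡∂ n) p x), ContDiffAt ℝ ∞ (inChart p A.ρ) z := by
  have ht := (eventually_extChartAt_symm hx hp univ_mem).mono fun z hz => hz.1
  exact ht.eventually_nhds.mono fun z hz => (contDiffOn_inChart A.ρ_smooth).contDiffAt hz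

lemma isMetricAt_g (hx : x ∈ (𝓡∂ n).interior M) (hp : x ∈ (extChartAt (𝓡∂ n) p).source)
    (hr : 0 < A.ρ x) : IsMetricAt (gram A.g p) (extChartAt (𝓡∂ n) p x) := by
  refine ((isMetricOnChart_gram A.h p).isMetricAt hx hp).conformal (A.contDiffAt_inChart_ρ hx hp)
    ?_ (Eventually.of_forall (A.gram_g p))
  rwa [inChart, (extChartAt (𝓡∂ n) p).left_inv hp]

/-- The metric `g` is a smooth Riemannian metric on each open set of interior points
where `ρ > 0`. -/
lemma isRiemannianOn_g {W : Set M} (hW : IsOpen W) (hi : W ⊆ (𝓡∂ n).interior M)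
    (hr : ∀ x ∈ W, 0 < A.ρ x) : IsRiemannianOn A.g W :=
  ⟨hW, hi, fun _ x hx hp => A.isMetricAt_g (hi hx) hp (hr x hx)⟩

/-- The function `τ = 1 / ρ`. -/
def τ (x : M) : ℝ := (A.ρ x)⁻¹

lemma inChart_τ (p : M) : inChart (n := n) p A.τ = fun y => (inChart p A.ρ y)⁻¹ := rfl

lemma contMDiffAt_τ (hx : 0 < A.ρ x) : ContMDiffAt (𝓡∂ n) 𝓘(ℝ) ∞ A.τ x := by
  have h : ContDiffAt ℝ ∞ (fun s : ℝ => s⁻¹) (A.ρ x) := contDiffAt_inv ℝ hx.ne'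
  exact h.contMDiffAt.comp x (A.ρ_smooth x)

section Conformal

variable {G' : Coord n → Matrix (Fin n) (Fin n) ℝ} {r : Coord n → ℝ}

/-- The gradient of `1 / r` for the metric `r⁻² G`. -/
lemma _root_.AsympHyp.IsMetricAt.coordInner_inv_conformal (h : IsMetricAt G y)
    (hr : ContDiffAt ℝ ∞ r y) (hr0 : 0 < r y) (hG' : G' y = (r y ^ 2)⁻¹ • G y) :
    coordInner G' (fun z => (r z)⁻¹) (fun z => (r z)⁻¹) y = (r y)⁻¹ ^ 2 * coordInner G r r y := by
  have e1 : ∀ j, coordDiff (fun z => (r z)⁻¹) y j = -(r y ^ 2)⁻¹ * coordDiff r y j := by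
    intro j
    rw [coordDiff, pderiv_comp h.mem (f := fun s => s⁻¹) (hasDerivAt_inv hr0.ne').differentiableAt
      hr.diff, (hasDerivAt_inv hr0.ne').deriv]
    rfl
  have e2 : (G' y)⁻¹ = (r y ^ 2) • (G y)⁻¹ := by
    rw [hG']
    refine Matrix.inv_eq_right_inv ?_
    simp [Matrix.mul_nonsing_inv _ h.isUnit_det, smul_smul, hr0.ne']
  simp only [coordInner, e1, e2, Finset.mul_sum, Matrix.smul_apply, smul_eq_mul]
  refine Finset.sum_congr rfl fun i _ => Finset.sum_congr rfl fun j _ => ?_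
  field_simp

/-- The Hessian of `1 / r` for the metric `r⁻² G` is close to that metric times `1 / r` where
`|dr|_G` is close to `1` and `r` is small. -/
lemma _root_.AsympHyp.IsMetricAt.sqrt_tensorNormSq_hess_inv_le (h : IsMetricAt G y)
    (h' : IsMetricAt G' y) (hr : ContDiffAt ℝ ∞ r y) (hr0 : 0 < r y)
    (hG' : ∀ᶠ z in 𝓝 y, G' z = (r z ^ 2)⁻¹ • G z) :
    √(tensorNormSq (G' y) (coordHess G' (fun z => (r z)⁻¹) y - (r y)⁻¹ • G' y))
      ≤ (r y)⁻¹ * (|coordInner G r r y - 1| * √n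
        + √(r y ^ 2 * tensorNormSq (G y) (coordHess G r y))) := by
  have e : coordHess G' (fun z => (r z)⁻¹) y - (r y)⁻¹ • G' y
      = ((r y)⁻¹ * (coordInner G r r y - 1)) • G' y + (-(r y ^ 2)⁻¹) • coordHess G r y := by
    ext i j
    simp only [Matrix.sub_apply, Matrix.add_apply, Matrix.smul_apply, smul_eq_mul,
      h.coordHess_inv_conformal h' hr hr0 hG']
    ring
  have hp' := h'.posDef.self_of_nhds
  have hp := h.posDef.self_of_nhds
  rw [e]
  refine (sqrt_tensorNormSq_add_le hp' _ _).trans (le_of_eq ?_)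
  rw [sqrt_tensorNormSq_smul, sqrt_tensorNormSq_smul, tensorNormSq_self hp', hG'.self_of_nhds,
    tensorNormSq_inv_smul (by positivity) hp, Real.sqrt_mul (by positivity),
    Real.sqrt_mul (by positivity), Real.sqrt_sq (by positivity), Real.sqrt_sq hr0.le, abs_mul,
    abs_neg, abs_of_pos (inv_pos.2 hr0), abs_of_pos (inv_pos.2 (pow_pos hr0 2))]
  field_simp

end Conformal

/-- A property which holds near each point at infinity holds where `ρ` is small. -/
lemma exists_forall_lt [CompactSpace M] {P : M → Prop}
    (h : ∀ x, A.ρ x = 0 → ∀ᶠ z in 𝓝 x, P z) : ∃ ε > 0, ∀ x, A.ρ x < ε → P x := by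
  have hK : IsCompact (closure {x | ¬ P x}) := isClosed_closure.isCompact
  have hpos : ∀ x ∈ closure {x | ¬ P x}, 0 < A.ρ x := by
    intro x hx
    refine (A.ρ_nonneg x).lt_of_ne fun h0 => ?_
    exact (mem_closure_iff_frequently.1 hx) ((h x h0.symm).mono fun z hz => not_not.2 hz)
  rcases (closure {x | ¬ P x}).eq_empty_or_nonempty with he | hne
  · refine ⟨1, one_pos, fun x _ => ?_⟩
    by_contra hx
    exact (he ▸ subset_closure hx : x ∈ (∅ : Set M))
  · obtain ⟨x₀, hx₀, hmin⟩ := hK.exists_isMinOn hne A.ρ_smooth.continuous.continuousOn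
    refine ⟨A.ρ x₀, hpos x₀ hx₀, fun x hx => ?_⟩
    by_contra hP
    exact (hmin (subset_closure hP)).not_gt hx

/-- The coordinate expressions of `|dρ|²_h` and `∇²ρ` (for `h`) are continuous up to the boundary,
so that `|dρ|²_h` is close to `1` and `ρ² |∇²ρ|²_h` is close to `0` near each point at infinity.
The inner boundary is closed, so it stays away from that point. -/
lemma eventually_near_infinity {x₀ : M} (h0 : A.ρ x₀ = 0) {η : ℝ} (hη : 0 < η) :
    ∀ᶠ x in 𝓝 x₀, x ∈ (extChartAt (𝓡∂ n) x₀).source ∧ (0 < A.ρ x → x ∈ (𝓡∂ n).interior M) ∧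
      |coordInner (gram A.h.inner x₀) (inChart x₀ A.ρ) (inChart x₀ A.ρ) (extChartAt (𝓡∂ n) x₀ x)
        - 1| < η ∧
      A.ρ x ^ 2 * tensorNormSq (gram A.h.inner x₀ (extChartAt (𝓡∂ n) x₀ x))
        (coordHess (gram A.h.inner x₀) (inChart x₀ A.ρ) (extChartAt (𝓡∂ n) x₀ x)) < η ^ 2 := by
  have hm := isMetricOnChart_gram A.h x₀
  have hc := fun i j => (hm.contDiffOn i j).continuousOn
  have hρ : ContDiffOn ℝ ∞ (inChart x₀ A.ρ) _ := contDiffOn_inChart A.ρ_smooth (p := x₀)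
  have key : ∀ F : Coord n → ℝ, ContinuousOn F (extChartAt (𝓡∂ n) x₀).target →
      ContinuousAt (fun x => F (extChartAt (𝓡∂ n) x₀ x)) x₀ := fun F hF =>
    (hF.comp (continuousOn_extChartAt x₀) (extChartAt (𝓡∂ n) x₀).mapsTo).continuousAt
      (extChartAt_source_mem_nhds x₀)
  have h1 := key _ (continuousOn_coordInner hc (fun y hy => hm.isUnit_det hy)
    (fun i => (contDiffOn_pderiv hρ i).continuousOn)
    (fun i => (contDiffOn_pderiv hρ i).continuousOn))
  have h2 := key _ (continuousOn_tensorNormSq hc (fun y hy => hm.isUnit_det hy)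
    (hm.continuousOn_coordHess hρ))
  have h3 := (A.ρ_smooth.continuous.continuousAt (x := x₀)).pow 2 |>.mul h2
  have e1 : coordInner (gram A.h.inner x₀) (inChart x₀ A.ρ) (inChart x₀ A.ρ)
      (extChartAt (𝓡∂ n) x₀ x₀) = 1 := Real.sqrt_eq_one.1 (A.dρ_norm x₀ h0)
  have hb : ∀ᶠ x in 𝓝 x₀, x ∉ (𝓡∂ n).boundary M ∩ {x | 0 < A.ρ x} :=
    A.isClosed_innerBoundary.isOpen_compl.mem_nhds fun h => h.2.ne' h0
  have h1' : Tendsto (fun x => |coordInner (gram A.h.inner x₀) (inChart x₀ A.ρ) (inChart x₀ A.ρ)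
      (extChartAt (𝓡∂ n) x₀ x) - 1|) (𝓝 x₀) (𝓝 0) := by
    have := (h1.sub (continuousAt_const (y := (1 : ℝ)))).abs
    simpa only [ContinuousAt, Pi.sub_apply, e1, sub_self, abs_zero] using this
  filter_upwards [extChartAt_source_mem_nhds (I := 𝓡∂ n) x₀, hb, h1'.eventually_lt_const hη,
    h3.tendsto.eventually_lt_const (u := η ^ 2) (by simp [h0]; positivity)] with x a1 a2 a3 a4
  refine ⟨a1, fun hpos => ?_, a3, a4⟩
  rw [← (𝓡∂ n).compl_boundary]
  exact fun hx => a2 ⟨hx, hpos⟩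

/-- Near infinity `|dτ|²_g / τ²` is close to `1`, and the Hessian of `τ` is close to `τ g`. -/
lemma exists_collar [CompactSpace M] {η : ℝ} (hη : 0 < η) :
    ∃ ε > 0, ∀ x, 0 < A.ρ x → A.ρ x < ε → x ∈ (𝓡∂ n).interior M ∧
      |innerD A.g A.τ A.τ x - A.τ x ^ 2| ≤ η * A.τ x ^ 2 ∧ hessTNorm A.g A.τ x ≤ η * A.τ x := by
  -- `∇²τ - τ g` has a part `τ (|dρ|² - 1) g`, of norm `√n τ ||dρ|² - 1|`, and
  -- a part of norm `τ ρ |∇²ρ|`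
  set η' := η / (√n + 1) with hη'
  have hη0 : 0 < η' := by positivity
  have hηle : η' ≤ η := div_le_self hη.le (by linarith [Real.sqrt_nonneg n])
  obtain ⟨ε, hε, H⟩ := A.exists_forall_lt (P := fun x => ∃ p : M,
    x ∈ (extChartAt (𝓡∂ n) p).source ∧ (0 < A.ρ x → x ∈ (𝓡∂ n).interior M) ∧
      |coordInner (gram A.h.inner p) (inChart p A.ρ) (inChart p A.ρ) (extChartAt (𝓡∂ n) p x)
        - 1| < η' ∧
      A.ρ x ^ 2 * tensorNormSq (gram A.h.inner p (extChartAt (𝓡∂ n) p x))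
        (coordHess (gram A.h.inner p) (inChart p A.ρ) (extChartAt (𝓡∂ n) p x)) < η' ^ 2)
    (fun x₀ h0 => (A.eventually_near_infinity h0 hη0).mono fun x hx => ⟨x₀, hx⟩)
  refine ⟨ε, hε, fun x hpos hx => ?_⟩
  obtain ⟨p, hp, hi, h1, h2⟩ := H x hx
  have hxi := hi hpos
  have hW : IsOpen ((𝓡∂ n).interior M ∩ {x | 0 < A.ρ x}) :=
    ((𝓡∂ n).isOpen_interior (n := ∞) (by simp)).inter (isOpen_lt continuous_const A.ρ_smooth.continuous)
  have hR := A.isRiemannianOn_g hW inter_subset_left (fun x hx => hx.2)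
  have hxW : x ∈ (𝓡∂ n).interior M ∩ {x | 0 < A.ρ x} := ⟨hxi, hpos⟩
  have hm := (isMetricOnChart_gram A.h p).isMetricAt hxi hp
  have hm' := A.isMetricAt_g hxi hp hpos
  have hrx : inChart p A.ρ (extChartAt (𝓡∂ n) p x) = A.ρ x := by
    rw [inChart, (extChartAt (𝓡∂ n) p).left_inv hp]
  have hρ := contDiffAt_inChart hxi hp (A.ρ_smooth x)
  have hτ := A.contMDiffAt_τ hpos
  refine ⟨hxi, ?_, ?_⟩
  · rw [hR.innerD_eq hxW hp hτ hτ, A.inChart_τ, hm.coordInner_inv_conformal hρ (hrx ▸ hpos)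
      (A.gram_g p _), hrx, τ]
    have : (A.ρ x)⁻¹ ^ 2 * coordInner (gram A.h.inner p) (inChart p A.ρ) (inChart p A.ρ)
      (extChartAt (𝓡∂ n) p x) - (A.ρ x)⁻¹ ^ 2 = (coordInner (gram A.h.inner p) (inChart p A.ρ)
        (inChart p A.ρ) (extChartAt (𝓡∂ n) p x) - 1) * (A.ρ x)⁻¹ ^ 2 := by ring
    rw [this, abs_mul, abs_of_nonneg (sq_nonneg (A.ρ x)⁻¹)]
    exact mul_le_mul_of_nonneg_right (h1.le.trans hηle) (sq_nonneg _)
  · rw [hR.hessTNorm_eq hxW hp hτ]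
    refine (hm.sqrt_tensorNormSq_hess_inv_le hm' hρ (hrx ▸ hpos)
      (Eventually.of_forall (A.gram_g p))).trans ?_
    rw [hrx, τ, mul_comm η]
    refine mul_le_mul_of_nonneg_left ?_ (inv_nonneg.2 hpos.le)
    have h3 : √(A.ρ x ^ 2 * tensorNormSq (gram A.h.inner p (extChartAt (𝓡∂ n) p x))
        (coordHess (gram A.h.inner p) (inChart p A.ρ) (extChartAt (𝓡∂ n) p x))) ≤ η' :=
      Real.sqrt_le_iff.2 ⟨hη0.le, h2.le⟩
    have h4 := mul_le_mul_of_nonneg_right h1.le (Real.sqrt_nonneg n)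
    have h5 : η' * (√n + 1) = η := div_mul_cancel₀ _ (by positivity)
    linarith

end AHManifold
end Infinity

/-! ### The pointwise inequality -/

/-- Coercivity of the unperturbed quadratic form, in which `q` stands for `|dN|` and `κ` for
`n + 1 + 2 δ`. -/
lemma quadratic_form_lower_bound {n κ lam μ : ℝ} (hn : 2 ≤ n) (hκ : 0 < κ) (hμ0 : 0 ≤ μ)
    (hμ1 : μ ≤ 1) (hμ : μ ≤ κ / 8) (hlam : (n + 1) ^ 2 / κ + 2 * μ ≤ lam * (n - 1)) (N u q : ℝ) :
    μ * q ^ 2 + κ / 2 * N ^ 2 ≤ lam * (n - 1) * u ^ 2 + μ * q ^ 2 - μ * (n - 1) * N * u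
      - μ * (u + N) ^ 2 + κ * N ^ 2 + 2 * N * u := by
  have h1 : -(2 * μ * u ^ 2 + 2 * μ * N ^ 2) ≤ -(μ * (u + N) ^ 2) := by
    nlinarith [mul_nonneg hμ0 (sq_nonneg (u - N))]
  have h2 : μ * N ^ 2 ≤ κ / 8 * N ^ 2 := mul_le_mul_of_nonneg_right hμ (sq_nonneg N)
  have h3 : ((n + 1) ^ 2 / κ + 2 * μ) * u ^ 2 ≤ lam * (n - 1) * u ^ 2 :=
    mul_le_mul_of_nonneg_right hlam (sq_nonneg u)
  -- the coefficient of `N u` is at most `n + 1` in absolute value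
  have h4 : |2 - μ * (n - 1)| ≤ n + 1 := by
    rw [abs_le]; constructor <;> nlinarith
  have h5 : |2 - μ * (n - 1)| * |N * u| ≤ (n + 1) * |N * u| :=
    mul_le_mul_of_nonneg_right h4 (abs_nonneg _)
  have h6 : -(|2 - μ * (n - 1)| * |N * u|) ≤ (2 - μ * (n - 1)) * (N * u) := by
    rw [← abs_mul]; exact neg_abs_le _
  have h7 : (n + 1) * |N * u| ≤ κ / 4 * N ^ 2 + (n + 1) ^ 2 / κ * u ^ 2 := by
    have h8 := sq_nonneg (κ / 2 * |N| - (n + 1) * |u|)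
    have h9 : κ / 4 * N ^ 2 + (n + 1) ^ 2 / κ * u ^ 2 - (n + 1) * |N * u|
        = (κ / 2 * |N| - (n + 1) * |u|) ^ 2 / κ := by
      rw [abs_mul, ← sq_abs N, ← sq_abs u]; field_simp; ring
    have := div_nonneg h8 hκ.le
    linarith
  nlinarith

set_option maxHeartbeats 800000 in
/-- The integrand which the divergence theorem yields is coercive up to a multiple of `θ ^ 2` if
the perturbations `α`, `x₁`, `x₂`, `x₃` are small. Here `1 + α` is `|dτ|² / τ²`, `b` is
`⟨dτ, dN⟩ / τ`, `q` is `|dN|` and `θ` is `|T(N)|`; the `x`s are components of `T(τ)` and the `t`s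
are components of `T(N)`, each divided by a power of `τ`. -/
lemma exists_pointwise_bound {n δ : ℝ} (hn : 2 ≤ n) (hδ : 0 < n + 1 + 2 * δ) :
    ∃ η lam μ c C : ℝ, 0 < η ∧ η ≤ 1 / 2 ∧ 0 < c ∧ 0 ≤ C ∧
      ∀ α N b q θ x₁ x₂ x₃ t₁ t₂ t₃ : ℝ, |α| ≤ η → 0 ≤ q → 0 ≤ θ → |b| ≤ 2 * q →
        |x₁| ≤ 2 * η * q → |x₂| ≤ η * q ^ 2 → |x₃| ≤ n * η →
        |t₁| ≤ 2 * θ → |t₂| ≤ 2 * θ * q → |t₃| ≤ n * θ →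
        c * (N ^ 2 + q ^ 2) - C * θ ^ 2 ≤
          -lam * ((b - N) * ((n - 1) * ((1 + α) * N - b) + (1 + α) * t₃ - b * x₃ + x₁ - t₁)
              + ((1 + α) * x₂ - b * x₁ + (1 + α) * t₂ - b * t₁))
            + μ * (N * ((n - 1) * ((1 + α) * N - b) + (1 + α) * t₃ - b * x₃ + x₁ - t₁)
              + (1 + α) * q ^ 2 - b ^ 2)
            + (N ^ 2 * (n + x₃) + (2 * δ - 1) * (1 + α) * N ^ 2 + 2 * N * b) := by
  -- `μ` is small compared with the coefficient `κ` of `N²`; then `lam` is chosen so large that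
  -- `lam (n - 1) u²` absorbs the mixed terms `N u`, and last of all `η`, small against the total
  -- coefficient `D` of the error terms
  set κ := n + 1 + 2 * δ with hκ
  set μ := min 1 (κ / 8) with hμ
  have hμ0 : 0 < μ := lt_min one_pos (by positivity)
  set lam := ((n + 1) ^ 2 / κ + 2 * μ) / (n - 1) with hlam
  have hlam0 : 0 ≤ lam := div_nonneg (by positivity) (by linarith)
  have hlam1 : lam * (n - 1) = (n + 1) ^ 2 / κ + 2 * μ := div_mul_cancel₀ _ (by linarith)
  set D := lam * (10 * n + 8) + μ * (5 * n + 1) + n + |2 * δ - 1| with hD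
  have hD0 : 0 < D := by positivity
  set c₀ := min μ (κ / 2) with hc₀
  have hc : 0 < c₀ := lt_min hμ0 (by positivity)
  refine ⟨min (1 / 2) (c₀ / (8 * D)), lam, μ, c₀ / 2, 2 * D ^ 2 / c₀, lt_min (by norm_num)
    (by positivity), min_le_left _ _, by positivity, by positivity, ?_⟩
  set η := min (1 / 2) (c₀ / (8 * D)) with hη
  have hη0 : 0 < η := lt_min (by norm_num) (by positivity)
  have hη1 : η ≤ 1 / 2 := min_le_left _ _
  have hηD : η * (8 * D) ≤ c₀ := by
    rw [← le_div_iff₀ (by positivity)]; exact min_le_right _ _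
  intro α N b q θ x₁ x₂ x₃ t₁ t₂ t₃ hα hq hθ hb hx₁ hx₂ hx₃ ht₁ ht₂ ht₃
  -- `k` and `L` collect the errors; they are bounded in terms of `Y`
  set Y := |N| + q with hY
  have hNY : |N| ≤ Y := by linarith
  have hqY : q ≤ Y := by linarith [abs_nonneg N]
  have hY0 : 0 ≤ Y := hq.trans hqY
  have hα1 : |1 + α| ≤ 2 := by
    rw [abs_le] at hα ⊢; constructor <;> linarith
  have hu : |b - N| ≤ 2 * Y := (abs_sub _ _).trans (by linarith [abs_nonneg N])
  set k := (n - 1) * (α * N) + (1 + α) * t₃ - b * x₃ + x₁ - t₁ with hk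
  set L := (1 + α) * x₂ - b * x₁ + (1 + α) * t₂ - b * t₁ with hL
  have mulb : ∀ {r s R S : ℝ}, |r| ≤ R → |s| ≤ S → |r * s| ≤ R * S := by
    intro r s R S h1 h2
    rw [abs_mul]
    exact mul_le_mul h1 h2 (abs_nonneg _) ((abs_nonneg _).trans h1)
  have hkb : |k| ≤ 5 * n * (η * Y + θ) := by
    have e1 : |(n - 1) * (α * N)| ≤ (n - 1) * (η * |N|) :=
      mulb (abs_of_nonneg (by linarith)).le (mulb hα le_rfl)
    have e2 := mulb hα1 ht₃
    have e3 := mulb hb hx₃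
    have e4 : |k| ≤ |(n - 1) * (α * N)| + |(1 + α) * t₃| + |b * x₃| + |x₁| + |t₁| := by
      rw [hk]
      refine (abs_sub _ _).trans (add_le_add ((abs_add_le _ _).trans (add_le_add
        ((abs_sub _ _).trans (add_le_add (abs_add_le _ _) le_rfl)) le_rfl)) le_rfl)
    have e5 : 0 ≤ η * |N| := by positivity
    have e6 : 0 ≤ η * q := by positivity
    have e7 : η * Y = η * |N| + η * q := by rw [hY]; ring
    rw [e7]
    have e8 : 2 * (η * q) ≤ n * (η * q) := mul_le_mul_of_nonneg_right hn e6
    have e9 : 2 * θ ≤ n * θ := mul_le_mul_of_nonneg_right hn hθ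
    have e10 : 0 ≤ n * (η * |N|) := by positivity
    linarith only [e1, e2, e3, e4, e5, e6, e8, e9, e10, hx₁, ht₁, hθ]
  have hLb : |L| ≤ 8 * (η * Y ^ 2 + θ * Y) := by
    have e1 := mulb hα1 hx₂
    have e2 := mulb hb hx₁
    have e3 := mulb hα1 ht₂
    have e4 := mulb hb ht₁
    have e5 : |L| ≤ |(1 + α) * x₂| + |b * x₁| + |(1 + α) * t₂| + |b * t₁| := by
      rw [hL]
      exact (abs_sub _ _).trans (add_le_add ((abs_add_le _ _).trans (add_le_add
        (abs_sub _ _) le_rfl)) le_rfl)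
    have e6 : η * q ^ 2 ≤ η * Y ^ 2 := by gcongr
    have e7 : θ * q ≤ θ * Y := by gcongr
    have e8 : 0 ≤ η * Y ^ 2 := by positivity
    linarith only [e1, e2, e3, e4, e5, e6, e7, e8]
  have hmain := quadratic_form_lower_bound hn hδ hμ0.le (min_le_left _ _) (min_le_right _ _)
    hlam1.ge N (b - N) q
  have hE1 : |lam * ((b - N) * k + L)| ≤ lam * (2 * Y * (5 * n * (η * Y + θ))
      + 8 * (η * Y ^ 2 + θ * Y)) :=
    mulb (abs_of_nonneg hlam0).le ((abs_add_le _ _).trans (add_le_add (mulb hu hkb) hLb))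
  have hE2 : |μ * (N * k + α * q ^ 2)| ≤ μ * (Y * (5 * n * (η * Y + θ)) + η * Y ^ 2) := by
    refine mulb (abs_of_nonneg hμ0.le).le ((abs_add_le _ _).trans (add_le_add (mulb hNY hkb) ?_))
    refine mulb hα ?_
    rw [abs_of_nonneg (sq_nonneg q)]
    gcongr
  have hNY2 : |N ^ 2| ≤ Y ^ 2 := by rw [abs_pow]; gcongr
  have hE3 : |N ^ 2 * x₃| ≤ Y ^ 2 * (n * η) := mulb hNY2 hx₃
  have hE4 : |(2 * δ - 1) * (α * N ^ 2)| ≤ |2 * δ - 1| * (η * Y ^ 2) :=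
    mulb le_rfl (mulb hα hNY2)
  have hY2 : Y ^ 2 ≤ 2 * (N ^ 2 + q ^ 2) := by
    rw [hY, ← sq_abs N]; nlinarith [sq_nonneg (|N| - q)]
  -- the sum of the error terms
  have hsum : lam * (2 * Y * (5 * n * (η * Y + θ)) + 8 * (η * Y ^ 2 + θ * Y))
      + μ * (Y * (5 * n * (η * Y + θ)) + η * Y ^ 2) + Y ^ 2 * (n * η)
      + |2 * δ - 1| * (η * Y ^ 2) ≤ D * (η * Y ^ 2 + θ * Y) := by
    have e1 : 0 ≤ θ * Y := by positivity
    have e2 : 0 ≤ (μ + n + |2 * δ - 1|) * (θ * Y) := by positivity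
    rw [hD]
    linarith only [e2]
  have hyoung : D * (θ * Y) ≤ c₀ / 8 * Y ^ 2 + 2 * D ^ 2 / c₀ * θ ^ 2 := by
    have : c₀ / 8 * Y ^ 2 + 2 * D ^ 2 / c₀ * θ ^ 2 - D * (θ * Y)
        = (c₀ * Y - 4 * D * θ) ^ 2 / (8 * c₀) := by field_simp; ring
    have h2 : 0 ≤ (c₀ * Y - 4 * D * θ) ^ 2 / (8 * c₀) := by positivity
    linarith only [this, h2]
  have hηY : D * (η * Y ^ 2) ≤ c₀ / 8 * Y ^ 2 := by
    have := mul_le_mul_of_nonneg_right hηD (sq_nonneg Y)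
    linarith only [this]
  have hc1 : c₀ * q ^ 2 ≤ μ * q ^ 2 := mul_le_mul_of_nonneg_right (min_le_left _ _) (sq_nonneg q)
  have hc2 : c₀ * N ^ 2 ≤ κ / 2 * N ^ 2 :=
    mul_le_mul_of_nonneg_right (min_le_right _ _) (sq_nonneg N)
  have hcY : c₀ * Y ^ 2 ≤ c₀ * (2 * (N ^ 2 + q ^ 2)) := mul_le_mul_of_nonneg_left hY2 hc.le
  have hfin : -lam * ((b - N) * ((n - 1) * ((1 + α) * N - b) + (1 + α) * t₃ - b * x₃ + x₁ - t₁)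
        + L) + μ * (N * ((n - 1) * ((1 + α) * N - b) + (1 + α) * t₃ - b * x₃ + x₁ - t₁)
        + (1 + α) * q ^ 2 - b ^ 2)
      + (N ^ 2 * (n + x₃) + (2 * δ - 1) * (1 + α) * N ^ 2 + 2 * N * b)
      = (lam * (n - 1) * (b - N) ^ 2 + μ * q ^ 2 - μ * (n - 1) * N * (b - N)
        - μ * (b - N + N) ^ 2 + κ * N ^ 2 + 2 * N * (b - N)) - lam * ((b - N) * k + L)
        + μ * (N * k + α * q ^ 2) + N ^ 2 * x₃ + (2 * δ - 1) * (α * N ^ 2) := by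
    rw [hk, hκ]; ring
  rw [hfin]
  have a1 := (abs_le.1 hE1).2
  have a2 := (abs_le.1 hE2).1
  have a3 := (abs_le.1 hE3).1
  have a4 := (abs_le.1 hE4).1
  have a5 : D * (η * Y ^ 2 + θ * Y) = D * (η * Y ^ 2) + D * (θ * Y) := by ring
  linarith only [hmain, hE1, a1, a2, a3, a4, a5, hsum, hyoung, hηY, hc1, hc2, hcY, hY2]

section Integrands

/-! ### The integrands of the divergence theorem -/

variable {n : ℕ} [NeZero n] {M : Type*} [TopologicalSpace M]
  [ChartedSpace (EuclideanHalfSpace n) M] [IsManifold (𝓡∂ n) ∞ M]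
  {x : M} {B : BilinField n M} {W : Set M} {a b c f t N : M → ℝ}

/-- The value of the tensor `T(f) = ∇²f - f g` at the gradients of `a` and `b`. -/
def hessTD (B : BilinField n M) (f a b : M → ℝ) (x : M) : ℝ :=
  coordGrad (gram B x) (inChart x a) (extChartAt (𝓡∂ n) x x) ⬝ᵥ
    hessT B f x (extChartAt (𝓡∂ n) x x) *ᵥ
      coordGrad (gram B x) (inChart x b) (extChartAt (𝓡∂ n) x x)

/-- The trace of the tensor `T(f) = ∇²f - f g`. -/
def hessTTrace (B : BilinField n M) (f : M → ℝ) (x : M) : ℝ :=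
  ((gram B x (extChartAt (𝓡∂ n) x x))⁻¹ * hessT B f x (extChartAt (𝓡∂ n) x x)).trace

lemma coordHess_eq_hessT_add (B : BilinField n M) (f : M → ℝ) (x : M) :
    coordHess (gram B x) (inChart x f) (extChartAt (𝓡∂ n) x x)
      = hessT B f x (extChartAt (𝓡∂ n) x x) + f x • gram B x (extChartAt (𝓡∂ n) x x) := by
  rw [hessT, inChart_self, sub_add_cancel]
  rfl

lemma covectorNormSq_coordDiff (B : BilinField n M) (a : M → ℝ) (x : M) :
    covectorNormSq (gram B x (extChartAt (𝓡∂ n) x x))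
      (coordDiff (inChart x a) (extChartAt (𝓡∂ n) x x)) = innerD B a a x := rfl

lemma IsRiemannianOn.posDef (h : IsRiemannianOn B W) (hx : x ∈ W) :
    (gram B x (extChartAt (𝓡∂ n) x x)).PosDef :=
  (h.metric x x hx (mem_extChartAt_source x)).posDef.self_of_nhds

lemma IsRiemannianOn.isUnit_det (h : IsRiemannianOn B W) (hx : x ∈ W) :
    IsUnit (gram B x (extChartAt (𝓡∂ n) x x)).det :=
  (h.metric x x hx (mem_extChartAt_source x)).isUnit_det

lemma IsRiemannianOn.hessD_eq (h : IsRiemannianOn B W) (hx : x ∈ W) (f a b : M → ℝ) :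
    hessD B f a b x = hessTD B f a b x + f x * innerD B a b x := by
  have hu := h.isUnit_det hx
  have hs : (gram B x (extChartAt (𝓡∂ n) x x))⁻¹ᵀ = (gram B x (extChartAt (𝓡∂ n) x x))⁻¹ := by
    ext i j
    exact (h.metric x x hx (mem_extChartAt_source x)).inv_symm j i
  rw [hessD, coordHess_eq_hessT_add, add_mulVec, dotProduct_add, hessTD, smul_mulVec,
    dotProduct_smul, smul_eq_mul]
  congr 2
  rw [coordGrad, coordGrad, mulVec_mulVec, Matrix.mul_nonsing_inv _ hu, one_mulVec, innerD,
    coordInner_eq, coordGrad, dotProduct_mulVec, ← mulVec_transpose, hs]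

lemma IsRiemannianOn.lap_eq_hessTTrace (h : IsRiemannianOn B W) (hx : x ∈ W) (f : M → ℝ) :
    lap B f x = hessTTrace B f x + n * f x := by
  rw [lap, coordLap, coordHess_eq_hessT_add, Matrix.mul_add, trace_add, Matrix.mul_smul,
    Matrix.nonsing_inv_mul _ (h.isUnit_det hx), trace_smul, trace_one, hessTTrace]
  simp [mul_comm]

lemma IsRiemannianOn.innerD_self_nonneg (h : IsRiemannianOn B W) (hx : x ∈ W) (a : M → ℝ) :
    0 ≤ innerD B a a x := by
  obtain ⟨C, hC⟩ := exists_inv_eq_transpose_mul_self (h.posDef hx)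
  rw [← covectorNormSq_coordDiff, covectorNormSq_eq_sum hC]
  positivity

lemma IsRiemannianOn.sq_innerD_le (h : IsRiemannianOn B W) (hx : x ∈ W) (a b : M → ℝ) :
    innerD B a b x ^ 2 ≤ innerD B a a x * innerD B b b x := by
  have := sq_dotProduct_inv_mulVec_le (h.posDef hx)
    (coordDiff (inChart x a) (extChartAt (𝓡∂ n) x x))
    (coordDiff (inChart x b) (extChartAt (𝓡∂ n) x x))
  rw [covectorNormSq_coordDiff, covectorNormSq_coordDiff] at this
  rw [innerD, coordInner_eq]
  exact this

lemma IsRiemannianOn.abs_hessTD_le (h : IsRiemannianOn B W) (hx : x ∈ W) (f a b : M → ℝ) :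
    |hessTD B f a b x| ≤ hessTNorm B f x * √(innerD B a a x) * √(innerD B b b x) := by
  have := sq_dotProduct_mulVec_inv_le (h.posDef hx) (hessT B f x (extChartAt (𝓡∂ n) x x))
    (coordDiff (inChart x a) (extChartAt (𝓡∂ n) x x))
    (coordDiff (inChart x b) (extChartAt (𝓡∂ n) x x))
  rw [covectorNormSq_coordDiff, covectorNormSq_coordDiff] at this
  have h2 := Real.abs_le_sqrt this
  have h0 := tensorNormSq_nonneg (h.posDef hx) (hessT B f x (extChartAt (𝓡∂ n) x x))
  rwa [Real.sqrt_mul (mul_nonneg h0 (h.innerD_self_nonneg hx a)), Real.sqrt_mul h0] at h2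

lemma IsRiemannianOn.abs_hessTTrace_le (h : IsRiemannianOn B W) (hx : x ∈ W) (f : M → ℝ) :
    |hessTTrace B f x| ≤ √n * hessTNorm B f x := by
  have h2 := Real.abs_le_sqrt (sq_trace_le (h.posDef hx) (hessT B f x (extChartAt (𝓡∂ n) x x)))
  rwa [Real.sqrt_mul (Nat.cast_nonneg n)] at h2

/-- `|∇²f| ≤ |T(f)| + √n |f|`. -/
lemma IsRiemannianOn.hessianNorm_le (h : IsRiemannianOn B W) (hx : x ∈ W) (f : M → ℝ) :
    hessianNorm B f x ≤ hessTNorm B f x + √n * |f x| := by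
  have h1 := sqrt_tensorNormSq_add_le (h.posDef hx) (hessT B f x (extChartAt (𝓡∂ n) x x))
    (f x • gram B x (extChartAt (𝓡∂ n) x x))
  rw [← coordHess_eq_hessT_add, sqrt_tensorNormSq_smul, tensorNormSq_self (h.posDef hx),
    mul_comm] at h1
  exact h1

lemma IsRiemannianOn.innerD_comp_mul_mul (h : IsRiemannianOn B W) (hx : x ∈ W) {F : ℝ → ℝ}
    (hF : ∀ z ∈ W, ContDiffAt ℝ ∞ F (t z)) (ht : ContMDiffOn (𝓡∂ n) 𝓘(ℝ) ∞ t W)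
    (ha : ContMDiffOn (𝓡∂ n) 𝓘(ℝ) ∞ a W) (hb : ContMDiffOn (𝓡∂ n) 𝓘(ℝ) ∞ b W) (c : M → ℝ) :
    innerD B (fun z => F (t z) * (a z * b z)) c x
      = F (t x) * (a x * innerD B b c x + b x * innerD B a c x)
        + deriv F (t x) * (a x * b x) * innerD B t c x := by
  have hFt : ContMDiffOn (𝓡∂ n) 𝓘(ℝ) ∞ (fun z => F (t z)) W := fun z hz =>
    (hF z hz).contMDiffAt.comp_contMDiffWithinAt z (ht z hz)
  have hab : ContMDiffOn (𝓡∂ n) 𝓘(ℝ) ∞ (fun z => a z * b z) W := ha.mul hb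
  rw [h.innerD_mul hx hFt hab, h.innerD_mul hx ha hb,
    h.innerD_comp hx ((hF x hx).differentiableAt (by simp)) ht]
  ring

/-- The divergence of `F(t) w (⟨dt, dt⟩ ∇N - ⟨dt, dN⟩ ∇t)`. As this field is orthogonal to `∇t`,
there is no term with the derivative of `F`. -/
lemma IsRiemannianOn.integrand_orthogonal (h : IsRiemannianOn B W) (hx : x ∈ W) {F : ℝ → ℝ}
    (hF : ∀ z ∈ W, ContDiffAt ℝ ∞ F (t z)) (ht : ContMDiffOn (𝓡∂ n) 𝓘(ℝ) ∞ t W)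
    (hN : ContMDiffOn (𝓡∂ n) 𝓘(ℝ) ∞ N W) {w : M → ℝ} (hw : ContMDiffOn (𝓡∂ n) 𝓘(ℝ) ∞ w W) :
    (F (t x) * (w x * innerD B t t x) * lap B N x
        + innerD B (fun z => F (t z) * (w z * innerD B t t z)) N x)
      - (F (t x) * (w x * innerD B t N x) * lap B t x
        + innerD B (fun z => F (t z) * (w z * innerD B t N z)) t x)
      = F (t x) * (w x * ((n - 1) * (innerD B t t x * N x - t x * innerD B t N x)
            + innerD B t t x * hessTTrace B N x - innerD B t N x * hessTTrace B t x
            + hessTD B t t N x - hessTD B N t t x)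
          + innerD B t t x * innerD B w N x - innerD B t N x * innerD B w t x) := by
  have hA := h.contMDiffOn_innerD ht ht
  have hB := h.contMDiffOn_innerD ht hN
  have e1 : innerD B (innerD B t t) N x = 2 * hessD B t t N x := by
    rw [h.innerD_comm hx, h.innerD_innerD hx ht ht, h.hessD_comm hx ht N t]; ring
  have e2 : innerD B (innerD B t N) t x = hessD B t t N x + hessD B N t t x := by
    rw [h.innerD_comm hx, h.innerD_innerD hx ht hN]
  rw [h.innerD_comp_mul_mul hx hF ht hw hA, h.innerD_comp_mul_mul hx hF ht hw hB, e1, e2,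
    h.lap_eq_hessTTrace hx, h.lap_eq_hessTTrace hx, h.hessD_eq hx, h.hessD_eq hx]
  ring

/-- The derivative of `⟨dt, dN⟩ / t - N` in the direction of `⟨dt, dt⟩ ∇N - ⟨dt, dN⟩ ∇t`. If
`T(t) = 0` and `T(N) = 0` it vanishes. -/
lemma IsRiemannianOn.innerD_quotient_sub (h : IsRiemannianOn B W) (hx : x ∈ W)
    (ht : ContMDiffOn (𝓡∂ n) 𝓘(ℝ) ∞ t W) (ht0 : ∀ z ∈ W, 0 < t z)
    (hN : ContMDiffOn (𝓡∂ n) 𝓘(ℝ) ∞ N W) :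
    innerD B t t x * innerD B (fun z => (t z)⁻¹ * innerD B t N z - N z) N x
        - innerD B t N x * innerD B (fun z => (t z)⁻¹ * innerD B t N z - N z) t x
      = (t x)⁻¹ * (innerD B t t x * hessTD B t N N x - innerD B t N x * hessTD B t t N x
          + innerD B t t x * hessTD B N t N x - innerD B t N x * hessTD B N t t x) := by
  have hB := h.contMDiffOn_innerD ht hN
  have ht1 : ContMDiffOn (𝓡∂ n) 𝓘(ℝ) ∞ (fun z => (t z)⁻¹) W := fun z hz =>
    (contDiffAt_inv ℝ (ht0 z hz).ne').contMDiffAt.comp_contMDiffWithinAt z (ht z hz)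
  have hu : ContMDiffOn (𝓡∂ n) 𝓘(ℝ) ∞ (fun z => (t z)⁻¹ * innerD B t N z) W := ht1.mul hB
  have hc : ∀ c, innerD B (fun z => (t z)⁻¹ * innerD B t N z - N z) c x
      = (t x)⁻¹ * innerD B (innerD B t N) c x - (t x ^ 2)⁻¹ * innerD B t N x * innerD B t c x
        - innerD B N c x := by
    intro c
    rw [h.innerD_sub hx hu hN, h.innerD_mul hx ht1 hB,
      h.innerD_comp (F := fun s => s⁻¹) hx (hasDerivAt_inv (ht0 x hx).ne').differentiableAt ht,
      (hasDerivAt_inv (ht0 x hx).ne').deriv]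
    ring
  have e1 : innerD B (innerD B t N) N x = hessD B t N N x + hessD B N t N x := by
    rw [h.innerD_comm hx, h.innerD_innerD hx ht hN, h.hessD_comm hx hN N t]
  have e2 : innerD B (innerD B t N) t x = hessD B t t N x + hessD B N t t x := by
    rw [h.innerD_comm hx, h.innerD_innerD hx ht hN]
  have h0 := (ht0 x hx).ne'
  rw [hc, hc, e1, e2, h.hessD_eq hx, h.hessD_eq hx, h.hessD_eq hx, h.hessD_eq hx,
    h.innerD_comm hx N t]
  field_simp
  ring

/-- The divergence of `F(t) N² ∇t`. -/
lemma IsRiemannianOn.integrand_radial (h : IsRiemannianOn B W) (hx : x ∈ W) {F : ℝ → ℝ}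
    (hF : ∀ z ∈ W, ContDiffAt ℝ ∞ F (t z)) (ht : ContMDiffOn (𝓡∂ n) 𝓘(ℝ) ∞ t W)
    (hN : ContMDiffOn (𝓡∂ n) 𝓘(ℝ) ∞ N W) :
    F (t x) * (N x * N x) * lap B t x + innerD B (fun z => F (t z) * (N z * N z)) t x
      = F (t x) * (N x ^ 2 * (n * t x + hessTTrace B t x) + 2 * N x * innerD B t N x)
        + deriv F (t x) * N x ^ 2 * innerD B t t x := by
  rw [h.innerD_comp_mul_mul hx hF ht hN hN, h.lap_eq_hessTTrace hx, h.innerD_comm hx N t]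
  ring

end Integrands
section WeightedEstimate

/-! ### The weighted estimate -/

variable {n : ℕ} [NeZero n] {M : Type*} [TopologicalSpace M]
  [ChartedSpace (EuclideanHalfSpace n) M] [IsManifold (𝓡∂ n) ∞ M]
  {x : M} {B : BilinField n M} {W : Set M} {t N : M → ℝ}

/-- The combination of the divergences of the three fields in the proof of the weighted estimate,
without the common factor `χ(t) t^{2δ-2}` and without the term with the derivative of `χ`. -/
def estimateForm (B : BilinField n M) (t N : M → ℝ) (δ lam μ : ℝ) (x : M) : ℝ :=
  -lam * (((t x)⁻¹ * innerD B t N x - N x) *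
        ((n - 1) * (innerD B t t x * N x - t x * innerD B t N x)
          + innerD B t t x * hessTTrace B N x - innerD B t N x * hessTTrace B t x
          + hessTD B t t N x - hessTD B N t t x)
      + (t x)⁻¹ * (innerD B t t x * hessTD B t N N x - innerD B t N x * hessTD B t t N x
          + innerD B t t x * hessTD B N t N x - innerD B t N x * hessTD B N t t x))
    + μ * (N x * ((n - 1) * (innerD B t t x * N x - t x * innerD B t N x)
          + innerD B t t x * hessTTrace B N x - innerD B t N x * hessTTrace B t x
          + hessTD B t t N x - hessTD B N t t x)
      + innerD B t t x * innerD B N N x - innerD B t N x * innerD B N t x)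
    + (t x * (N x ^ 2 * (n * t x + hessTTrace B t x) + 2 * N x * innerD B t N x)
      + (2 * δ - 1) * (innerD B t t x * N x ^ 2))

/-- Coercivity of the integrand, where `|dt|² / t²` is close to `1` and `T(t)` is small compared
with `t`. -/
lemma IsRiemannianOn.estimateForm_ge (h : IsRiemannianOn B W) (hx : x ∈ W)
    {δ η lam μ c C : ℝ} (hη : η ≤ 1 / 2)
    (hbound : ∀ α N b q θ x₁ x₂ x₃ t₁ t₂ t₃ : ℝ, |α| ≤ η → 0 ≤ q → 0 ≤ θ → |b| ≤ 2 * q →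
        |x₁| ≤ 2 * η * q → |x₂| ≤ η * q ^ 2 → |x₃| ≤ n * η →
        |t₁| ≤ 2 * θ → |t₂| ≤ 2 * θ * q → |t₃| ≤ n * θ →
        c * (N ^ 2 + q ^ 2) - C * θ ^ 2 ≤
          -lam * ((b - N) * ((n - 1) * ((1 + α) * N - b) + (1 + α) * t₃ - b * x₃ + x₁ - t₁)
              + ((1 + α) * x₂ - b * x₁ + (1 + α) * t₂ - b * t₁))
            + μ * (N * ((n - 1) * ((1 + α) * N - b) + (1 + α) * t₃ - b * x₃ + x₁ - t₁)
              + (1 + α) * q ^ 2 - b ^ 2)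
            + (N ^ 2 * (n + x₃) + (2 * δ - 1) * (1 + α) * N ^ 2 + 2 * N * b))
    (ht : 0 < t x) (hA : |innerD B t t x - t x ^ 2| ≤ η * t x ^ 2)
    (hE : hessTNorm B t x ≤ η * t x) :
    t x ^ 2 * (c * (N x ^ 2 + innerD B N N x) - C * hessTNorm B N x ^ 2)
      ≤ estimateForm B t N δ lam μ x := by
  set s := t x with hs
  set A := innerD B t t x with hAdef
  set q := √(innerD B N N x) with hq
  set θ := hessTNorm B N x with hθ
  have hq2 : q ^ 2 = innerD B N N x := Real.sq_sqrt (h.innerD_self_nonneg hx N)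
  have hq0 : 0 ≤ q := Real.sqrt_nonneg _
  have hθ0 : 0 ≤ θ := Real.sqrt_nonneg _
  have hE0 : 0 ≤ hessTNorm B t x := Real.sqrt_nonneg _
  have hη0 : 0 ≤ η := nonneg_of_mul_nonneg_left (hE0.trans hE) ht
  have hn1 : (1 : ℝ) ≤ n := by exact_mod_cast NeZero.one_le
  have hsn : √(n : ℝ) ≤ n := by
    rw [Real.sqrt_le_left (by positivity)]; nlinarith
  have hA2 : A ≤ 2 * s ^ 2 := by
    have := (abs_le.1 hA).2
    nlinarith [sq_nonneg s]
  have hsA : √A ≤ 2 * s := by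
    rw [Real.sqrt_le_left (by positivity)]; nlinarith [sq_nonneg s]
  have hAA : √A * √A = A := Real.mul_self_sqrt (h.innerD_self_nonneg hx t)
  have key := hbound (A / s ^ 2 - 1) (N x) (innerD B t N x / s) q θ (hessTD B t t N x / s ^ 2)
    (hessTD B t N N x / s) (hessTTrace B t x / s) (hessTD B N t t x / s ^ 2)
    (hessTD B N t N x / s) (hessTTrace B N x) ?_ hq0 hθ0 ?_ ?_ ?_ ?_ ?_ ?_ ?_
  · have h2 := mul_le_mul_of_nonneg_left key (sq_nonneg s)
    rw [hq2] at h2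
    refine h2.trans (le_of_eq ?_)
    rw [estimateForm, h.innerD_comm hx N t, ← hs, ← hAdef]
    field_simp
    ring
  · rw [show A / s ^ 2 - 1 = (A - s ^ 2) / s ^ 2 by field_simp, abs_div,
      abs_of_pos (pow_pos ht 2), div_le_iff₀ (pow_pos ht 2)]
    exact hA
  · rw [abs_div, abs_of_pos ht, div_le_iff₀ ht]
    have h1 := Real.abs_le_sqrt (h.sq_innerD_le hx t N)
    rw [Real.sqrt_mul (h.innerD_self_nonneg hx t)] at h1
    calc _ ≤ √A * q := h1
      _ ≤ 2 * s * q := by gcongr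
      _ = _ := by ring
  · rw [abs_div, abs_of_pos (pow_pos ht 2), div_le_iff₀ (pow_pos ht 2)]
    calc _ ≤ hessTNorm B t x * √A * q := h.abs_hessTD_le hx t t N
      _ ≤ (η * s) * (2 * s) * q := by gcongr
      _ = _ := by ring
  · rw [abs_div, abs_of_pos ht, div_le_iff₀ ht]
    calc _ ≤ hessTNorm B t x * q * q := h.abs_hessTD_le hx t N N
      _ ≤ (η * s) * q * q := by gcongr
      _ = _ := by ring
  · rw [abs_div, abs_of_pos ht, div_le_iff₀ ht]
    calc _ ≤ √n * hessTNorm B t x := h.abs_hessTTrace_le hx t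
      _ ≤ n * (η * s) := by gcongr
      _ = _ := by ring
  · rw [abs_div, abs_of_pos (pow_pos ht 2), div_le_iff₀ (pow_pos ht 2)]
    calc _ ≤ θ * √A * √A := h.abs_hessTD_le hx N t t
      _ = θ * A := by rw [mul_assoc, hAA]
      _ ≤ θ * (2 * s ^ 2) := by gcongr
      _ = _ := by ring
  · rw [abs_div, abs_of_pos ht, div_le_iff₀ ht]
    calc _ ≤ θ * √A * q := h.abs_hessTD_le hx N t N
      _ ≤ θ * (2 * s) * q := by gcongr
      _ = _ := by ring
  · calc _ ≤ √n * θ := h.abs_hessTTrace_le hx N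
      _ ≤ n * θ := by gcongr

lemma IsRiemannianOn.innerD_eq_zero (h : IsRiemannianOn B W) (hx : x ∈ W)
    (hN : N =ᶠ[𝓝 x] fun _ => 0) (c : M → ℝ) : innerD B N c x = 0 := by
  rw [h.innerD_congr hx hN]
  have h0 := h.innerD_comp (a := fun _ : M => (0 : ℝ)) hx (F := fun _ => 0)
    (differentiableAt_const _) contMDiffOn_const c
  simpa using h0

lemma IsRiemannianOn.hessTNorm_eq_zero (h : IsRiemannianOn B W) (hx : x ∈ W)
    (hN : N =ᶠ[𝓝 x] fun _ => 0) : hessTNorm B N x = 0 := by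
  have h1 : hessT B N x (extChartAt (𝓡∂ n) x x) = 0 := by
    change coordHess (gram B x) (inChart x N) (extChartAt (𝓡∂ n) x x) - _ = 0
    rw [coordHess_congr (inChart_eventuallyEq (h.interior hx) (mem_extChartAt_source x) hN),
      inChart_self, hN.self_of_nhds, zero_smul, sub_zero]
    ext i j
    have h3 : ∀ i, pderiv (n := n) i (fun _ => (0 : ℝ)) = fun _ => 0 := by
      intro i; ext y
      simp [pderiv]
    have h2 : ∀ i, pderiv i (inChart (n := n) x fun _ => (0 : ℝ)) = fun _ => 0 := h3
    simp [coordHess, h2, h3]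
  rw [hessTNorm, h1]
  simp [tensorNormSq]

/-- The divergence theorem, applied to the three fields. The sum `F` of the divergences exceeds
the form by a multiple of `χ' ≥ 0`. -/
lemma IsRiemannianOn.integral_weight_mul_estimateForm_nonpos [T2Space M] [CompactSpace M]
    [MeasurableSpace M] [BorelSpace M] (h : IsRiemannianOn B W)
    (ht : ContMDiffOn (𝓡∂ n) 𝓘(ℝ) ∞ t W) (ht0 : ∀ z ∈ W, 0 < t z)
    (hN : ContMDiffOn (𝓡∂ n) 𝓘(ℝ) ∞ N W) {χ : ℝ → ℝ} (hχ : ContDiff ℝ ∞ χ)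
    (hχ' : ∀ s, 0 ≤ deriv χ s) {K : Set M} (hK : IsCompact K) (hKW : K ⊆ W)
    (hKχ : ∀ z ∈ W, z ∉ K → χ (t z) = 0 ∨ N =ᶠ[𝓝 z] fun _ => 0) (δ lam μ : ℝ) :
    ∃ F : M → ℝ, IntegrableOn F W (riemannianMeasure B) ∧
      ∫ z in W, F z ∂(riemannianMeasure B) = 0 ∧
      ∀ z ∈ W, χ (t z) * t z ^ (2 * δ - 2) * estimateForm B t N δ lam μ z ≤ F z := by
  have hF : ∀ (r : ℝ), ∀ z ∈ W, ContDiffAt ℝ ∞ (fun s => χ s * s ^ r) (t z) := fun r z hz =>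
    hχ.contDiffAt.mul (Real.contDiffAt_rpow_const_of_ne (ht0 z hz).ne')
  have hFt : ∀ (r : ℝ), ContMDiffOn (𝓡∂ n) 𝓘(ℝ) ∞ (fun z => χ (t z) * t z ^ r) W :=
    fun r z hz => (hF r z hz).contMDiffAt.comp_contMDiffWithinAt z (ht z hz)
  have hA := h.contMDiffOn_innerD ht ht
  have hB := h.contMDiffOn_innerD ht hN
  have ht1 : ContMDiffOn (𝓡∂ n) 𝓘(ℝ) ∞ (fun z => (t z)⁻¹) W := fun z hz =>
    (contDiffAt_inv ℝ (ht0 z hz).ne').contMDiffAt.comp_contMDiffWithinAt z (ht z hz)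
  set u : M → ℝ := fun z => (t z)⁻¹ * innerD B t N z - N z with hu
  have hus : ContMDiffOn (𝓡∂ n) 𝓘(ℝ) ∞ u W := (ht1.mul hB).sub hN
  have hN0 : ∀ z ∈ W, z ∉ K → χ (t z) = 0 ∨ (N z = 0 ∧ u z = 0) := by
    intro z hz hzK
    refine (hKχ z hz hzK).imp_right fun h0 => ⟨h0.self_of_nhds, ?_⟩
    rw [hu]
    simp only [h.innerD_comm hz t N, h.innerD_eq_zero hz h0, h0.self_of_nhds, mul_zero, sub_zero]
  have g1 := h.green hK hKW ((hFt (2 * δ - 2)).mul (hus.mul hA)) hN fun z hz hzK => by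
    rcases hN0 z hz hzK with h0 | h0 <;> simp [h0]
  have g2 := h.green hK hKW ((hFt (2 * δ - 2)).mul (hus.mul hB)) ht fun z hz hzK => by
    rcases hN0 z hz hzK with h0 | h0 <;> simp [h0]
  have g3 := h.green hK hKW ((hFt (2 * δ - 2)).mul (hN.mul hA)) hN fun z hz hzK => by
    rcases hN0 z hz hzK with h0 | h0 <;> simp [h0]
  have g4 := h.green hK hKW ((hFt (2 * δ - 2)).mul (hN.mul hB)) ht fun z hz hzK => by
    rcases hN0 z hz hzK with h0 | h0 <;> simp [h0]
  have g5 := h.green hK hKW ((hFt (2 * δ - 1)).mul (hN.mul hN)) ht fun z hz hzK => by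
    rcases hN0 z hz hzK with h0 | h0 <;> simp [h0]
  refine ⟨_, (((g1.1.sub g2.1).const_mul (-lam)).add ((g3.1.sub g4.1).const_mul μ)).add g5.1,
    ?_, ?_⟩
  · have i1 := g1.1.sub g2.1
    have i2 := g3.1.sub g4.1
    rw [integral_add' ((i1.const_mul (-lam)).add (i2.const_mul μ)) g5.1,
      integral_add' (i1.const_mul (-lam)) (i2.const_mul μ), integral_const_mul, integral_const_mul,
      integral_sub' g1.1 g2.1, integral_sub' g3.1 g4.1, g1.2, g2.2, g3.2, g4.2, g5.2]
    simp
  · intro z hz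
    have hs := ht0 z hz
    have i1 := h.integrand_orthogonal hz (hF (2 * δ - 2)) ht hN hus
    have i2 := h.integrand_orthogonal hz (hF (2 * δ - 2)) ht hN hN
    have i3 := h.integrand_radial hz (hF (2 * δ - 1)) ht hN
    have i4 : innerD B t t z * innerD B u N z - innerD B t N z * innerD B u t z = _ :=
      h.innerD_quotient_sub hz ht ht0 hN
    have hd : deriv (fun s => χ s * s ^ (2 * δ - 1)) (t z)
        = deriv χ (t z) * t z ^ (2 * δ - 1) + (2 * δ - 1) * χ (t z) * t z ^ (2 * δ - 2) := by
      have h1 := ((hχ.differentiable (by simp)).differentiableAt (x := t z)).hasDerivAt.mul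
        (Real.hasDerivAt_rpow_const (x := t z) (p := 2 * δ - 1) (Or.inl hs.ne'))
      rw [show (fun s => χ s * s ^ (2 * δ - 1)) = χ * fun s => s ^ (2 * δ - 1) from rfl, h1.deriv,
        show 2 * δ - 1 - 1 = 2 * δ - 2 by ring]
      ring
    have hp : t z ^ (2 * δ - 1) = t z ^ (2 * δ - 2) * t z := by
      rw [← Real.rpow_add_one hs.ne']; congr 1; ring
    have hpos : 0 ≤ deriv χ (t z) * t z ^ (2 * δ - 1) * (N z ^ 2 * innerD B t t z) :=
      mul_nonneg (mul_nonneg (hχ' _) (Real.rpow_nonneg hs.le _))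
        (mul_nonneg (sq_nonneg _) (h.innerD_self_nonneg hz t))
    simp only [Pi.add_apply, Pi.sub_apply, Pi.mul_apply]
    have e : (-lam * (_ - _) + μ * (_ - _) + _ : ℝ) = _ :=
      congrArg₂ (· + ·) (congrArg₂ (· + ·) (congrArg (-lam * ·) i1) (congrArg (μ * ·) i2)) i3
    refine le_trans ?_ (le_of_eq e.symm)
    have huz : u z = (t z)⁻¹ * innerD B t N z - N z := rfl
    rw [hd, hp, sub_eq_iff_eq_add.1 i4, huz, estimateForm]
    rw [hp] at hpos
    linarith only [hpos]

/-- The weighted `L²` estimate with a smooth cut-off: `∫ χ(t) t^{2δ} (N² + |dN|²)` is controlled by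
`∫ χ(t) t^{2δ} |T(N)|²` if `|dt|² / t²` is close to `1` and `∇²t` is close to `t g`. -/
lemma IsRiemannianOn.integral_cutoff_le [T2Space M] [CompactSpace M]
    [MeasurableSpace M] [BorelSpace M] (h : IsRiemannianOn B W)
    (ht : ContMDiffOn (𝓡∂ n) 𝓘(ℝ) ∞ t W) (ht0 : ∀ z ∈ W, 0 < t z)
    (hN : ContMDiffOn (𝓡∂ n) 𝓘(ℝ) ∞ N W) {χ : ℝ → ℝ} (hχ : ContDiff ℝ ∞ χ) (hχ0 : ∀ s, 0 ≤ χ s)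
    (hχ' : ∀ s, 0 ≤ deriv χ s) {K : Set M} (hK : IsCompact K) (hKW : K ⊆ W)
    (hKχ : ∀ z ∈ W, z ∉ K → χ (t z) = 0 ∨ N =ᶠ[𝓝 z] fun _ => 0) {δ lam μ c C : ℝ}
    (hform : ∀ z ∈ W, t z ^ 2 * (c * (N z ^ 2 + innerD B N N z) - C * hessTNorm B N z ^ 2)
      ≤ estimateForm B t N δ lam μ z) :
    c * ∫ z in W, χ (t z) * (t z ^ (2 * δ) * (N z ^ 2 + innerD B N N z)) ∂(riemannianMeasure B)
      ≤ C * ∫ z in W, χ (t z) * (t z ^ (2 * δ) * hessTNorm B N z ^ 2) ∂(riemannianMeasure B) := by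
  obtain ⟨F, hF, hF0, hFle⟩ := h.integral_weight_mul_estimateForm_nonpos ht ht0 hN hχ hχ' hK hKW
    hKχ δ lam μ
  have hc : ContinuousOn (fun z => χ (t z)) W := hχ.continuous.comp_continuousOn ht.continuousOn
  have hw : ContinuousOn (fun z => t z ^ (2 * δ)) W :=
    ht.continuousOn.rpow_const fun z hz => Or.inl (ht0 z hz).ne'
  have i1 : IntegrableOn (fun z => χ (t z) * (t z ^ (2 * δ) * (N z ^ 2 + innerD B N N z))) W
      (riemannianMeasure B) := by
    refine h.integrableOn hK hKW (hc.mul (hw.mul ((hN.continuousOn.pow 2).add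
      (h.contMDiffOn_innerD hN hN).continuousOn))) fun z hz hzK => ?_
    rcases hKχ z hz hzK with h0 | h0
    · rw [h0, zero_mul]
    · rw [h.innerD_eq_zero hz h0, h0.self_of_nhds]; simp
  have i2 : IntegrableOn (fun z => χ (t z) * (t z ^ (2 * δ) * hessTNorm B N z ^ 2)) W
      (riemannianMeasure B) := by
    refine h.integrableOn hK hKW (hc.mul (hw.mul ((h.continuousOn_hessTNorm hN).pow 2)))
      fun z hz hzK => ?_
    rcases hKχ z hz hzK with h0 | h0
    · rw [h0, zero_mul]
    · rw [h.hessTNorm_eq_zero hz h0]; simp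
  have hle := setIntegral_mono_on ((i1.const_mul c).sub (i2.const_mul C)) hF
    h.isOpen.measurableSet fun z hz => by
      refine le_trans ?_ (hFle z hz)
      have hp : t z ^ (2 * δ) = t z ^ (2 * δ - 2) * t z ^ 2 := by
        rw [← Real.rpow_natCast, ← Real.rpow_add (ht0 z hz)]; congr 1; push_cast; ring
      have := mul_le_mul_of_nonneg_left (hform z hz)
        (mul_nonneg (hχ0 (t z)) (Real.rpow_nonneg (ht0 z hz).le (2 * δ - 2)))
      refine le_trans (le_of_eq ?_) this
      simp only [Pi.sub_apply]
      rw [hp]; ring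
  rw [hF0, integral_sub' (i1.const_mul c) (i2.const_mul C), integral_const_mul,
    integral_const_mul] at hle
  linarith

end WeightedEstimate

/-! ### Sharp cut-offs as limits of smooth ones -/

/-- A smooth nondecreasing function which vanishes on `(-∞, a]` and is equal to `1`
on `[b, ∞)`. -/
def cutoff (a b s : ℝ) : ℝ := Real.smoothTransition ((s - a) / (b - a))

section Cutoff

variable {a b s : ℝ}

lemma contDiff_cutoff (a b : ℝ) : ContDiff ℝ ∞ (cutoff a b) :=
  Real.smoothTransition.contDiff.comp ((contDiff_id.sub contDiff_const).div_const _)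

lemma cutoff_nonneg (a b s : ℝ) : 0 ≤ cutoff a b s := Real.smoothTransition.nonneg _

lemma cutoff_le_one (a b s : ℝ) : cutoff a b s ≤ 1 := Real.smoothTransition.le_one _

lemma cutoff_eq_zero (hab : a < b) (h : s ≤ a) : cutoff a b s = 0 :=
  Real.smoothTransition.zero_of_nonpos
    (div_nonpos_of_nonpos_of_nonneg (by linarith) (by linarith))

lemma cutoff_eq_one (hab : a < b) (h : b ≤ s) : cutoff a b s = 1 :=
  Real.smoothTransition.one_of_one_le (by rw [le_div_iff₀ (by linarith)]; linarith)

lemma deriv_cutoff_nonneg (hab : a < b) (s : ℝ) : 0 ≤ deriv (cutoff a b) s := by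
  refine Monotone.deriv_nonneg fun x y hxy => Real.smoothTransition.monotone ?_
  exact div_le_div_of_nonneg_right (by linarith) (by linarith)

end Cutoff

section Final

variable {n : ℕ} [NeZero n] {M : Type*} [TopologicalSpace M]
  [ChartedSpace (EuclideanHalfSpace n) M] [IsManifold (𝓡∂ n) ∞ M]

/-- The integrals with the cut-offs, whose transition intervals `(a k, b)` shrink to the point `b`,
tend to the integral over `{b ≤ t}`. -/
lemma IsRiemannianOn.tendsto_integral_cutoff [T2Space M] [CompactSpace M] [MeasurableSpace M]
    [BorelSpace M] {B : BilinField n M} {W K : Set M} {t f : M → ℝ} (h : IsRiemannianOn B W)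
    (hK : IsCompact K) (hKW : K ⊆ W) (ht : ContinuousOn t W) (htm : Measurable t)
    (hf : ContinuousOn f W) {a : ℕ → ℝ} {a₀ b : ℝ} (ha₀ : ∀ k, a₀ ≤ a k) (hab : ∀ k, a k < b)
    (ha : Tendsto a atTop (𝓝 b)) (hKf : ∀ z ∈ W, z ∉ K → t z ≤ a₀ ∨ f z = 0) :
    Tendsto (fun k => ∫ z in W, cutoff (a k) b (t z) * f z ∂(riemannianMeasure B)) atTop
      (𝓝 (∫ z in W ∩ {z | b ≤ t z}, f z ∂(riemannianMeasure B))) := by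
  have hW := h.isOpen.measurableSet
  rw [← setIntegral_indicator (measurableSet_le measurable_const htm)]
  refine tendsto_integral_of_dominated_convergence (K.indicator fun z => |f z|) ?_ ?_ ?_ ?_
  · intro k
    exact ((((contDiff_cutoff (a k) b).continuous).comp_continuousOn ht).mul
      hf).aestronglyMeasurable hW
  · rw [integrable_indicator_iff hK.measurableSet, IntegrableOn,
      Measure.restrict_restrict hK.measurableSet, inter_eq_left.2 hKW]
    exact h.integrableOn_of_isCompact hK hKW (hf.mono hKW).abs
  · intro k
    filter_upwards [ae_restrict_mem hW] with z hz
    rw [norm_mul, Real.norm_eq_abs, abs_of_nonneg (cutoff_nonneg _ _ _), Real.norm_eq_abs]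
    by_cases hzK : z ∈ K
    · rw [indicator_of_mem hzK]
      exact mul_le_of_le_one_left (abs_nonneg _) (cutoff_le_one _ _ _)
    · rw [indicator_of_notMem hzK]
      rcases hKf z hz hzK with h0 | h0
      · rw [cutoff_eq_zero (hab k) (h0.trans (ha₀ k)), zero_mul]
      · rw [h0, abs_zero, mul_zero]
  · refine Eventually.of_forall fun z => ?_
    rcases le_or_gt b (t z) with hz | hz
    · rw [indicator_of_mem (by exact hz)]
      refine tendsto_const_nhds.congr fun k => ?_
      rw [cutoff_eq_one (hab k) hz, one_mul]
    · rw [indicator_of_notMem (by exact not_le.2 hz)]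
      refine tendsto_const_nhds.congr' ?_
      filter_upwards [ha.eventually_const_le hz] with k hk
      rw [cutoff_eq_zero (hab k) hk, zero_mul]

lemma eLpNorm_two_eq_sqrt_integral {α : Type*} [MeasurableSpace α] {μ : Measure α} {f : α → ℝ}
    (hf : AEStronglyMeasurable f μ) (hi : Integrable (fun x => f x ^ 2) μ) :
    eLpNorm f 2 μ = ENNReal.ofReal √(∫ x, f x ^ 2 ∂μ) := by
  rw [((memLp_two_iff_integrable_sq hf).2 hi).eLpNorm_eq_integral_rpow_norm (by simp) (by simp)]
  simp [Real.sqrt_eq_rpow]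

/-! ### The estimate near infinity -/

namespace AHManifold

variable (A : AHManifold n M) {R : ℝ} {N : M → ℝ}

/-- A test function is smooth on a full neighbourhood `{0 < ρ < ε}` of infinity which contains
`E_R`. -/
lemma IsTest.exists_contMDiffOn [CompactSpace M] (hN : A.IsTest R N) {ε₀ : ℝ}
    (hε₀ : Real.exp (-2 * R) < ε₀) : ∃ ε, Real.exp (-2 * R) < ε ∧ ε ≤ ε₀ ∧
      ContMDiffOn (𝓡∂ n) 𝓘(ℝ) ∞ N {x | 0 < A.ρ x ∧ A.ρ x < ε} := by
  obtain ⟨⟨U, hU, hEU, hNU⟩, -⟩ := hN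
  set e := Real.exp (-2 * R) with he
  have hρ := A.ρ_smooth.continuous
  have hK : IsCompact ({x | e ≤ A.ρ x} ∩ Uᶜ) :=
    ((isClosed_le continuous_const hρ).inter hU.isClosed_compl).isCompact
  obtain ⟨m, hm, hmK⟩ : ∃ m, e < m ∧ ∀ x, e ≤ A.ρ x → x ∉ U → m ≤ A.ρ x := by
    rcases ({x | e ≤ A.ρ x} ∩ Uᶜ).eq_empty_or_nonempty with h0 | hne
    · refine ⟨e + 1, by linarith, fun x hx hxU => ?_⟩
      exact absurd (h0 ▸ (⟨hx, hxU⟩ : x ∈ {x | e ≤ A.ρ x} ∩ Uᶜ)) (notMem_empty x)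
    · obtain ⟨x₀, hx₀, hmin⟩ := hK.exists_isMinOn hne hρ.continuousOn
      refine ⟨A.ρ x₀, lt_of_le_of_ne hx₀.1 fun h => hx₀.2 (hEU ⟨?_, h.ge⟩),
        fun x hx hxU => hmin ⟨hx, hxU⟩⟩
      rw [← h]; exact Real.exp_pos _
  refine ⟨min m ε₀, lt_min hm hε₀, min_le_right _ _, hNU.mono fun x hx => ?_⟩
  by_contra hxU
  rcases le_total (A.ρ x) e with h1 | h1
  · exact hxU (hEU ⟨hx.1, h1⟩)
  · exact (hmK x h1 hxU).not_gt (hx.2.trans_le (min_le_left _ _))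

/-- A test function vanishes near infinity. -/
lemma IsTest.exists_eventuallyEq_zero (hN : A.IsTest R N) : ∃ c, 0 < c ∧
    ∀ x, 0 < A.ρ x → A.ρ x < c → N =ᶠ[𝓝 x] fun _ => 0 := by
  obtain ⟨-, K, hK, hKE, hN0⟩ := hN
  have hρ := A.ρ_smooth.continuous
  obtain ⟨m, hm, hmK⟩ : ∃ m, 0 < m ∧ ∀ x ∈ K, m ≤ A.ρ x := by
    rcases K.eq_empty_or_nonempty with h0 | hne
    · exact ⟨1, one_pos, fun x hx => absurd (h0 ▸ hx) (notMem_empty x)⟩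
    · obtain ⟨x₀, hx₀, hmin⟩ := hK.exists_isMinOn hne hρ.continuousOn
      exact ⟨A.ρ x₀, (hKE hx₀).1, fun x hx => hmin hx⟩
  refine ⟨min m (Real.exp (-2 * R)), lt_min hm (Real.exp_pos _), fun x hx hxm => ?_⟩
  filter_upwards [(isOpen_lt continuous_const hρ).mem_nhds hx,
    (isOpen_lt hρ continuous_const).mem_nhds hxm] with z hz hzm
  exact hN0 z ⟨hz, hzm.le.trans (min_le_right _ _)⟩
    fun hzK => (hmK z hzK).not_gt (lt_of_lt_of_le hzm (min_le_left _ _))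

lemma measurable_τ [MeasurableSpace M] [BorelSpace M] : Measurable A.τ :=
  A.ρ_smooth.continuous.measurable.inv

/-- The weighted estimate on `E_R`, in terms of integrals. -/
lemma exists_integral_le [T2Space M] [CompactSpace M] [MeasurableSpace M] [BorelSpace M]
    {δ : ℝ} (hn : (2 : ℝ) ≤ n) (hδ : 0 < n + 1 + 2 * δ) :
    ∃ R₀ : ℝ, 0 < R₀ ∧ ∃ D : ℝ, 0 ≤ D ∧ ∀ R, R₀ < R → ∀ N : M → ℝ, A.IsTest R N →
      ∃ W : Set M, IsRiemannianOn A.g W ∧ (∀ x ∈ W, 0 < A.ρ x) ∧ A.E R ⊆ W ∧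
      ContMDiffOn (𝓡∂ n) 𝓘(ℝ) ∞ N W ∧
      (∀ f : M → ℝ, ContinuousOn f W → (∀ x ∈ W, N =ᶠ[𝓝 x] (fun _ => 0) → f x = 0) →
        IntegrableOn f (A.E R) (riemannianMeasure A.g)) ∧
      ∫ x in A.E R, A.τ x ^ (2 * δ) * (N x ^ 2 + innerD A.g N N x) ∂(riemannianMeasure A.g)
        ≤ D * ∫ x in A.E R, A.τ x ^ (2 * δ) * hessTNorm A.g N x ^ 2 ∂(riemannianMeasure A.g) := by
  obtain ⟨η, lam, μ, c, C, hη, hη2, hc, hC, hbound⟩ := exists_pointwise_bound hn hδ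
  obtain ⟨ε₀, hε₀, hcollar⟩ := A.exists_collar hη
  refine ⟨max 1 (-Real.log ε₀ / 2), by positivity, C / c, by positivity, fun R hR N hN => ?_⟩
  set e := Real.exp (-2 * R) with he
  have he0 : 0 < e := Real.exp_pos _
  have heε : e < ε₀ := by
    have := (le_max_right _ _).trans_lt hR
    rw [he, ← Real.lt_log_iff_exp_lt hε₀]
    linarith
  obtain ⟨ε, heε1, hεε₀, hNW⟩ := IsTest.exists_contMDiffOn A hN heε
  obtain ⟨m, hm, hNm⟩ := IsTest.exists_eventuallyEq_zero A hN
  have hρ := A.ρ_smooth.continuous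
  set W := {x | 0 < A.ρ x ∧ A.ρ x < ε} with hW
  have hWo : IsOpen W := (isOpen_lt continuous_const hρ).inter (isOpen_lt hρ continuous_const)
  have h : IsRiemannianOn A.g W := A.isRiemannianOn_g hWo
    (fun x hx => (hcollar x hx.1 (hx.2.trans_le hεε₀)).1) fun x hx => hx.1
  have hτ : ContMDiffOn (𝓡∂ n) 𝓘(ℝ) ∞ A.τ W := fun x hx =>
    (A.contMDiffAt_τ hx.1).contMDiffWithinAt
  have hτ0 : ∀ x ∈ W, 0 < A.τ x := fun x hx => inv_pos.2 hx.1
  have hE : A.E R = W ∩ {x | e⁻¹ ≤ A.τ x} := by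
    ext x
    refine ⟨fun hx => ⟨⟨hx.1, hx.2.trans_lt heε1⟩, inv_anti₀ hx.1 hx.2⟩, fun hx => ⟨hx.1.1, ?_⟩⟩
    exact (inv_le_inv₀ he0 hx.1.1).1 hx.2
  have hEm : MeasurableSet (A.E R) := by
    rw [hE]
    exact hWo.measurableSet.inter (measurableSet_le measurable_const A.measurable_τ)
  -- the compact sets which contain the supports of the integrands
  set K : ℝ → Set M := fun r => {x | m ≤ A.ρ x ∧ A.ρ x ≤ r} with hKdef
  have hK : ∀ r, IsCompact (K r) := fun r =>
    ((isClosed_le continuous_const hρ).inter (isClosed_le hρ continuous_const)).isCompact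
  have hKW : ∀ r < ε, K r ⊆ W := fun r hr x hx => ⟨hm.trans_le hx.1, hx.2.trans_lt hr⟩
  have hKN : ∀ r, 0 < r → ∀ x ∈ W, x ∉ K r → A.τ x ≤ r⁻¹ ∨ N =ᶠ[𝓝 x] fun _ => 0 := by
    intro r hr x hx hxK
    rcases lt_or_ge (A.ρ x) m with h1 | h1
    · exact Or.inr (hNm x hx.1 h1)
    · have h2 : r < A.ρ x := not_le.1 fun h2 => hxK ⟨h1, h2⟩
      exact Or.inl (inv_anti₀ hr h2.le)
  refine ⟨W, h, fun x hx => hx.1, hE ▸ inter_subset_left, hNW, fun f hf hf0 => ?_, ?_⟩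
  · refine (h.integrableOn_of_isCompact (hK e) (hKW e heε1) (hf.mono (hKW e heε1))
      ).of_forall_sdiff_eq_zero hEm fun x hx => ?_
    have hxW : x ∈ W := (hE ▸ hx.1 : x ∈ W ∩ _).1
    refine hf0 x hxW (hNm x hxW.1 (not_le.1 fun h1 => hx.2 ⟨h1, hx.1.2⟩))
  · -- the cut-offs vanish where `τ ≤ a k`, and are equal to `1` on `E_R`
    set a : ℕ → ℝ := fun k => e⁻¹ - (e⁻¹ - ε⁻¹) / ((k : ℝ) + 2) with ha
    have hε0 : 0 < ε := he0.trans heε1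
    have hd : 0 < e⁻¹ - ε⁻¹ := sub_pos.2 (inv_strictAnti₀ he0 heε1)
    have hab : ∀ k, a k < e⁻¹ := fun k => sub_lt_self _ (by positivity)
    have ha₀ : ∀ k, a 0 ≤ a k := fun k => by
      refine sub_le_sub_left (div_le_div_of_nonneg_left hd.le (by norm_num) ?_) _
      have : (0 : ℝ) ≤ k := k.cast_nonneg
      push_cast; linarith
    have ha₁ : ε⁻¹ < a 0 := by
      simp only [ha, CharP.cast_eq_zero, zero_add]; linarith
    have hlim : Tendsto a atTop (𝓝 e⁻¹) := by
      have h1 : Tendsto (fun k : ℕ => (k : ℝ) + 2) atTop atTop :=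
        tendsto_atTop_add_const_right _ _ tendsto_natCast_atTop_atTop
      simpa using (tendsto_const_nhds (x := e⁻¹)).sub (h1.const_div_atTop (e⁻¹ - ε⁻¹))
    have hr : (a 0)⁻¹ < ε := inv_lt_of_inv_lt₀ hε0 ha₁
    have hr0 : 0 < (a 0)⁻¹ := inv_pos.2 ((inv_pos.2 hε0).trans ha₁)
    have hw : ContinuousOn (fun x => A.τ x ^ (2 * δ)) W :=
      hτ.continuousOn.rpow_const fun x hx => Or.inl (hτ0 x hx).ne'
    have hKN' : ∀ x ∈ W, x ∉ K (a 0)⁻¹ → A.τ x ≤ a 0 ∨ N =ᶠ[𝓝 x] fun _ => 0 := by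
      simpa using hKN _ hr0
    have hcut : ∀ k, c * ∫ x in W, cutoff (a k) e⁻¹ (A.τ x) *
          (A.τ x ^ (2 * δ) * (N x ^ 2 + innerD A.g N N x)) ∂(riemannianMeasure A.g)
        ≤ C * ∫ x in W, cutoff (a k) e⁻¹ (A.τ x) *
          (A.τ x ^ (2 * δ) * hessTNorm A.g N x ^ 2) ∂(riemannianMeasure A.g) := fun k =>
      h.integral_cutoff_le hτ hτ0 hNW (contDiff_cutoff _ _) (cutoff_nonneg _ _)
        (deriv_cutoff_nonneg (hab k)) (hK _) (hKW _ hr)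
        (fun x hx hxK => (hKN' x hx hxK).imp_left fun h1 =>
          cutoff_eq_zero (hab k) (h1.trans (ha₀ k)))
        (fun x hx => h.estimateForm_ge hx hη2 hbound (hτ0 x hx)
          (hcollar x hx.1 (hx.2.trans_le hεε₀)).2.1 (hcollar x hx.1 (hx.2.trans_le hεε₀)).2.2)
    have hL := h.tendsto_integral_cutoff (hK _) (hKW _ hr) hτ.continuousOn A.measurable_τ
      (hw.mul ((hNW.continuousOn.pow 2).add (h.contMDiffOn_innerD hNW hNW).continuousOn)) ha₀ hab
      hlim fun x hx hxK => (hKN' x hx hxK).imp_right fun h0 => by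
        simp [h.innerD_eq_zero hx h0, h0.self_of_nhds]
    have hRt := h.tendsto_integral_cutoff (hK _) (hKW _ hr) hτ.continuousOn A.measurable_τ
      (hw.mul ((h.continuousOn_hessTNorm hNW).pow 2)) ha₀ hab
      hlim fun x hx hxK => (hKN' x hx hxK).imp_right fun h0 => by
        simp [h.hessTNorm_eq_zero hx h0]
    rw [← hE] at hL hRt
    have := le_of_tendsto_of_tendsto' (hL.const_mul c) (hRt.const_mul C) hcut
    rw [div_mul_eq_mul_div, le_div_iff₀' hc]
    exact this

lemma measurableSet_E [MeasurableSpace M] [BorelSpace M] (R : ℝ) : MeasurableSet (A.E R) :=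
  (measurableSet_lt measurable_const A.ρ_smooth.continuous.measurable).inter
    (measurableSet_le A.ρ_smooth.continuous.measurable measurable_const)

section Norms

variable [MeasurableSpace M] [BorelSpace M] {W : Set M} {u v : M → ℝ} {δ : ℝ}

lemma sq_rpow_mul {x : M} (hx : 0 < A.ρ x) (δ r : ℝ) :
    (A.ρ x ^ (-δ) * r) ^ 2 = A.τ x ^ (2 * δ) * r ^ 2 := by
  rw [mul_pow, τ, Real.inv_rpow hx.le, ← Real.rpow_neg hx.le, ← Real.rpow_natCast, ← Real.rpow_mul hx.le]
  congr 2; push_cast; ring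

lemma aestronglyMeasurable_weight_mul (hEW : A.E R ⊆ W) (hu : ContinuousOn u W) :
    AEStronglyMeasurable (fun x => A.ρ x ^ (-δ) * u x)
      ((riemannianMeasure A.g).restrict (A.E R)) := by
  refine ContinuousOn.aestronglyMeasurable ?_ (A.measurableSet_E R)
  exact (A.ρ_smooth.continuous.continuousOn.rpow_const fun x hx => Or.inl hx.1.ne').mul
    (hu.mono hEW)

lemma normL2_eq (hEW : A.E R ⊆ W) (hu : ContinuousOn u W)
    (hi : IntegrableOn (fun x => A.τ x ^ (2 * δ) * u x ^ 2) (A.E R) (riemannianMeasure A.g)) :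
    A.normL2 (-δ) (A.E R) u = ENNReal.ofReal
      √(∫ x in A.E R, A.τ x ^ (2 * δ) * u x ^ 2 ∂(riemannianMeasure A.g)) := by
  have e : ∀ x ∈ A.E R, (A.ρ x ^ (-δ) * u x) ^ 2 = A.τ x ^ (2 * δ) * u x ^ 2 := fun x hx =>
    A.sq_rpow_mul hx.1 δ (u x)
  rw [normL2, eLpNorm_two_eq_sqrt_integral (A.aestronglyMeasurable_weight_mul hEW hu),
    setIntegral_congr_fun (A.measurableSet_E R) e]
  exact hi.congr_fun (fun x hx => (e x hx).symm) (A.measurableSet_E R)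

end Norms

end AHManifold
end Final
end AsympHyp

end

/-! ### The estimate in weighted Sobolev norms -/

theorem mainTheorem3 {n : ℕ} [NeZero n] {M : Type*} [TopologicalSpace M]
    [ChartedSpace (EuclideanHalfSpace n) M] [IsManifold (𝓡∂ n) ∞ M]
    [CompactSpace M] [T2Space M] [MeasurableSpace M] [BorelSpace M]
    (A : AsympHyp.AHManifold n M) (δ : ℝ) (hδ : δ ∈ Ioo (-((n : ℝ) + 1) / 2) (-1)) :
    ∃ R₀ : ℝ, 0 < R₀ ∧ ∃ c : ℝ≥0, 0 < c ∧ ∀ R : ℝ, R₀ < R →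
      ∀ N : M → ℝ, A.IsTest R N →
        A.normW22 (-δ) (A.E R) N
          ≤ c * A.normL2 (-δ) (A.E R) (AsympHyp.hessTNorm A.g N) := by
  obtain ⟨h1, h2⟩ := hδ
  have hn : (2 : ℝ) ≤ n := by
    have h3 : (1 : ℝ) < n := by linarith
    have h4 : 1 < n := by exact_mod_cast h3
    exact_mod_cast h4
  obtain ⟨R₀, hR₀, D, hD, hmain⟩ := A.exists_integral_le hn (δ := δ) (by linarith)
  lift D to ℝ≥0 using hD
  refine ⟨R₀, hR₀, 1 + (2 + NNReal.sqrt n) * NNReal.sqrt D, by positivity,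
    fun R hR N hN => ?_⟩
  obtain ⟨W, h, hρ, hEW, hNW, hint, hle⟩ := hmain R hR N hN
  have hE := A.measurableSet_E R
  have hw : ContinuousOn (fun x => A.τ x ^ (2 * δ)) W := fun x hx =>
    ((A.contMDiffAt_τ (hρ x hx)).continuousAt.rpow_const
      (Or.inl (inv_pos.2 (hρ x hx)).ne')).continuousWithinAt
  have hw0 : ∀ x ∈ A.E R, 0 ≤ A.τ x ^ (2 * δ) := fun x hx =>
    Real.rpow_nonneg (inv_pos.2 hx.1).le _
  have cN : ContinuousOn (fun x => |N x|) W := hNW.continuousOn.abs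
  have cI := (h.contMDiffOn_innerD hNW hNW).continuousOn
  have cD : ContinuousOn (AsympHyp.differentialNorm A.g N) W := cI.sqrt
  have cT := h.continuousOn_hessTNorm hNW
  have hI0 : ∀ x ∈ W, 0 ≤ AsympHyp.innerD A.g N N x := fun x hx => h.innerD_self_nonneg hx N
  have hD2 : ∀ x ∈ W, AsympHyp.differentialNorm A.g N x ^ 2 = AsympHyp.innerD A.g N N x :=
    fun x hx => Real.sq_sqrt (hI0 x hx)
  have iN := hint _ (hw.mul (cN.pow 2)) fun x hx h0 => by simp [h0.self_of_nhds]
  have iD := hint _ (hw.mul (cD.pow 2)) fun x hx h0 => by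
    simp [hD2 x hx, h.innerD_eq_zero hx h0]
  have iT := hint _ (hw.mul (cT.pow 2)) fun x hx h0 => by simp [h.hessTNorm_eq_zero hx h0]
  have iS := hint _ (hw.mul ((hNW.continuousOn.pow 2).add cI)) fun x hx h0 => by
    simp [h.innerD_eq_zero hx h0, h0.self_of_nhds]
  have eT := A.normL2_eq hEW cT iT
  -- a function whose square is at most `N² + |dN|²` has norm at most `√D ‖T(N)‖`
  have hbound : ∀ u : M → ℝ, ContinuousOn u W →
      IntegrableOn (fun x => A.τ x ^ (2 * δ) * u x ^ 2) (A.E R)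
        (AsympHyp.riemannianMeasure A.g) →
      (∀ x ∈ A.E R, u x ^ 2 ≤ N x ^ 2 + AsympHyp.innerD A.g N N x) →
      A.normL2 (-δ) (A.E R) u ≤ (NNReal.sqrt D : ℝ≥0)
        * A.normL2 (-δ) (A.E R) (AsympHyp.hessTNorm A.g N) := by
    intro u hu hi hule
    rw [eT, A.normL2_eq hEW hu hi, ENNReal.coe_nnreal_eq, ← ENNReal.ofReal_mul (by positivity),
      Real.coe_sqrt, ← Real.sqrt_mul D.coe_nonneg]
    refine ENNReal.ofReal_le_ofReal (Real.sqrt_le_sqrt (le_trans ?_ hle))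
    exact setIntegral_mono_on hi iS hE fun x hx =>
      mul_le_mul_of_nonneg_left (hule x hx) (hw0 x hx)
  have bN := hbound _ cN iN fun x hx => by
    rw [sq_abs]; linarith [hI0 x (hEW hx)]
  have bD := hbound _ cD iD fun x hx => by
    rw [hD2 x (hEW hx)]; linarith [sq_nonneg (N x)]
  have bH : A.normL2 (-δ) (A.E R) (AsympHyp.hessianNorm A.g N)
      ≤ A.normL2 (-δ) (A.E R) (AsympHyp.hessTNorm A.g N)
        + (NNReal.sqrt n : ℝ≥0) * A.normL2 (-δ) (A.E R) (fun x => |N x|) := by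
    have h3 := eLpNorm_add_le (A.aestronglyMeasurable_weight_mul (δ := δ) hEW cT)
      ((A.aestronglyMeasurable_weight_mul (δ := δ) hEW cN).const_mul √n) (p := 2) (by norm_num)
    refine ((eLpNorm_mono_ae ?_).trans h3).trans (add_le_add le_rfl (le_of_eq ?_))
    · filter_upwards [ae_restrict_mem hE] with x hx
      have hr := Real.rpow_nonneg hx.1.le (-δ)
      have hT0 : 0 ≤ AsympHyp.hessTNorm A.g N x := Real.sqrt_nonneg _
      have hH0 : 0 ≤ AsympHyp.hessianNorm A.g N x := Real.sqrt_nonneg _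
      rw [Real.norm_of_nonneg (mul_nonneg hr hH0), Real.norm_of_nonneg
        (by simp only [Pi.add_apply]; positivity)]
      have := mul_le_mul_of_nonneg_left (h.hessianNorm_le (hEW hx) N) hr
      simp only [Pi.add_apply]
      linarith
    have h5 := eLpNorm_const_smul (√n : ℝ) (fun x => A.ρ x ^ (-δ) * |N x|) 2
      ((AsympHyp.riemannianMeasure A.g).restrict (A.E R))
    refine h5.trans ?_
    congr 1
    rw [Real.enorm_of_nonneg (Real.sqrt_nonneg _), ENNReal.coe_nnreal_eq]
    simp
  calc A.normW22 (-δ) (A.E R) N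
      ≤ (NNReal.sqrt D : ℝ≥0) * A.normL2 (-δ) (A.E R) (AsympHyp.hessTNorm A.g N)
        + (NNReal.sqrt D : ℝ≥0) * A.normL2 (-δ) (A.E R) (AsympHyp.hessTNorm A.g N)
        + (A.normL2 (-δ) (A.E R) (AsympHyp.hessTNorm A.g N) + (NNReal.sqrt n : ℝ≥0)
          * ((NNReal.sqrt D : ℝ≥0) * A.normL2 (-δ) (A.E R) (AsympHyp.hessTNorm A.g N))) :=
        add_le_add (add_le_add bN bD) (bH.trans (add_le_add le_rfl (mul_le_mul_right bN _)))
    _ = _ := by push_cast; ring
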